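/- The following is a theorem of ZF (no form of Choice is assumed); that is, it holds in every model of ZF. Conventions. A set $X$ is finite if it is equipotent with a natural number, and Dedekind-finite if every injective function from $X$ to $X$ is surjective (otherwise it is Dedekind-infinite). $X$ is Cohen-finite if the set $\mathrm{Fin}(X)$ of all finite subsets of $X$ is Dedekind-finite. A Russell set is a Dedekind-finite set that is the union of a sequence $A_0, A_1, \dots$ of pairwise disjoint two-element sets. The reals $\mathbb{R}$ are the complete ordered field (which exists in ZF) and $\mathbb{C}=\mathbb{R}[i]$. For a set $X$, $\ell^2(X)$ is the inner product space of all $\eta\colon X\to\mathbb{C}$ for which the sums $\sum_{x\in F}|\eta(x)|^2$ over finite $F\subseteq X$ are bounded, and $\langle\eta,\zeta\rangle=\sum_{x\in X}\eta(x)\overline{\zeta(x)}$ is the limit of the finite sums along the finite subsets of $X$. An orthonormal basis is an orthonormal set whose closed linear span is the whole space, and $\cong$ denotes isometric linear isomorphism. Statement. Let $X$ be a Dedekind-finite set which is not Cohen-finite. Then: (1) $\ell^2(X)\cong\ell^2(X\sqcup\mathbb{N})$. (2) $\ell^2(X)$ has an orthonormal basis equipotent with $X$, which is Dedekind-finite,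 and an orthonormal basis equipotent with $X\sqcup\mathbb{N}$, which is Dedekind-infinite; in particular $\ell^2(X)$ has two orthonormal bases of different cardinalities. (3) Let $Y$ be a set that differs from $X$ by finitely many points, i.e. $|X|+m=|Y|+n$ for some $m,n\in\mathbb{N}$ (so $Y$ arises from $X$, up to a bijection, by adding $m$ points and removing $n$ points). Then $\ell^2(Y)\cong\ell^2(X)$. If $m\neq n$, then $|Y|\neq|X|$. If $X$ is a Russell set, then $Y$ is a Russell set if and only if $m-n$ is even. -/

import Mathlib

universe u

namespace ZFHilbert

/-! ## Models of ZF -/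

/-- The relation symbols of the language of set theory: one binary symbol. -/
inductive SetRel : ℕ → Type
  | mem : SetRel 2

/-- The first-order language of set theory. -/
def setLang : FirstOrder.Language.{0, 0} := ⟨fun _ => Empty, SetRel⟩

/-- The membership relation of a structure for the language of set theory. -/
def Mem {M : Type u} [setLang.Structure M] (x y : M) : Prop :=
  FirstOrder.Language.Structure.RelMap (L := setLang) SetRel.mem ![x, y]

/-- In `M`, the set `z` is empty. -/
def IsEmptySet {M : Type u} [setLang.Structure M] (z : M) : Prop := ∀ x, ¬ Mem x z

/-- In `M`, `s = x ∪ {x}`. -/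
def IsSucc {M : Type u} [setLang.Structure M] (s x : M) : Prop := ∀ y, Mem y s ↔ Mem y x ∨ y = x

/-- In `M`, the set `w` contains the empty set and is closed under `x ↦ x ∪ {x}`. -/
def IsInductive {M : Type u} [setLang.Structure M] (w : M) : Prop :=
  (∃ z, Mem z w ∧ IsEmptySet z) ∧ ∀ x, Mem x w → ∃ s, Mem s w ∧ IsSucc s x

/-- `M` is a model of ZF (Zermelo–Fraenkel set theory without Choice).  Separation and
Replacement are the usual schemes: they range over the classes and class relations that are
first-order definable over `M` with parameters. -/
structure IsModelZF (M : Type u) [setLang.Structure M] : Prop where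
  extensionality : ∀ x y : M, (∀ z, Mem z x ↔ Mem z y) → x = y
  foundation : ∀ x : M, (∃ y, Mem y x) → ∃ y, Mem y x ∧ ∀ z, Mem z y → ¬ Mem z x
  pairing : ∀ a b : M, ∃ p, ∀ z, Mem z p ↔ z = a ∨ z = b
  union : ∀ x : M, ∃ s, ∀ z, Mem z s ↔ ∃ y, Mem y x ∧ Mem z y
  powerset : ∀ x : M, ∃ p, ∀ z, Mem z p ↔ ∀ y, Mem y z → Mem y x
  infinity : ∃ w : M, IsInductive w
  separation : ∀ S : Set M, (Set.univ : Set M).Definable₁ setLang S →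
    ∀ a : M, ∃ b, ∀ x, Mem x b ↔ Mem x a ∧ x ∈ S
  replacement : ∀ G : Set (M × M), (Set.univ : Set M).Definable₂ setLang G →
    ∀ a : M, (∀ x, Mem x a → ∃! y, (x, y) ∈ G) → ∃ b, ∀ y, Mem y b ↔ ∃ x, Mem x a ∧ (x, y) ∈ G

/-! ## Sets and functions that belong to the model

All mathematical notions below are those of the model.  A type `α` whose elements stand for
certain sets of the model carries an instance of `Coded M α`, which says which set stands for which
element.  Subsets, functions and relations on such types are taken into account only if they are
themselves sets of the model (`Internal`). -/

/-- In `M`, `p` is the (Kuratowski) ordered pair `{{a}, {a, b}}`. -/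
def IsPair {M : Type u} [setLang.Structure M] (p a b : M) : Prop :=
  ∀ z, Mem z p ↔ (∀ w, Mem w z ↔ w = a) ∨ (∀ w, Mem w z ↔ w = a ∨ w = b)

/-- `Code x m`: the set `m` of the model is the object `x`. -/
class Coded (M : Type u) [setLang.Structure M] (α : Type u) where
  Code : α → M → Prop

/-- The object `x` is a set of the model `M`. -/
def Internal (M : Type u) [setLang.Structure M] {α : Type u} [Coded M α] (x : α) : Prop :=
  ∃ m : M, Coded.Code x m

instance instCodedSelf (M : Type u) [setLang.Structure M] : Coded M M where
  Code x m := m = x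

instance instCodedSubtype (M : Type u) [setLang.Structure M] {α : Type u} [Coded M α]
    (p : α → Prop) : Coded M {x : α // p x} where
  Code x m := Coded.Code x.1 m

instance instCodedProd (M : Type u) [setLang.Structure M] {α β : Type u} [Coded M α] [Coded M β] :
    Coded M (α × β) where
  Code x m := ∃ a b : M, Coded.Code x.1 a ∧ Coded.Code x.2 b ∧ IsPair m a b

/-- Elements of a disjoint union are the pairs `(a, ∅)` and `(b, {∅})`. -/
instance instCodedSum (M : Type u) [setLang.Structure M] {α β : Type u} [Coded M α] [Coded M β] :
    Coded M (α ⊕ β) where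
  Code x m := match x with
    | .inl y => ∃ a o : M, Coded.Code y a ∧ IsEmptySet o ∧ IsPair m a o
    | .inr y => ∃ b i : M, Coded.Code y b ∧ (∀ z, Mem z i ↔ IsEmptySet z) ∧ IsPair m b i

/-- A set of objects is the set of the model that has precisely these elements. -/
instance instCodedSet (M : Type u) [setLang.Structure M] {α : Type u} [Coded M α] :
    Coded M (Set α) where
  Code S m := ∀ y : M, Mem y m ↔ ∃ x ∈ S, Coded.Code x y

/-- A function is its graph. -/
instance instCodedFun (M : Type u) [setLang.Structure M] {α β : Type u} [Coded M α] [Coded M β] :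
    Coded M (α → β) where
  Code f m := ∀ p : M, Mem p m ↔ ∃ x : α, Coded.Code (x, f x) p

/-- The type of elements (in the sense of `M`) of the set `X`. -/
abbrev El {M : Type u} [setLang.Structure M] (X : M) : Type u := {x : M // Mem x X}

/-- The set `ℕ` of the model: the elements of the least inductive set. -/
abbrev Nat' (M : Type u) [setLang.Structure M] : Type u :=
  {n : M // ∀ w : M, IsInductive w → Mem n w}

/-- In `M`, there is a bijection between `α` and `β`. -/
def Equipotent (M : Type u) [setLang.Structure M] (α β : Type u) [Coded M α] [Coded M β] : Prop :=
  ∃ f : α → β, Internal M f ∧ Function.Bijective f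

/-- In `M`, the set `α` is equipotent with a natural number `n = {0, …, n - 1}`. -/
def IsFinite (M : Type u) [setLang.Structure M] (α : Type u) [Coded M α] : Prop :=
  ∃ n : Nat' M, Equipotent M α (El n.1)

/-- In `M`, every injective function from `α` to itself is surjective. -/
def DedekindFinite (M : Type u) [setLang.Structure M] (α : Type u) [Coded M α] : Prop :=
  ∀ f : α → α, Internal M f → Function.Injective f → Function.Surjective f

/-- The set `Fin(α)` of all finite subsets of `α`, in the sense of `M`. -/
abbrev Fin' (M : Type u) [setLang.Structure M] (α : Type u) [Coded M α] : Type u :=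
  {F : Set α // Internal M F ∧ IsFinite M {x : α // x ∈ F}}

/-- In `M`, the set `Fin(α)` is Dedekind-finite. -/
def CohenFinite (M : Type u) [setLang.Structure M] (α : Type u) [Coded M α] : Prop :=
  DedekindFinite M (Fin' M α)

/-- In `M`, the set `α` is a Russell set: it is Dedekind-finite, and it is the union of a sequence
`A₀, A₁, …` of pairwise disjoint two-element sets. -/
def IsRussell (M : Type u) [setLang.Structure M] (α : Type u) [Coded M α] : Prop :=
  DedekindFinite M α ∧ ∃ A : Nat' M → Set α, Internal M A ∧
    (∀ n, ∃ a b, a ≠ b ∧ A n = {a, b}) ∧ (∀ m n, m ≠ n → Disjoint (A m) (A n)) ∧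
    ⋃ n, A n = Set.univ

/-- In `M`, the natural number `n` is even. -/
def IsEvenNat {M : Type u} [setLang.Structure M] (n : Nat' M) : Prop :=
  ∃ k : Nat' M, Equipotent M (El n.1) (El k.1 ⊕ El k.1)

/-! ## Real and complex numbers of the model -/

/-- The real numbers of `M`: what is in `M` a complete ordered field.  Its operations and its order
are sets of `M`, and every nonempty bounded set of reals that is a set of `M` has a supremum. -/
structure RealField (M : Type u) [setLang.Structure M] where
  carrier : M
  field : Field (El carrier)
  order : LinearOrder (El carrier)
  strictOrdered : IsStrictOrderedRing (El carrier)
  internal_add : Internal M (fun p : El carrier × El carrier => p.1 + p.2)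
  internal_mul : Internal M (fun p : El carrier × El carrier => p.1 * p.2)
  internal_le : Internal M {p : El carrier × El carrier | p.1 ≤ p.2}
  complete : ∀ S : Set (El carrier), Internal M S → S.Nonempty → BddAbove S → ∃ s, IsLUB S s

/-- The type of real numbers of the model. -/
abbrev RealField.Re {M : Type u} [setLang.Structure M] (R : RealField M) : Type u := El R.carrier

instance instFieldRe {M : Type u} [setLang.Structure M] (R : RealField M) : Field R.Re := R.field

noncomputable instance instLinearOrderRe {M : Type u} [setLang.Structure M] (R : RealField M) :
    LinearOrder R.Re := R.order

instance instIsStrictOrderedRingRe {M : Type u} [setLang.Structure M] (R : RealField M) :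
    IsStrictOrderedRing R.Re := R.strictOrdered

/-- The type of complex numbers of the model: `x + y i` with `x`, `y` real and `i ^ 2 = -1`.
Here `star` is complex conjugation and `QuadraticAlgebra.norm z` is `x ^ 2 + y ^ 2 = |z| ^ 2`. -/
abbrev RealField.Cx {M : Type u} [setLang.Structure M] (R : RealField M) : Type u :=
  QuadraticAlgebra R.Re (-1) 0

/-- A complex number is the pair of its real and imaginary part. -/
instance instCodedCx (M : Type u) [setLang.Structure M] (R : RealField M) : Coded M R.Cx where
  Code z m := Coded.Code (z.re, z.im) m

/-! ## The Hilbert spaces `ℓ²(ι)` of the model -/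

/-- `σ` is the function that maps each finite set `F ⊆ ι` of the model to the sum `∑ x ∈ F, a x`,
which is defined by recursion on `F`. -/
def IsFinSums (M : Type u) [setLang.Structure M] {ι A : Type u} [Coded M ι] [Coded M A]
    [AddCommMonoid A] (a : ι → A) (σ : Fin' M ι → A) : Prop :=
  Internal M σ ∧ (∀ F, F.1 = ∅ → σ F = 0) ∧
    ∀ (F G : Fin' M ι) (x : ι), x ∉ F.1 → G.1 = insert x F.1 → σ G = σ F + a x

/-- `∑ x, a x = t` for a nonnegative function `a`: the supremum of the finite sums is `t`. -/
def HasTotal {M : Type u} [setLang.Structure M] (R : RealField M) {ι : Type u} [Coded M ι]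
    (a : ι → R.Re) (t : R.Re) : Prop :=
  ∃ σ : Fin' M ι → R.Re, IsFinSums M a σ ∧ IsLUB (Set.range σ) t

/-- The space `ℓ²(ι)` of the model: the functions `η : ι → ℂ` of the model for which
`∑ x, |η x| ^ 2` is finite. -/
def Ell2 {M : Type u} [setLang.Structure M] (R : RealField M) (ι : Type u) [Coded M ι] : Type u :=
  {η : ι → R.Cx // Internal M η ∧ ∃ t, HasTotal R (fun x => QuadraticAlgebra.norm (η x)) t}

instance instCodedEll2 (M : Type u) [setLang.Structure M] (R : RealField M) (ι : Type u)
    [Coded M ι] : Coded M (Ell2 R ι) where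
  Code η m := Coded.Code η.1 m

/-- `⟨η, ζ⟩ = c`: the finite sums `∑ x ∈ F, η x * star (ζ x)`, indexed by the finite sets `F`
directed by inclusion, converge to `c`. -/
def HasInner {M : Type u} [setLang.Structure M] {R : RealField M} {ι : Type u} [Coded M ι]
    (η ζ : Ell2 R ι) (c : R.Cx) : Prop :=
  ∃ σ : Fin' M ι → R.Cx, IsFinSums M (fun x => η.1 x * star (ζ.1 x)) σ ∧
    ∀ ε : R.Re, 0 < ε → ∃ F₀ : Fin' M ι, ∀ F : Fin' M ι, F₀.1 ⊆ F.1 →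
      QuadraticAlgebra.norm (σ F - c) < ε

/-- `ℓ²(ι)` and `ℓ²(κ)` are isometrically isomorphic in the model: there is in the model a linear
bijection between them that preserves the inner product. -/
def Ell2Iso {M : Type u} [setLang.Structure M] (R : RealField M) (ι κ : Type u) [Coded M ι]
    [Coded M κ] : Prop :=
  ∃ U : Ell2 R ι → Ell2 R κ, Internal M U ∧ Function.Bijective U ∧
    (∀ (c : R.Cx) (η ζ ξ : Ell2 R ι), ξ.1 = c • η.1 + ζ.1 → (U ξ).1 = c • (U η).1 + (U ζ).1) ∧
    ∀ (η ζ : Ell2 R ι) (c : R.Cx), HasInner η ζ c → HasInner (U η) (U ζ) c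

/-- The set `S` of vectors is a closed linear subspace of `ℓ²(ι)`. -/
structure IsClosedSubspace {M : Type u} [setLang.Structure M] {R : RealField M} {ι : Type u}
    [Coded M ι] (S : Set (Ell2 R ι)) : Prop where
  zero : ∀ ξ : Ell2 R ι, ξ.1 = 0 → ξ ∈ S
  smul_add : ∀ (c : R.Cx) (η ζ ξ : Ell2 R ι), η ∈ S → ζ ∈ S → ξ.1 = c • η.1 + ζ.1 → ξ ∈ S
  closed : ∀ ξ : Ell2 R ι, (∀ ε : R.Re, 0 < ε → ∃ η ∈ S, ∃ t < ε,
    HasTotal R (fun x => QuadraticAlgebra.norm (ξ.1 x - η.1 x)) t) → ξ ∈ S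

/-- In the model, `B` is an orthonormal basis of `ℓ²(ι)`: it is orthonormal, and its closed linear
span is the whole space. -/
structure IsOrthonormalBasis {M : Type u} [setLang.Structure M] {R : RealField M} {ι : Type u}
    [Coded M ι] (B : Set (Ell2 R ι)) : Prop where
  internal : Internal M B
  unit : ∀ e ∈ B, HasInner e e 1
  orthogonal : ∀ e ∈ B, ∀ f ∈ B, e ≠ f → HasInner e f 0
  span : ∀ S : Set (Ell2 R ι), Internal M S → IsClosedSubspace S → B ⊆ S → S = Set.univ

end ZFHilbert

open ZFHilbert

namespace ZFHilbert

set_option linter.unusedSectionVars false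

variable {M : Type u} [setLang.Structure M]

/-! Everything rests on one orthonormal sequence. If the set of finite subsets of `X` is
Dedekind-infinite, it contains an injective sequence of finite sets. A finite set has only finitely
many subsets, so one can repeatedly pass to the first member of the sequence that is not contained
in the union of those used before, and subtract that union. This gives disjoint nonempty finite sets
`A n` (`exists_disjoint_seq`). Their normalised indicators are orthonormal, so ℓ²(X) is the
orthogonal sum of a copy of ℓ²(ℕ), recorded by the coefficients `coef`, and of the space of
functions whose sum over every `A n` vanishes. Splitting ℕ into even and odd numbers gives ℓ²(ℕ) ≅
ℓ²(ℕ) ⊕ ℓ²(ℕ), hence ℓ²(X) ≅ ℓ²(X ⊔ ℕ) (`ell2Iso_sum_nat`). No element of any `A n` is ever chosen,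
so this does not conflict with `X` being Dedekind-finite.

An isometric isomorphism from ℓ²(κ) carries the unit vectors to an orthonormal basis equipotent with
κ (`exists_orthonormalBasis`); κ = X and κ = X ⊔ ℕ give the two bases. If `Y` differs from `X` by
finitely many points, the difference is absorbed by ℕ (`equipotent_sum_nat`), and a tail of the
blocks survives in `Y` (`exists_disjoint_seq_of_equipotent`), so ℓ²(Y) ≅ ℓ²(Y ⊔ ℕ) ≅ ℓ²(X ⊔ ℕ) ≅
ℓ²(X). The cardinalities differ for m ≠ n because finite sets can be cancelled against a
Dedekind-finite set (`nat_eq_of_equipotent_sum`).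

For Russell sets, a sequence of pairs is encoded as a fixed-point-free involution together with an
enumeration of its orbits. Two points can be added or removed (`HasPairing.add_two`,
`HasPairing.remove_two`). Adding a single point is impossible: there would be an involution σ
without fixed points and an involution τ with exactly one fixed point p. The orbit of p under τσ
returns to p by Dedekind-finiteness, and τ reflects this cycle, which forces a further fixed point
of σ or of τ (`HasPairing.not_add_one`).

All of this takes place inside the model `M`. `MSet` says that the objects of a type form a set of
`M`; `DefP` and `DefF` say that a predicate or function belongs to `M`. These are closed under
connectives, quantifiers over such types, composition and the usual constructions, so that
`fun_prop` can verify them. Induction over `Nat'`, which may be nonstandard, and over `Fin'` is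
available for such predicates only. External choice does no harm: a function obtained by it enters
`M` only through a definable description of its values. Finally, `nonempty_realField` constructs the
reals of `M` from Cauchy sequences of rationals. -/

/-- Finitary predicates on `M` that are first-order definable with parameters. -/
def BDef {ι : Type*} (P : (ι → M) → Prop) : Prop := (Set.univ : Set M).Definable setLang {v | P v}

/-! ### First-order definability over the structure -/

section base
variable {ι : Type*} {P Q : (ι → M) → Prop}

theorem BDef.and (hP : BDef P) (hQ : BDef Q) : BDef fun v => P v ∧ Q v := Set.Definable.inter hP hQ
theorem BDef.or (hP : BDef P) (hQ : BDef Q) : BDef fun v => P v ∨ Q v := Set.Definable.union hP hQ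
theorem BDef.not (hP : BDef P) : BDef fun v => ¬ P v := Set.Definable.compl hP
theorem BDef.imp (hP : BDef P) (hQ : BDef Q) : BDef fun v => P v → Q v := by
  simpa only [imp_iff_not_or] using hP.not.or hQ
theorem BDef.iff (hP : BDef P) (hQ : BDef Q) : BDef fun v => P v ↔ Q v := by
  simpa only [iff_iff_implies_and_implies] using (hP.imp hQ).and (hQ.imp hP)
-- Existential quantification is projection along `some`: the variable `none` is the bound one.
theorem BDef.ex [Finite ι] {P : (ι → M) → M → Prop}
    (h : BDef fun w : Option ι → M => P (fun i => w (some i)) (w none)) :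
    BDef fun v => ∃ m, P v m := by
  have := Set.Definable.image_comp h (some : ι → Option ι)
  unfold BDef
  convert this using 1
  ext v
  constructor
  · rintro ⟨m, hm⟩
    exact ⟨fun o => o.elim m v, hm, rfl⟩
  · rintro ⟨w, hw, rfl⟩
    exact ⟨_, hw⟩
theorem BDef.all [Finite ι] {P : (ι → M) → M → Prop}
    (h : BDef fun w : Option ι → M => P (fun i => w (some i)) (w none)) :
    BDef fun v => ∀ m, P v m := by
  have := (BDef.ex (P := fun v m => ¬ P v m) h.not).not
  simpa only [not_exists, not_not] using this
theorem BDef.mem (i j : ι) : BDef fun v : ι → M => Mem (v i) (v j) := by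
  refine Set.definable_iff_exists_formula_sum.2 ⟨FirstOrder.Language.Relations.formula
    (L := setLang) (n := 2) SetRel.mem ![.var (.inr i), .var (.inr j)], ?_⟩
  ext v
  apply iff_of_eq
  change FirstOrder.Language.Structure.RelMap _ _ = FirstOrder.Language.Structure.RelMap _ _
  congr 1
  funext k
  fin_cases k <;> rfl
theorem BDef.eq (i j : ι) : BDef fun v : ι → M => v i = v j := by
  refine Set.definable_iff_exists_formula_sum.2
    ⟨FirstOrder.Language.Term.equal (.var (.inr i)) (.var (.inr j)), ?_⟩
  ext v
  change _ ↔ FirstOrder.Language.Formula.Realize _ _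
  rw [FirstOrder.Language.Formula.realize_equal]
  rfl
theorem BDef.eq_const (i : ι) (c : M) : BDef fun v : ι → M => v i = c := by
  refine Set.definable_iff_exists_formula_sum.2
    ⟨FirstOrder.Language.Term.equal (.var (.inr i)) (.var (.inl ⟨c, trivial⟩)), ?_⟩
  ext v
  change _ ↔ FirstOrder.Language.Formula.Realize _ _
  rw [FirstOrder.Language.Formula.realize_equal]
  rfl
theorem BDef.mem_const [Finite ι] (i : ι) (c : M) : BDef fun v : ι → M => Mem (v i) c := by
  have : BDef fun v : ι → M => ∃ m, m = c ∧ Mem (v i) m :=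
    BDef.ex ((BDef.eq_const none c).and (BDef.mem (some i) none))
  simpa using this
theorem BDef.isPair [Finite ι] (i j k : ι) : BDef fun v : ι → M => IsPair (v i) (v j) (v k) := by
  exact BDef.all ((BDef.mem none (some i)).iff
    ((BDef.all ((BDef.mem none (some none)).iff (BDef.eq none (some (some j))))).or
    (BDef.all ((BDef.mem none (some none)).iff
      ((BDef.eq none (some (some j))).or (BDef.eq none (some (some k))))))))
end base

/-! ### Elementary operations in a model of ZF -/

theorem IsModelZF.sep (hM : IsModelZF M) {P : M → Prop}
    (h : BDef fun v : Fin 1 → M => P (v 0)) (a : M) : ∃ b, ∀ x, Mem x b ↔ Mem x a ∧ P x :=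
  hM.separation {x | P x} h a

theorem IsModelZF.sep_pair (hM : IsModelZF M) (a b : M) :
    ∃ p, ∀ z, Mem z p ↔ Mem z a ∨ Mem z b := by
  obtain ⟨q, hq⟩ := hM.pairing a b
  obtain ⟨p, hp⟩ := hM.union q
  exact ⟨p, fun z => by simp [hp, hq, or_and_right, exists_or]⟩

theorem IsModelZF.exists_isPair (hM : IsModelZF M) (a b : M) : ∃ p, IsPair p a b := by
  obtain ⟨s, hs⟩ := hM.pairing a a
  obtain ⟨t, ht⟩ := hM.pairing a b
  obtain ⟨p, hp⟩ := hM.pairing s t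
  refine ⟨p, fun z => (hp z).trans (or_congr ⟨?_, fun h => ?_⟩ ⟨?_, fun h => ?_⟩)⟩
  · rintro rfl; simpa using hs
  · exact hM.extensionality _ _ fun w => by simp [h, hs]
  · rintro rfl; exact ht
  · exact hM.extensionality _ _ fun w => by simp [h, ht]

theorem IsPair.unique (hM : IsModelZF M) {p q a b : M} (h : IsPair p a b) (h' : IsPair q a b) :
    p = q :=
  hM.extensionality _ _ fun z => (h z).trans (h' z).symm

/-- The two members of `p` are {a}, {a, b} and also {c}, {c, d}. Matching {a} with either of the
latter settles the first coordinates; the second ones follow according to whether {a, b} is a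
singleton. -/
theorem IsPair.inj (hM : IsModelZF M) {p a b c d : M} (h : IsPair p a b) (h' : IsPair p c d) :
    a = c ∧ b = d := by
  obtain ⟨s, hs⟩ := hM.pairing a a
  obtain ⟨t, ht⟩ := hM.pairing a b
  obtain ⟨s', hs'⟩ := hM.pairing c c
  obtain ⟨t', ht'⟩ := hM.pairing c d
  simp only [or_self] at hs hs'
  have h1 := (h' s).1 ((h s).2 (.inl hs))
  have h2 := (h' t).1 ((h t).2 (.inr ht))
  have h3 := (h s').1 ((h' s').2 (.inl hs'))
  have h4 := (h t').1 ((h' t').2 (.inr ht'))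
  simp only [hs, ht, hs', ht'] at h1 h2 h3 h4
  have hac : a = c := by
    rcases h1 with h1 | h1
    · exact (h1 a).1 rfl
    · exact ((h1 c).2 (.inl rfl)).symm
  subst hac
  refine ⟨rfl, ?_⟩
  rcases h2 with h2 | h2
  · have hb : b = a := (h2 b).1 (.inr rfl)
    subst hb
    rcases h4 with h4 | h4
    · exact ((h4 d).1 (.inr rfl)).symm
    · have := (h4 d).1 (.inr rfl); tauto
  · have hb := (h2 b).1 (.inr rfl)
    have hd := (h2 d).2 (.inr rfl)
    rcases hb with rfl | hb
    · exact (hd.elim id id).symm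
    · exact hb

/-! ### Types of objects that form a set of the model -/

/-- The objects of type `α` are coded faithfully, and their codes form a set of the model. -/
class MSet (M : Type u) [setLang.Structure M] (α : Type u) [Coded M α] : Prop where
  exists_code : ∀ x : α, ∃ m : M, Coded.Code x m
  code_unique : ∀ {x : α} {m n : M}, Coded.Code x m → Coded.Code x n → m = n
  code_inj : ∀ {x y : α} {m : M}, Coded.Code x m → Coded.Code y m → x = y
  exists_set : ∃ A : M, ∀ y, Mem y A ↔ ∃ x : α, Coded.Code x y

/-- The set of the model that stands for `x`. -/
noncomputable def code (M : Type u) [setLang.Structure M] {α : Type u} [Coded M α] [MSet M α]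
    (x : α) : M :=
  (MSet.exists_code x).choose

/-- The predicate `P` is a set of the model. -/
@[fun_prop]
def DefP (M : Type u) [setLang.Structure M] {α : Type u} [Coded M α] (P : α → Prop) : Prop :=
  Internal M {x | P x}

/-- The function `f` is a set of the model. -/
@[fun_prop]
def DefF (M : Type u) [setLang.Structure M] {α β : Type u} [Coded M α] [Coded M β]
    (f : α → β) : Prop :=
  Internal M f

section code
variable {α β γ δ : Type u} [Coded M α] [Coded M β] [Coded M γ] [Coded M δ]

theorem code_spec [MSet M α] (x : α) : Coded.Code x (code M x) := (MSet.exists_code x).choose_spec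

theorem code_iff [MSet M α] {x : α} {m : M} : Coded.Code x m ↔ m = code M x :=
  ⟨fun h => MSet.code_unique h (code_spec x), fun h => h ▸ code_spec x⟩

theorem code_injective [MSet M α] : Function.Injective (code M : α → M) := fun x y h =>
  MSet.code_inj (code_spec x) (h ▸ code_spec y)

@[simp] theorem code_inj_iff [MSet M α] {x y : α} : code M x = code M y ↔ x = y :=
  code_injective.eq_iff

theorem DefP.exists_set [MSet M α] {P : α → Prop} (h : DefP M P) :
    ∃ m : M, ∀ y, Mem y m ↔ ∃ x, P x ∧ y = code M x := by
  obtain ⟨m, hm⟩ := h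
  exact ⟨m, fun y => (hm y).trans (by simp [code_iff])⟩

variable [ZF : Fact (IsModelZF M)]

/-- The bridge from formulas to sets of objects: Separation is applied to the set of all codes. -/
theorem DefP.of_base [MSet M α] {P : α → Prop} (Q : M → Prop)
    (hQ : BDef fun v : Fin 1 → M => Q (v 0)) (h : ∀ x, P x ↔ Q (code M x)) : DefP M P := by
  obtain ⟨A, hA⟩ := MSet.exists_set (M := M) (α := α)
  obtain ⟨b, hb⟩ := ZF.out.sep hQ A
  refine ⟨b, fun y => ?_⟩
  simp only [hb, hA, code_iff, Set.mem_ofPred_eq, h]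
  constructor
  · rintro ⟨⟨x, rfl⟩, hx⟩; exact ⟨x, hx, rfl⟩
  · rintro ⟨x, hx, rfl⟩; exact ⟨⟨x, rfl⟩, hx⟩

/-! ### Products -/

instance instMSetProd [MSet M α] [MSet M β] : MSet M (α × β) where
  exists_code x := by
    obtain ⟨p, hp⟩ := ZF.out.exists_isPair (code M x.1) (code M x.2)
    exact ⟨p, _, _, code_spec _, code_spec _, hp⟩
  code_unique := by
    rintro x m n ⟨a, b, ha, hb, h⟩ ⟨a', b', ha', hb', h'⟩
    rw [code_iff] at ha hb ha' hb'
    subst ha hb ha' hb'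
    exact h.unique ZF.out h'
  code_inj := by
    rintro x y m ⟨a, b, ha, hb, h⟩ ⟨a', b', ha', hb', h'⟩
    rw [code_iff] at ha hb ha' hb'
    subst ha hb ha' hb'
    obtain ⟨h1, h2⟩ := h.inj ZF.out h'
    exact Prod.ext (code_injective h1) (code_injective h2)
  exists_set := by
    obtain ⟨A, hA⟩ := MSet.exists_set (M := M) (α := α)
    obtain ⟨B, hB⟩ := MSet.exists_set (M := M) (α := β)
    -- Kuratowski pairs with entries in A ∪ B lie in the second power set of A ∪ B, from which the
    -- product is separated.
    obtain ⟨U, hU⟩ := ZF.out.sep_pair A B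
    obtain ⟨PU, hPU⟩ := ZF.out.powerset U
    obtain ⟨PPU, hPPU⟩ := ZF.out.powerset PU
    obtain ⟨C, hC⟩ := ZF.out.sep (P := fun p => ∃ a b, Mem a A ∧ Mem b B ∧ IsPair p a b)
      (.ex <| .ex <| (BDef.mem_const (some none) A).and <| (BDef.mem_const none B).and <|
        BDef.isPair (some (some 0)) (some none) none) PPU
    refine ⟨C, fun p => (hC p).trans ⟨?_, ?_⟩⟩
    · rintro ⟨-, a, b, ha, hb, hp⟩
      obtain ⟨x, hx⟩ := (hA a).1 ha
      obtain ⟨y, hy⟩ := (hB b).1 hb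
      exact ⟨(x, y), a, b, hx, hy, hp⟩
    · rintro ⟨x, a, b, ha, hb, hp⟩
      have haA := (hA a).2 ⟨_, ha⟩
      have hbB := (hB b).2 ⟨_, hb⟩
      refine ⟨(hPPU p).2 fun z hz => (hPU z).2 fun w hw => (hU w).2 ?_, a, b, haA, hbB, hp⟩
      rcases (hp z).1 hz with h | h
      · exact .inl ((h w).1 hw ▸ haA)
      · rcases (h w).1 hw with rfl | rfl
        · exact .inl haA
        · exact .inr hbB

theorem isPair_code [MSet M α] [MSet M β] (x : α) (y : β) :
    IsPair (code M (x, y)) (code M x) (code M y) := by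
  obtain ⟨a, b, ha, hb, h⟩ := code_spec (M := M) (x, y)
  rw [code_iff] at ha hb
  subst ha hb
  exact h

theorem isPair_code_iff [MSet M α] [MSet M β] {p : α × β} {a b : M} :
    IsPair (code M p) a b ↔ a = code M p.1 ∧ b = code M p.2 := by
  constructor
  · intro h
    obtain ⟨h1, h2⟩ := (isPair_code p.1 p.2).inj ZF.out h
    exact ⟨h1.symm, h2.symm⟩
  · rintro ⟨rfl, rfl⟩; exact isPair_code _ _

/-- A function and its graph have the same code, so statements about functions reduce to statements
about predicates. -/
theorem defF_iff_graph {f : α → β} : DefF M f ↔ DefP M fun p : α × β => f p.1 = p.2 := by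
  refine exists_congr fun m => forall_congr' fun y => iff_congr Iff.rfl ⟨?_, ?_⟩
  · rintro ⟨x, hx⟩; exact ⟨(x, f x), rfl, hx⟩
  · rintro ⟨⟨x, z⟩, h : f x = z, hx⟩; subst h; exact ⟨x, hx⟩

theorem DefF.exists_graph [MSet M α] [MSet M β] {f : α → β} (h : DefF M f) :
    ∃ m : M, ∀ q, Mem q m ↔ ∃ x, q = code M (x, f x) := by
  obtain ⟨m, hm⟩ := (defF_iff_graph.1 h).exists_set
  refine ⟨m, fun q => (hm q).trans ⟨?_, ?_⟩⟩
  · rintro ⟨⟨x, z⟩, h : f x = z, hx⟩; subst h; exact ⟨x, hx⟩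
  · rintro ⟨x, hx⟩; exact ⟨(x, f x), rfl, hx⟩

/-! ### Closure properties of the sets and functions of the model -/

section closure
variable [MSet M α] [MSet M β] [MSet M γ] [MSet M δ] {P Q : α → Prop}

theorem DefP.congr (hP : DefP M P) (h : ∀ x, Q x ↔ P x) : DefP M Q := by
  rwa [show Q = P from funext fun x => propext (h x)]

@[fun_prop]
theorem DefP.const (c : Prop) : DefP M fun _ : α => c := by
  by_cases h : c
  · refine .of_base (fun m => m = m) (.eq 0 0) (by simp [h])
  · refine .of_base (fun m => ¬ m = m) (BDef.eq 0 0).not (by simp [h])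

@[fun_prop]
theorem DefP.not (hP : DefP M P) : DefP M fun x => ¬ P x := by
  obtain ⟨m, hm⟩ := hP.exists_set
  exact .of_base (fun y => ¬ Mem y m) (BDef.mem_const 0 m).not (by simp [hm])

@[fun_prop]
theorem DefP.and (hP : DefP M P) (hQ : DefP M Q) : DefP M fun x => P x ∧ Q x := by
  obtain ⟨m, hm⟩ := hP.exists_set
  obtain ⟨n, hn⟩ := hQ.exists_set
  exact .of_base (fun y => Mem y m ∧ Mem y n) ((BDef.mem_const 0 m).and (BDef.mem_const 0 n))
    (by simp [hm, hn])

@[fun_prop]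
theorem DefP.or (hP : DefP M P) (hQ : DefP M Q) : DefP M fun x => P x ∨ Q x :=
  (hP.not.and hQ.not).not.congr fun x => by tauto

@[fun_prop]
theorem DefP.imp (hP : DefP M P) (hQ : DefP M Q) : DefP M fun x => P x → Q x :=
  (hP.and hQ.not).not.congr fun x => by tauto

@[fun_prop]
theorem DefP.iff (hP : DefP M P) (hQ : DefP M Q) : DefP M fun x => P x ↔ Q x :=
  ((hP.imp hQ).and (hQ.imp hP)).congr fun x => by tauto

-- The codes of the relation form a set `m`, so the quantifier over `y` becomes a search in `M` for
-- a pair in `m` whose first entry is the code of `x`.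
@[fun_prop]
theorem DefP.exists {P : α → β → Prop} (h : DefP M fun p : α × β => P p.1 p.2) :
    DefP M fun x => ∃ y, P x y := by
  obtain ⟨m, hm⟩ := h.exists_set
  refine .of_base (fun a => ∃ p b, IsPair p a b ∧ Mem p m)
    (.ex <| .ex <| (BDef.isPair (some none) (some (some 0)) none).and
      (BDef.mem_const (some none) m)) fun x => ⟨?_, ?_⟩
  · rintro ⟨y, hy⟩
    exact ⟨_, _, isPair_code x y, (hm _).2 ⟨_, hy, rfl⟩⟩
  · rintro ⟨p, b, h1, h2⟩
    obtain ⟨⟨x', y⟩, hxy, rfl⟩ := (hm p).1 h2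
    obtain ⟨h3, h4⟩ := isPair_code_iff.1 h1
    obtain rfl := code_injective h3
    exact ⟨_, hxy⟩

@[fun_prop]
theorem DefP.forall {P : α → β → Prop} (h : DefP M fun p : α × β => P p.1 p.2) :
    DefP M fun x => ∀ y, P x y :=
  (DefP.exists (P := fun x y => ¬ P x y) h.not).not.congr fun x => by simp

theorem defF_of_base {f : α → β} (R : M → M → Prop)
    (hR : BDef fun w : Option (Option (Fin 1)) → M => R (w (some none)) (w none))
    (h : ∀ x y, f x = y ↔ R (code M x) (code M y)) : DefF M f := by
  rw [defF_iff_graph]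
  refine .of_base (fun m => ∃ a b, R a b ∧ IsPair m a b)
    (.ex <| .ex <| .and hR (BDef.isPair (some (some 0)) (some none) none)) fun p => ?_
  simp [isPair_code_iff, h]

@[fun_prop]
theorem DefF.id : DefF M fun x : α => x :=
  defF_of_base (fun a b => a = b) (.eq _ _) (by simp)

@[fun_prop]
theorem DefF.const (c : β) : DefF M fun _ : α => c :=
  defF_of_base (fun _ b => b = code M c) (.eq_const _ _) (by simp [eq_comm])

/-- The graph of a function of the model, as a binary relation. -/
theorem DefF.base {f : α → β} (h : DefF M f) : ∃ R : M → M → Prop,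
    (∀ {ι : Type} [Finite ι] (i j : ι), BDef fun w : ι → M => R (w i) (w j)) ∧
    ∀ x b, R (code M x) b ↔ b = code M (f x) := by
  obtain ⟨m, hm⟩ := h.exists_graph
  refine ⟨fun a b => ∃ q, IsPair q a b ∧ Mem q m, fun i j =>
    .ex <| (BDef.isPair none (some i) (some j)).and (BDef.mem_const none m), fun x b => ⟨?_, ?_⟩⟩
  · rintro ⟨q, hq, hqm⟩
    obtain ⟨x', rfl⟩ := (hm q).1 hqm
    obtain ⟨h1, rfl⟩ := isPair_code_iff.1 hq
    obtain rfl := code_injective h1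
    rfl
  · rintro rfl
    exact ⟨_, isPair_code _ _, (hm _).2 ⟨_, rfl⟩⟩

@[fun_prop]
theorem DefF.comp {g : β → γ} {f : α → β} (hg : DefF M g) (hf : DefF M f) :
    DefF M fun x => g (f x) := by
  obtain ⟨R, hR, h1⟩ := hf.base
  obtain ⟨S, hS, h2⟩ := hg.base
  exact defF_of_base (fun a b => ∃ c, R a c ∧ S c b) (.ex <| (hR _ _).and (hS _ _))
    (by simp [h1, h2, eq_comm])

@[fun_prop]
theorem DefP.comp {P : β → Prop} {f : α → β} (hP : DefP M P) (hf : DefF M f) :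
    DefP M fun x => P (f x) := by
  obtain ⟨R, hR, h1⟩ := hf.base
  obtain ⟨m, hm⟩ := hP.exists_set
  exact .of_base (fun a => ∃ c, R a c ∧ Mem c m) (.ex <| (hR _ _).and (BDef.mem_const _ _))
    (by simp [h1, hm])

@[fun_prop]
theorem DefP.eq {f g : α → β} (hf : DefF M f) (hg : DefF M g) : DefP M fun x => f x = g x := by
  obtain ⟨R, hR, h1⟩ := hf.base
  obtain ⟨S, hS, h2⟩ := hg.base
  exact .of_base (fun a => ∃ c, R a c ∧ S a c) (.ex <| (hR _ _).and (hS _ _))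
    (by simp [h1, h2])

@[fun_prop]
theorem DefF.fst : DefF M (Prod.fst : α × β → α) := by
  refine defF_of_base (fun p a => ∃ b, IsPair p a b)
    (.ex <| BDef.isPair (some (some none)) (some none) none) fun p x => ?_
  simp [isPair_code_iff, eq_comm]

@[fun_prop]
theorem DefF.snd : DefF M (Prod.snd : α × β → β) := by
  refine defF_of_base (fun p b => ∃ a, IsPair p a b)
    (.ex <| BDef.isPair (some (some none)) none (some none)) fun p x => ?_
  simp [isPair_code_iff, eq_comm]

@[fun_prop]
theorem DefF.prodMk {f : α → β} {g : α → γ} (hf : DefF M f) (hg : DefF M g) :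
    DefF M fun x => (f x, g x) := by
  obtain ⟨R, hR, h1⟩ := hf.base
  obtain ⟨S, hS, h2⟩ := hg.base
  refine defF_of_base (fun a p => ∃ b c, R a b ∧ S a c ∧ IsPair p b c)
    (.ex <| .ex <| (hR _ _).and <| (hS _ _).and <|
      BDef.isPair (some (some none)) (some none) none) fun x y => ?_
  simp [h1, h2, isPair_code_iff, Prod.ext_iff, eq_comm]

theorem DefF.of_graph {f : α → β} {P : α → β → Prop} (hP : DefP M fun p : α × β => P p.1 p.2)
    (h : ∀ x y, f x = y ↔ P x y) : DefF M f :=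
  defF_iff_graph.2 (hP.congr fun _ => h _ _)

end closure
end code

section closure
variable {M : Type u} [setLang.Structure M] {α β γ δ : Type u}
  [Coded M α] [Coded M β] [Coded M γ] [Coded M δ]
  [ZF : Fact (IsModelZF M)] [MSet M α] [MSet M β] [MSet M γ] [MSet M δ]

/-! ### Subtypes and sets -/

@[fun_prop]
theorem DefP.existsUnique {P : α → β → Prop} (h : DefP M fun p : α × β => P p.1 p.2) :
    DefP M fun x => ∃! y, P x y := by
  unfold ExistsUnique
  fun_prop

theorem defF_of_code_eq {e : α → β} (he : ∀ x, code M (e x) = code M x) : DefF M e :=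
  defF_of_base (fun a b => a = b) (.eq _ _) fun x y => by
    rw [← he, code_inj_iff]

/-- By injectivity, f x = y means e (f x) = e y. In this way functions obtained by `choose` as
solutions of an equation in a larger type are recognised as sets of the model. -/
theorem DefF.of_comp {e : β → γ} (he : DefF M e) (hi : Function.Injective e) {f : α → β}
    (h : DefF M fun x => e (f x)) : DefF M f :=
  .of_graph (P := fun x y => e (f x) = e y)
    (DefP.eq (DefF.comp (g := fun x => e (f x)) h .fst) (he.comp .snd))
    fun _ _ => hi.eq_iff.symm

-- The injection leaves codes unchanged, so the codes of `α` are those of its range. Subtypes,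
-- function types, sums, quotients and complex numbers are all treated this way.
omit [MSet M α] in
theorem MSet.of_injective {e : α → β} (hi : Function.Injective e)
    (hc : ∀ x (m : M), Coded.Code x m ↔ Coded.Code (e x) m) (hr : DefP M (· ∈ Set.range e)) :
    MSet M α where
  exists_code x := by simpa only [hc] using MSet.exists_code (e x)
  code_unique h h' := MSet.code_unique ((hc _ _).1 h) ((hc _ _).1 h')
  code_inj h h' := hi (MSet.code_inj ((hc _ _).1 h) ((hc _ _).1 h'))
  exists_set := by
    obtain ⟨m, hm⟩ := hr.exists_set
    refine ⟨m, fun y => (hm y).trans ?_⟩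
    simp [hc, code_iff]

omit [MSet M α] in
theorem MSet.defF_of_code_iff {e : α → β}
    (hc : ∀ x (m : M), Coded.Code x m ↔ Coded.Code (e x) m) [MSet M α] : DefF M e :=
  defF_of_code_eq fun x => (code_iff.1 ((hc x _).1 (code_spec x))).symm

theorem MSet.subtype {p : α → Prop} (hp : DefP M p) : MSet M {x // p x} :=
  .of_injective Subtype.val_injective (fun _ _ => Iff.rfl) (by simpa using hp)

@[fun_prop]
theorem DefF.val {p : α → Prop} [MSet M {x // p x}] {f : β → {x // p x}} (hf : DefF M f) :
    DefF M fun x => (f x).1 :=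
  (MSet.defF_of_code_iff (fun _ _ => Iff.rfl)).comp hf

@[fun_prop]
theorem DefF.mk {p : α → Prop} [MSet M {x // p x}] {f : β → α} (hf : DefF M f)
    (h : ∀ x, p (f x)) : DefF M fun x => (⟨f x, h x⟩ : {x // p x}) :=
  .of_comp DefF.id.val Subtype.val_injective hf

theorem DefP.internal {P : α → Prop} (h : DefP M P) : Internal M {x | P x} := h

/-- The sets of objects of type `α` that belong to the model. -/
abbrev ISet (M : Type u) [setLang.Structure M] (α : Type u) [Coded M α] : Type u :=
  {S : Set α // Internal M S}

omit [ZF : Fact (IsModelZF M)] in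
theorem mem_iff_of_code {S : Set α} {m : M} (h : Coded.Code S m) {x : α} :
    x ∈ S ↔ Mem (code M x) m := by
  rw [h]
  simp [code_iff]

/-- The codes are the elements of the power set, taken in `M`, of the set of codes of `α`: each such
element codes the set of those `x` whose code it contains. -/
instance instMSetISet : MSet M (ISet M α) where
  exists_code S := S.2
  code_unique h h' := ZF.out.extensionality _ _ fun y => (h y).trans (h' y).symm
  code_inj h h' := Subtype.ext <| Set.ext fun _ =>
    (mem_iff_of_code h).trans (mem_iff_of_code h').symm
  exists_set := by
    obtain ⟨A, hA⟩ := MSet.exists_set (M := M) (α := α)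
    obtain ⟨B, hB⟩ := ZF.out.powerset A
    refine ⟨B, fun m => (hB m).trans ⟨fun h => ?_, ?_⟩⟩
    · have : Coded.Code {x : α | Mem (code M x) m} m := by
        intro y
        constructor
        · intro hy
          obtain ⟨x, hx⟩ := (hA y).1 (h y hy)
          exact ⟨x, by simpa [← code_iff.1 hx] using hy, hx⟩
        · rintro ⟨x, hx, hxy⟩
          rw [code_iff] at hxy
          exact hxy ▸ hx
      exact ⟨⟨_, m, this⟩, this⟩
    · rintro ⟨S, hS⟩ y hy
      obtain ⟨x, -, hx⟩ := (hS y).1 hy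
      exact (hA y).2 ⟨x, hx⟩

/-- The family of sets `F` belongs to the model. -/
@[fun_prop]
def DefS (M : Type u) [setLang.Structure M] {α β : Type u} [Coded M α] [Coded M β]
    (F : α → Set β) : Prop :=
  DefP M fun p : α × β => p.2 ∈ F p.1

@[fun_prop]
theorem DefP.mem {f : α → β} {F : α → Set β} (hf : DefF M f) (hF : DefS M F) :
    DefP M fun x => f x ∈ F x :=
  DefP.comp (P := fun p : α × β => p.2 ∈ F p.1) hF (DefF.id.prodMk hf)

@[fun_prop]
theorem DefS.comp {F : β → Set γ} {f : α → β} (hF : DefS M F) (hf : DefF M f) :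
    DefS M fun x => F (f x) :=
  DefP.comp (P := fun p : β × γ => p.2 ∈ F p.1) (f := fun p : α × γ => (f p.1, p.2)) hF
    (by fun_prop)

theorem DefS.of_internal {S : Set β} (hS : Internal M S) : DefS M fun _ : α => S :=
  DefP.comp (P := fun x => x ∈ S) hS .snd

@[fun_prop]
theorem DefS.val {p : Set β → Prop} [MSet M {S // p S}] {f : α → {S // p S}} (hf : DefF M f) :
    DefS M fun x => (f x).1 := by
  obtain ⟨R, hR, h1⟩ := hf.base
  refine DefP.of_base (fun q => ∃ a b m, IsPair q a b ∧ R a m ∧ Mem b m)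
    (.ex <| .ex <| .ex <| (BDef.isPair (some (some (some 0))) (some (some none)) (some none)).and <|
      (hR _ _).and <| BDef.mem _ _) fun q => ?_
  have : q.2 ∈ (f q.1).1 ↔ Mem (code M q.2) (code M (f q.1)) := mem_iff_of_code
    (show Coded.Code (f q.1).1 _ from code_spec (M := M) (f q.1))
  rw [this]
  constructor
  · intro h
    exact ⟨_, _, _, isPair_code _ _, (h1 _ _).2 rfl, h⟩
  · rintro ⟨a, b, m, hq, ha, hb⟩
    obtain ⟨rfl, rfl⟩ := isPair_code_iff.1 hq
    rw [h1] at ha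
    exact ha ▸ hb

theorem DefF.of_val_set {p : Set β → Prop} [MSet M {S // p S}] {f : α → {S // p S}}
    (hf : DefS M fun x => (f x).1) : DefF M f := by
  refine .of_graph (P := fun x S => ∀ y, y ∈ S.1 ↔ y ∈ (f x).1) ?_
    fun x S => by simp [Subtype.ext_iff, Set.ext_iff, iff_comm]
  have : DefP M fun q : (α × {S // p S}) × β => q.2 ∈ (f q.1.1).1 :=
    DefP.mem .snd (DefS.comp (F := fun x => (f x).1) hf (by fun_prop))
  fun_prop

@[fun_prop]
theorem DefF.mkSet {p : Set β → Prop} [MSet M {S // p S}] {F : α → Set β} (hF : DefS M F)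
    (h : ∀ x, p (F x)) : DefF M fun x => (⟨F x, h x⟩ : {S // p S}) :=
  .of_val_set hF

theorem DefS.internal {F : α → Set β} (hF : DefS M F) (x : α) : Internal M (F x) :=
  DefP.comp (P := fun p : α × β => p.2 ∈ F p.1) hF ((DefF.const x).prodMk .id)

theorem MSet.subtype_set {p : Set α → Prop} (hp : ∀ S, p S → Internal M S)
    (h : DefP M fun S : ISet M α => p S.1) : MSet M {S // p S} := by
  refine .of_injective (e := fun S => (⟨S.1, hp _ S.2⟩ : ISet M α))
    (fun S T h => by simpa [Subtype.ext_iff] using h) (fun _ _ => Iff.rfl)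
    (h.congr fun S => ⟨?_, fun h => ⟨⟨S.1, h⟩, rfl⟩⟩)
  rintro ⟨T, rfl⟩; exact T.2

section sets
variable {F G : α → Set β}

@[fun_prop]
theorem DefS.setOf {P : α → β → Prop} (h : DefP M fun p : α × β => P p.1 p.2) :
    DefS M fun x => {y | P x y} := h
@[fun_prop]
theorem DefS.empty : DefS M fun _ : α => (∅ : Set β) := (DefP.const False).congr fun _ => by simp
@[fun_prop]
theorem DefS.union (hF : DefS M F) (hG : DefS M G) : DefS M fun x => F x ∪ G x := DefP.or hF hG
@[fun_prop]
theorem DefS.diff (hF : DefS M F) (hG : DefS M G) : DefS M fun x => F x \ G x :=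
  DefP.and hF (DefP.not hG)
@[fun_prop]
theorem DefS.singleton {f : α → β} (hf : DefF M f) : DefS M fun x => ({f x} : Set β) := by
  show DefP M fun p : α × β => p.2 = f p.1
  fun_prop
@[fun_prop]
theorem DefS.insert {f : α → β} (hf : DefF M f) (hF : DefS M F) :
    DefS M fun x => insert (f x) (F x) :=
  (DefS.singleton hf).union hF
@[fun_prop]
theorem DefP.subset (hF : DefS M F) (hG : DefS M G) : DefP M fun x => F x ⊆ G x := by
  have : DefP M fun x => ∀ y, y ∈ F x → y ∈ G x := by fun_prop
  exact this
@[fun_prop]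
theorem DefP.set_eq (hF : DefS M F) (hG : DefS M G) : DefP M fun x => F x = G x := by
  simp only [Set.ext_iff]
  fun_prop
@[fun_prop]
theorem DefP.disjoint (hF : DefS M F) (hG : DefS M G) : DefP M fun x => Disjoint (F x) (G x) := by
  simp only [Set.disjoint_left]
  fun_prop
@[fun_prop]
theorem DefS.image {f : α → γ → β} {F : α → Set γ} (hf : DefF M fun p : α × γ => f p.1 p.2)
    (hF : DefS M F) : DefS M fun x => f x '' F x := by
  show DefP M fun p : α × β => ∃ y, y ∈ F p.1 ∧ f p.1 y = p.2
  fun_prop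
@[fun_prop]
theorem DefS.preimage {f : α → γ → β} {F : α → Set β} (hf : DefF M fun p : α × γ => f p.1 p.2)
    (hF : DefS M F) : DefS M fun x => f x ⁻¹' F x := by
  show DefP M fun p : α × γ => f p.1 p.2 ∈ F p.1
  fun_prop

end sets

/-! ### Functions -/

/-- The functions from `α` to `β` that belong to the model. -/
abbrev IFun (M : Type u) [setLang.Structure M] (α β : Type u) [Coded M α] [Coded M β] : Type u :=
  {f : α → β // Internal M f}

omit [MSet M α] [MSet M β] in
theorem code_fun_iff {f : α → β} {m : M} :
    Coded.Code f m ↔ Coded.Code {p : α × β | f p.1 = p.2} m := by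
  refine forall_congr' fun y => iff_congr Iff.rfl ⟨?_, ?_⟩
  · rintro ⟨x, hx⟩; exact ⟨(x, f x), rfl, hx⟩
  · rintro ⟨⟨x, z⟩, h : f x = z, hx⟩; subst h; exact ⟨x, hx⟩

/-- The graph of a function of the model. -/
def graph {p : (α → β) → Prop} (hp : ∀ f, p f → Internal M f) (f : {f // p f}) :
    ISet M (α × β) :=
  ⟨{q | f.1 q.1 = q.2}, defF_iff_graph.1 (hp _ f.2)⟩

theorem graph_injective {p : (α → β) → Prop} (hp : ∀ f, p f → Internal M f) :
    Function.Injective (graph hp) := fun f g h => Subtype.ext <| funext fun x => by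
  have : (x, f.1 x) ∈ (graph hp g).1 := h ▸ rfl
  exact this.symm

instance instMSetIFun : MSet M (IFun M α β) := by
  refine .of_injective (e := graph fun _ h => h) (graph_injective _) (fun f m => code_fun_iff) ?_
  refine DefP.congr (P := fun R : ISet M (α × β) => ∀ x, ∃! y, (x, y) ∈ R.1) (by fun_prop)
    fun R => ⟨?_, fun h => ?_⟩
  · rintro ⟨f, rfl⟩ x
    exact ⟨f.1 x, rfl, fun y hy => Eq.symm hy⟩
  -- External choice is harmless here, since `f` is determined by `R`, which belongs to the model.
  · choose f hf hf' using h
    have key : ∀ x y, f x = y ↔ (x, y) ∈ R.1 := fun x y =>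
      ⟨fun h => h ▸ hf x, fun h => (hf' _ _ h).symm⟩
    have : DefF M f := .of_graph (P := fun x y => (x, y) ∈ R.1)
      (by have := DefS.of_internal (α := α × β) R.2; fun_prop) key
    exact ⟨⟨f, this⟩, Subtype.ext <| Set.ext fun q => key _ _⟩

omit [MSet M β] in
theorem MSet.subtype_fun [MSet M β] {p : (α → β) → Prop} (hp : ∀ f, p f → Internal M f)
    (h : DefP M fun f : IFun M α β => p f.1) : MSet M {f // p f} := by
  refine .of_injective (e := fun S => (⟨S.1, hp _ S.2⟩ : IFun M α β))
    (fun S T h => by simpa [Subtype.ext_iff] using h) (fun _ _ => Iff.rfl)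
    (h.congr fun S => ⟨?_, fun h => ⟨⟨S.1, h⟩, rfl⟩⟩)
  rintro ⟨T, rfl⟩; exact T.2

theorem internal_of_code {p : (α → β) → Prop} [MSet M {f // p f}] (f : {f // p f}) :
    Internal M f.1 := ⟨code M f, code_spec (M := M) f⟩

@[fun_prop]
theorem DefF.app {p : (β → γ) → Prop} [MSet M {f // p f}] {f : α → {f // p f}} {g : α → β}
    (hf : DefF M f) (hg : DefF M g) : DefF M fun x => (f x).1 (g x) := by
  have key : DefF M (graph (M := M) (p := p) fun f h => internal_of_code (⟨f, h⟩ : {f // p f})) :=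
    MSet.defF_of_code_iff fun f m => code_fun_iff
  refine .of_graph (P := fun x z => (g x, z) ∈
    (graph (M := M) (p := p) (fun f h => internal_of_code (⟨f, h⟩ : {f // p f})) (f x)).1)
    (DefP.mem (by fun_prop) (DefS.val (key.comp (hf.comp .fst)))) fun x z => Iff.rfl

@[fun_prop]
theorem DefF.mkFun {p : (β → γ) → Prop} [MSet M {f // p f}] {f : α → β → γ}
    (hf : DefF M fun q : α × β => f q.1 q.2) (h : ∀ x, p (f x)) :
    DefF M fun x => (⟨f x, h x⟩ : {f // p f}) :=
  .of_graph (P := fun x g => ∀ y, g.1 y = f x y) (by fun_prop)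
    fun x g => by simp [Subtype.ext_iff, funext_iff, eq_comm]

@[fun_prop]
theorem DefF.ite {P : α → Prop} [∀ x, Decidable (P x)] {f g : α → β} (hP : DefP M P)
    (hf : DefF M f) (hg : DefF M g) : DefF M fun x => if P x then f x else g x :=
  .of_graph (P := fun x y => (P x ∧ f x = y) ∨ (¬ P x ∧ g x = y)) (by fun_prop)
    fun x y => by split_ifs with h <;> simp [h]

/-- The substitute for the axiom of choice: under unique existence `P` itself is the graph of the
function. -/
theorem DefF.exists_choice {P : α → β → Prop} (hP : DefP M fun p : α × β => P p.1 p.2)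
    (h : ∀ x, ∃! y, P x y) : ∃ f : α → β, DefF M f ∧ ∀ x y, f x = y ↔ P x y := by
  choose f hf hf' using h
  have key : ∀ x y, f x = y ↔ P x y := fun x y => ⟨fun h => h ▸ hf x, fun h => (hf' _ _ h).symm⟩
  exact ⟨f, .of_graph hP key, key⟩

theorem DefF.inverse {f : α → β} (hf : DefF M f) {g : β → α} (h : ∀ x y, g y = x ↔ f x = y) :
    DefF M g :=
  .of_graph (P := fun y x => f x = y) (by fun_prop) fun y x => h x y

theorem DefF.equiv_symm {e : α ≃ β} (he : DefF M e) : DefF M e.symm :=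
  he.inverse fun _ _ => by rw [Equiv.symm_apply_eq, eq_comm]

theorem exists_isEmptySet : ∃ o : M, IsEmptySet o := by
  obtain ⟨w, ⟨z, -, hz⟩, -⟩ := ZF.out.infinity
  exact ⟨z, hz⟩

instance instMSetEl (X : M) : MSet M (El X) where
  exists_code x := ⟨x.1, rfl⟩
  code_unique h h' := Eq.trans h (Eq.symm h')
  code_inj h h' := Subtype.ext (Eq.trans (Eq.symm h) h')
  exists_set := ⟨X, fun y => ⟨fun h => ⟨⟨y, h⟩, rfl⟩, by rintro ⟨x, hx⟩; exact hx ▸ x.2⟩⟩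

@[simp] theorem code_el {X : M} (x : El X) : code M x = x.1 := (code_iff.1 rfl).symm

theorem defP_el_mem {X : M} (A : M) : DefP M fun x : El X => Mem x.1 A :=
  .of_base (fun y => Mem y A) (BDef.mem_const _ _) (by simp)

/-! ### Sums -/

/-- Puts a disjoint union inside a product without changing codes: `D` contains the codes of both
summands and the tags ∅ and {∅}. What is needed about sums then follows from products. -/
theorem exists_sum_embedding : ∃ (D : M) (e : α ⊕ β → El D × El D), Function.Injective e ∧
    (∀ s (m : M), Coded.Code s m ↔ Coded.Code (e s) m) ∧ DefP M (· ∈ Set.range e) ∧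
    (∃ f : α → El D, ∃ c, DefF M f ∧ ∀ a, e (.inl a) = (f a, c)) ∧
    (∃ f : β → El D, ∃ c, DefF M f ∧ ∀ a, e (.inr a) = (f a, c)) := by
  obtain ⟨A, hA⟩ := MSet.exists_set (M := M) (α := α)
  obtain ⟨B, hB⟩ := MSet.exists_set (M := M) (α := β)
  obtain ⟨o, ho⟩ := exists_isEmptySet (M := M)
  have hoe : ∀ z : M, IsEmptySet z ↔ z = o := fun z =>
    ⟨fun h => ZF.out.extensionality _ _ fun w => iff_of_false (h w) (ho w), fun h => h ▸ ho⟩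
  obtain ⟨i, hi⟩ := ZF.out.pairing o o
  simp only [or_self] at hi
  have hie : ∀ z : M, (∀ w, Mem w z ↔ w = o) ↔ z = i := fun z =>
    ⟨fun h => ZF.out.extensionality _ _ fun w => (h w).trans (hi w).symm, fun h => h ▸ hi⟩
  have hoi : o ≠ i := fun h => ho o (by rw [h, hi, ← h])
  obtain ⟨C, hC⟩ := ZF.out.sep_pair A B
  obtain ⟨E, hE⟩ := ZF.out.pairing o i
  obtain ⟨D, hD⟩ := ZF.out.sep_pair C E
  have hDA : ∀ x : α, Mem (code M x) D := fun x =>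
    (hD _).2 (.inl ((hC _).2 (.inl ((hA _).2 ⟨x, code_spec x⟩))))
  have hDB : ∀ x : β, Mem (code M x) D := fun x =>
    (hD _).2 (.inl ((hC _).2 (.inr ((hB _).2 ⟨x, code_spec x⟩))))
  have hDo : Mem o D := (hD _).2 (.inr ((hE _).2 (.inl rfl)))
  have hDi : Mem i D := (hD _).2 (.inr ((hE _).2 (.inr rfl)))
  let f : α → El D := fun x => ⟨code M x, hDA x⟩
  let g : β → El D := fun x => ⟨code M x, hDB x⟩
  let o' : El D := ⟨o, hDo⟩
  let i' : El D := ⟨i, hDi⟩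
  have hne : o' ≠ i' := fun h => hoi (congrArg Subtype.val h)
  have hf : Function.Injective f := fun x y h => code_injective (congrArg Subtype.val h)
  have hg : Function.Injective g := fun x y h => code_injective (congrArg Subtype.val h)
  have dA := defP_el_mem (X := D) A
  have dB := defP_el_mem (X := D) B
  refine ⟨D, Sum.elim (fun x => (f x, o')) (fun x => (g x, i')), ?_, ?_, ?_,
    ⟨f, o', defF_of_code_eq fun x => by simp [f], fun _ => rfl⟩,
    ⟨g, i', defF_of_code_eq fun x => by simp [g], fun _ => rfl⟩⟩
  · rintro (x | x) (y | y) h <;> simp only [Sum.elim_inl, Sum.elim_inr, Prod.mk.injEq] at h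
    · rw [hf h.1]
    · exact absurd h.2 hne
    · exact absurd h.2.symm hne
    · rw [hg h.1]
  · rintro (x | x) m
    · refine exists_congr fun a => exists_congr fun b => and_congr ?_ (and_congr (hoe b) Iff.rfl)
      exact code_iff
    · refine exists_congr fun a => exists_congr fun b => and_congr code_iff (and_congr ?_ Iff.rfl)
      simp only [hoe, hie]; rfl
  · refine DefP.congr (P := fun p : El D × El D =>
      (Mem p.1.1 A ∧ p.2 = o') ∨ (Mem p.1.1 B ∧ p.2 = i'))
      ?_ fun p => ⟨?_, ?_⟩
    · have h1 := dA.comp (DefF.fst (α := El D) (β := El D))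
      have h2 := dB.comp (DefF.fst (α := El D) (β := El D))
      fun_prop
    · rintro ⟨x | x, rfl⟩
      · exact .inl ⟨(hA _).2 ⟨x, code_spec x⟩, rfl⟩
      · exact .inr ⟨(hB _).2 ⟨x, code_spec x⟩, rfl⟩
    · rcases p with ⟨p, q⟩
      rintro (⟨h, rfl⟩ | ⟨h, rfl⟩)
      · obtain ⟨x, hx⟩ := (hA _).1 h
        exact ⟨.inl x, Prod.ext (Subtype.ext (code_iff.1 hx).symm) rfl⟩
      · obtain ⟨x, hx⟩ := (hB _).1 h
        exact ⟨.inr x, Prod.ext (Subtype.ext (code_iff.1 hx).symm) rfl⟩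

instance instMSetSum : MSet M (α ⊕ β) := by
  obtain ⟨D, e, h1, h2, h3, -⟩ := exists_sum_embedding (M := M) (α := α) (β := β)
  exact .of_injective h1 h2 h3

@[fun_prop]
theorem DefF.inl {f : γ → α} (hf : DefF M f) : DefF M fun x => (.inl (f x) : α ⊕ β) := by
  obtain ⟨D, e, h1, h2, h3, ⟨g, c, hg, h⟩, -⟩ := exists_sum_embedding (M := M) (α := α) (β := β)
  refine .of_comp (MSet.defF_of_code_iff h2) h1 ?_
  simp only [h]
  fun_prop

@[fun_prop]
theorem DefF.inr {f : γ → β} (hf : DefF M f) : DefF M fun x => (.inr (f x) : α ⊕ β) := by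
  obtain ⟨D, e, h1, h2, h3, -, ⟨g, c, hg, h⟩⟩ := exists_sum_embedding (M := M) (α := α) (β := β)
  refine .of_comp (MSet.defF_of_code_iff h2) h1 ?_
  simp only [h]
  fun_prop

@[fun_prop]
theorem DefF.sumElim {f : γ → α → δ} {g : γ → β → δ} {s : γ → α ⊕ β}
    (hf : DefF M fun p : γ × α => f p.1 p.2) (hg : DefF M fun p : γ × β => g p.1 p.2)
    (hs : DefF M s) : DefF M fun x => Sum.elim (f x) (g x) (s x) := by
  refine .of_graph (P := fun x y => (∃ a, s x = .inl a ∧ f x a = y) ∨ ∃ b, s x = .inr b ∧ g x b = y)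
    (by fun_prop) fun x y => ?_
  rcases s x with a | b <;> simp

end closure

section nat
variable {M : Type u} [setLang.Structure M] {α β γ δ : Type u}
  [Coded M α] [Coded M β] [Coded M γ] [Coded M δ]
  [ZF : Fact (IsModelZF M)] [MSet M α] [MSet M β] [MSet M γ] [MSet M δ]

/-! ### Natural numbers -/

theorem exists_isSucc (x : M) : ∃ s, IsSucc s x := by
  obtain ⟨p, hp⟩ := ZF.out.pairing x x
  obtain ⟨s, hs⟩ := ZF.out.sep_pair x p
  exact ⟨s, fun y => by simp [hs, hp]⟩

theorem IsSucc.unique {s t x : M} (h : IsSucc s x) (h' : IsSucc t x) : s = t :=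
  ZF.out.extensionality _ _ fun y => (h y).trans (h' y).symm

/-- Being an element of every inductive set is a first-order condition, so Separation cuts ω out of
any inductive set. -/
theorem exists_omega : ∃ w : M, ∀ n, Mem n w ↔ ∀ v : M, IsInductive v → Mem n v := by
  obtain ⟨w, hw⟩ := ZF.out.infinity
  have hS : ∀ {ι : Type} [Finite ι] (i j : ι), BDef fun v : ι → M => IsSucc (v i) (v j) :=
    fun i j => .all ((BDef.mem none (some i)).iff ((BDef.mem none (some j)).or (BDef.eq _ _)))
  have hI : BDef fun v : Option (Fin 1) → M => IsInductive (v none) :=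
    .and (.ex <| (BDef.mem none (some none)).and (.all (BDef.mem none (some none)).not))
      (.all <| (BDef.mem none (some none)).imp <| .ex <|
        (BDef.mem none (some (some none))).and (hS _ _))
  obtain ⟨b, hb⟩ := ZF.out.sep (P := fun n => ∀ v : M, IsInductive v → Mem n v)
    (.all (hI.imp (BDef.mem _ _))) w
  exact ⟨b, fun n => (hb n).trans ⟨And.right, fun h => ⟨h w hw, h⟩⟩⟩

instance instMSetNat : MSet M (Nat' M) where
  exists_code x := ⟨x.1, rfl⟩
  code_unique h h' := Eq.trans h (Eq.symm h')
  code_inj h h' := Subtype.ext (Eq.trans (Eq.symm h) h')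
  exists_set := by
    obtain ⟨w, hw⟩ := exists_omega (M := M)
    exact ⟨w, fun y => (hw y).trans ⟨fun h => ⟨⟨y, h⟩, rfl⟩, by rintro ⟨x, hx⟩; exact hx ▸ x.2⟩⟩

@[simp] theorem code_nat (n : Nat' M) : code M n = n.1 := (code_iff.1 rfl).symm

namespace Nat'

theorem exists_zero : ∃ z : Nat' M, IsEmptySet z.1 := by
  obtain ⟨o, ho⟩ := exists_isEmptySet (M := M)
  refine ⟨⟨o, fun w hw => ?_⟩, ho⟩
  obtain ⟨z, hz, hz'⟩ := hw.1
  rwa [ZF.out.extensionality o z fun y => iff_of_false (ho y) (hz' y)]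

noncomputable instance instZero : Zero (Nat' M) := ⟨exists_zero.choose⟩

theorem exists_succ (n : Nat' M) : ∃ s : Nat' M, IsSucc s.1 n.1 := by
  obtain ⟨s, hs⟩ := exists_isSucc n.1
  refine ⟨⟨s, fun w hw => ?_⟩, hs⟩
  obtain ⟨t, ht, ht'⟩ := hw.2 _ (n.2 w hw)
  rwa [hs.unique ht']

/-- The successor of a natural number of the model. -/
noncomputable def succ (n : Nat' M) : Nat' M := (exists_succ n).choose

noncomputable instance instLT : LT (Nat' M) := ⟨fun m n => Mem m.1 n.1⟩

theorem lt_def {m n : Nat' M} : m < n ↔ Mem m.1 n.1 := Iff.rfl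

theorem not_lt_zero' (n : Nat' M) : ¬ n < 0 := (exists_zero (M := M)).choose_spec n.1

theorem isSucc_succ (n : Nat' M) : IsSucc n.succ.1 n.1 := (exists_succ n).choose_spec

theorem lt_succ' {m n : Nat' M} : m < n.succ ↔ m < n ∨ m = n :=
  (isSucc_succ n m.1).trans (or_congr Iff.rfl Subtype.ext_iff.symm)

/-- The set coding `P` is inductive and hence contains every `n`. Without the hypothesis on `P`
induction may fail, since the natural numbers of the model may be nonstandard. -/
theorem induction {P : Nat' M → Prop} (hP : DefP M P) (h0 : P 0)
    (hs : ∀ n, P n → P n.succ) (n : Nat' M) : P n := by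
  obtain ⟨m, hm⟩ := hP.exists_set
  have : IsInductive m := by
    refine ⟨⟨_, (hm _).2 ⟨0, h0, rfl⟩, ?_⟩, fun x hx => ?_⟩
    · rw [code_nat]; exact exists_zero.choose_spec
    · obtain ⟨k, hk, rfl⟩ := (hm x).1 hx
      refine ⟨_, (hm _).2 ⟨k.succ, hs k hk, rfl⟩, ?_⟩
      simpa using isSucc_succ k
  obtain ⟨k, hk, h⟩ := (hm _).1 (n.2 m this)
  rw [code_nat] at h
  rwa [Subtype.ext h]

@[fun_prop]
theorem defP_lt {f g : α → Nat' M} (hf : DefF M f) (hg : DefF M g) :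
    DefP M fun x => f x < g x := by
  have : DefP M fun p : Nat' M × Nat' M => p.1 < p.2 := by
    refine .of_base (fun q => ∃ a b, IsPair q a b ∧ Mem a b)
      (.ex <| .ex <| (BDef.isPair (some (some 0)) (some none) none).and (BDef.mem _ _)) fun p => ?_
    simp [isPair_code_iff, lt_def]
  exact this.comp (hf.prodMk hg)

/-- By induction, as n ∪ {n} has only the elements of n and n itself. It allows extensionality to be
applied to natural numbers through the order alone (`ext_lt`). -/
theorem exists_of_mem {n : Nat' M} {y : M} (h : Mem y n.1) : ∃ k : Nat' M, k.1 = y := by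
  obtain ⟨w, hw⟩ := MSet.exists_set (M := M) (α := Nat' M)
  have hw : ∀ y, Mem y w ↔ ∃ k : Nat' M, k.1 = y := fun y => by
    simp [hw, code_iff, eq_comm]
  rw [← hw]
  refine induction (P := fun n : Nat' M => ∀ y, Mem y n.1 → Mem y w) ?_ ?_ ?_ n y h
  · exact .of_base (fun n => ∀ y, Mem y n → Mem y w)
      (.all <| (BDef.mem _ _).imp (BDef.mem_const _ _)) (by simp)
  · exact fun y hy => absurd hy (exists_zero.choose_spec y)
  · intro n ih y hy
    rcases (isSucc_succ n y).1 hy with h | rfl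
    · exact ih y h
    · exact (hw _).2 ⟨n, rfl⟩

theorem ext_lt {m n : Nat' M} (h : ∀ k, k < m ↔ k < n) : m = n := by
  refine Subtype.ext (ZF.out.extensionality _ _ fun y => ⟨fun hy => ?_, fun hy => ?_⟩) <;>
  obtain ⟨k, rfl⟩ := exists_of_mem hy
  · exact (h k).1 hy
  · exact (h k).2 hy

@[fun_prop]
theorem defF_succ : DefF M (succ : Nat' M → Nat' M) :=
  .of_graph (P := fun n m => ∀ k, k < m ↔ k < n ∨ k = n) (by fun_prop) fun n m =>
    ⟨fun h _ => h ▸ lt_succ', fun h => ext_lt fun k => lt_succ'.trans (h k).symm⟩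

theorem lt_trans' {k m n : Nat' M} : k < m → m < n → k < n := by
  refine induction (P := fun n : Nat' M => k < m → m < n → k < n) (by fun_prop) ?_ ?_ n
  · exact fun _ h => absurd h (not_lt_zero' _)
  · intro n ih h1 h2
    rcases lt_succ'.1 h2 with h | rfl
    · exact lt_succ'.2 (.inl (ih h1 h))
    · exact lt_succ'.2 (.inl h1)

theorem lt_irrefl' (n : Nat' M) : ¬ n < n := by
  refine induction (P := fun n : Nat' M => ¬ n < n) (by fun_prop) (not_lt_zero' _) ?_ n
  intro n ih h
  rcases lt_succ'.1 h with h | h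
  · exact ih (lt_trans' (lt_succ'.2 (.inr rfl)) h)
  · exact ih (by have : n < n.succ := lt_succ'.2 (.inr rfl); rwa [h] at this)

theorem zero_lt_or (n : Nat' M) : 0 < n ∨ n = 0 := by
  refine induction (P := fun n : Nat' M => 0 < n ∨ n = 0) (by fun_prop) (.inr rfl) ?_ n
  rintro n (h | rfl)
  · exact .inl (lt_succ'.2 (.inl h))
  · exact .inl (lt_succ'.2 (.inr rfl))

theorem succ_lt_or {m n : Nat' M} : m < n → m.succ < n ∨ m.succ = n := by
  refine induction (P := fun n : Nat' M => m < n → m.succ < n ∨ m.succ = n) (by fun_prop) ?_ ?_ n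
  · exact fun h => absurd h (not_lt_zero' _)
  · intro n ih h
    rcases lt_succ'.1 h with h | rfl
    · rcases ih h with h | h
      · exact .inl (lt_succ'.2 (.inl h))
      · exact .inl (lt_succ'.2 (.inr h))
    · exact .inr rfl

theorem trichotomy (m n : Nat' M) : m < n ∨ m = n ∨ n < m := by
  refine induction (P := fun n : Nat' M => m < n ∨ m = n ∨ n < m) (by fun_prop) ?_ ?_ n
  · rcases zero_lt_or m with h | h <;> simp [h]
  · rintro n (h | h | h)
    · exact .inl (lt_succ'.2 (.inl h))
    · exact .inl (lt_succ'.2 (.inr h))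
    · rcases succ_lt_or h with h | h <;> simp [h]

noncomputable instance instLinearOrder : LinearOrder (Nat' M) where
  __ := instLT
  le m n := m < n ∨ m = n
  le_refl n := .inr rfl
  le_trans a b c := by
    rintro (h | rfl) (h' | rfl)
    · exact .inl (lt_trans' h h')
    · exact .inl h
    · exact .inl h'
    · exact .inr rfl
  le_antisymm a b := by
    rintro (h | rfl) (h' | h')
    · exact absurd (lt_trans' h h') (lt_irrefl' _)
    all_goals first | rfl | exact h'.symm
  lt_iff_le_not_ge a b := by
    constructor
    · refine fun h => ⟨.inl h, ?_⟩
      rintro (h' | rfl)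
      · exact lt_irrefl' _ (lt_trans' h h')
      · exact lt_irrefl' _ h
    · rintro ⟨h | rfl, h'⟩
      · exact h
      · exact absurd (.inr rfl) h'
  le_total a b := by
    rcases trichotomy a b with h | h | h
    · exact .inl (.inl h)
    · exact .inl (.inr h)
    · exact .inr (.inl h)
  toDecidableLE := Classical.decRel _

@[fun_prop]
theorem defP_le {f g : α → Nat' M} (hf : DefF M f) (hg : DefF M g) :
    DefP M fun x => f x ≤ g x := by
  simp only [← not_lt]
  fun_prop

theorem lt_succ_iff {m n : Nat' M} : m < n.succ ↔ m ≤ n := lt_succ'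
theorem lt_succ_self (n : Nat' M) : n < n.succ := lt_succ'.2 (.inr rfl)
theorem succ_le_iff {m n : Nat' M} : m.succ ≤ n ↔ m < n :=
  ⟨fun h => (lt_succ_self m).trans_le h, fun h => succ_lt_or h⟩
theorem zero_le' (n : Nat' M) : 0 ≤ n := not_lt.1 (not_lt_zero' n)
theorem succ_ne_zero (n : Nat' M) : n.succ ≠ 0 := ((zero_le' n).trans_lt (lt_succ_self n)).ne'
theorem succ_injective : Function.Injective (succ : Nat' M → Nat' M) := by
  intro m n h
  apply le_antisymm
  · rw [← lt_succ_iff, ← h]; exact lt_succ_self m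
  · rw [← lt_succ_iff, h]; exact lt_succ_self n
theorem succ_lt_succ_iff {m n : Nat' M} : m.succ < n.succ ↔ m < n := by
  rw [lt_succ_iff, succ_le_iff]

theorem eq_zero_or_succ (n : Nat' M) : n = 0 ∨ ∃ m : Nat' M, n = m.succ := by
  refine induction (P := fun n : Nat' M => n = 0 ∨ ∃ m : Nat' M, n = m.succ) (by fun_prop)
    (.inl rfl) ?_ n
  exact fun n _ => .inr ⟨n, rfl⟩

theorem strong_induction {P : Nat' M → Prop} (hP : DefP M P)
    (h : ∀ n, (∀ m < n, P m) → P n) (n : Nat' M) : P n := by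
  refine h n (induction (P := fun n : Nat' M => ∀ m, m < n → P m) (by fun_prop)
    (fun m hm => absurd hm (not_lt_zero' _)) (fun n ih m hm => ?_) n)
  rcases lt_succ'.1 hm with hm | rfl
  · exact ih m hm
  · exact h m ih

theorem exists_least {P : Nat' M → Prop} (hP : DefP M P) {n : Nat' M} (hn : P n) :
    ∃ n, P n ∧ ∀ m < n, ¬ P m := by
  by_contra! hcon
  refine strong_induction (P := fun n : Nat' M => ¬ P n) (by fun_prop) (fun n ih hn => ?_) n hn
  obtain ⟨m, hm, hPm⟩ := hcon n hn
  exact ih m hm hPm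

/-- Definitions by recursion, with a parameter. -/
theorem exists_rec {c : γ → α} (hc : DefF M c) {s : γ × Nat' M × α → α} (hs : DefF M s) :
    ∃ f : γ × Nat' M → α, DefF M f ∧ (∀ g, f (g, 0) = c g) ∧
      ∀ g n, f (g, n.succ) = s (g, n, f (g, n)) := by
  -- A set of pairs, each justified either by the initial value or by a predecessor in the same set.
  -- It need not be functional: the agreement of values is proved by induction.
  let approx (g : γ) (r : ISet M (Nat' M × α)) : Prop := ∀ k z, (k, z) ∈ r.1 →
    (k = 0 ∧ z = c g) ∨ ∃ j w, k = succ j ∧ (j, w) ∈ r.1 ∧ z = s (g, j, w)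
  have ha : DefP M fun p : γ × ISet M (Nat' M × α) => approx p.1 p.2 := by
    simp only [approx]; fun_prop
  have ex : ∀ g n, ∃ y r, approx g r ∧ (n, y) ∈ r.1 := by
    intro g
    refine induction (by fun_prop) ?_ ?_
    · refine ⟨c g, ⟨{(0, c g)}, DefS.internal (DefS.singleton (DefF.const _)) (c g)⟩, ?_, rfl⟩
      intro k z h
      rw [Set.mem_singleton_iff, Prod.mk.injEq] at h
      exact .inl h
    · rintro n ⟨y, r, hr, hy⟩
      have hd : DefS M fun r : ISet M (Nat' M × α) => insert (n.succ, s (g, n, y)) r.1 := by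
        fun_prop
      refine ⟨s (g, n, y), ⟨_, hd.internal r⟩, ?_, .inl rfl⟩
      rintro k z (h | h)
      · rw [Prod.mk.injEq] at h
        exact .inr ⟨n, y, h.1, .inr hy, h.2⟩
      · rcases hr k z h with h | ⟨j, w, h1, h2, h3⟩
        · exact .inl h
        · exact .inr ⟨j, w, h1, .inr h2, h3⟩
  have un : ∀ g n y y' r r', approx g r → approx g r' → (n, y) ∈ r.1 → (n, y') ∈ r'.1 → y = y' := by
    intro g
    refine induction (by fun_prop) ?_ ?_
    · intro y y' r r' hr hr' h h'
      have key : ∀ y r, approx g r → (0, y) ∈ r.1 → y = c g := by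
        intro y r hr h
        rcases hr _ _ h with h | ⟨j, w, h1, -⟩
        · exact h.2
        · exact absurd h1.symm (succ_ne_zero _)
      rw [key y r hr h, key y' r' hr' h']
    · intro n ih y y' r r' hr hr' h h'
      have key : ∀ y r, approx g r → (n.succ, y) ∈ r.1 → ∃ w, (n, w) ∈ r.1 ∧ y = s (g, n, w) := by
        intro y r hr h
        rcases hr _ _ h with h | ⟨j, w, h1, h2, h3⟩
        · exact absurd h.1 (succ_ne_zero _)
        · obtain rfl := succ_injective h1
          exact ⟨w, h2, h3⟩
      obtain ⟨w, h1, rfl⟩ := key y r hr h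
      obtain ⟨w', h1', rfl⟩ := key y' r' hr' h'
      rw [ih w w' r r' hr hr' h1 h1']
  obtain ⟨f, hf, hf'⟩ := DefF.exists_choice (M := M)
    (P := fun (p : γ × Nat' M) y => ∃ r, approx p.1 r ∧ (p.2, y) ∈ r.1) (by fun_prop) (by
      rintro ⟨g, n⟩
      obtain ⟨y, r, hr, hy⟩ := ex g n
      refine ⟨y, ⟨r, hr, hy⟩, ?_⟩
      rintro y' ⟨r', hr', hy'⟩
      exact (un g n y y' r r' hr hr' hy hy').symm)
  refine ⟨f, hf, fun g => (hf' _ _).2 ?_, fun g n => (hf' _ _).2 ?_⟩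
  · obtain ⟨y, r, hr, hy⟩ := ex g 0
    refine ⟨r, hr, ?_⟩
    rcases hr _ _ hy with h | ⟨j, w, h1, -⟩
    · rwa [← h.2]
    · exact absurd h1.symm (succ_ne_zero _)
  · obtain ⟨y, r, hr, hy⟩ := ex g n.succ
    refine ⟨r, hr, ?_⟩
    rcases hr _ _ hy with h | ⟨j, w, h1, h2, h3⟩
    · exact absurd h.1 (succ_ne_zero _)
    · obtain rfl := succ_injective h1
      rwa [(hf' (g, n) w).2 ⟨r, hr, h2⟩, ← h3]

theorem exists_seq (c : α) {s : α → α} (hs : DefF M s) :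
    ∃ f : Nat' M → α, DefF M f ∧ f 0 = c ∧ ∀ n, f n.succ = s (f n) := by
  obtain ⟨f, hf, h0, h1⟩ := exists_rec (M := M) (c := fun _ : α => c) (by fun_prop)
    (s := fun p => s p.2.2) (by fun_prop)
  exact ⟨fun n => f (c, n), by fun_prop, h0 _, fun n => h1 _ _⟩

end Nat'
end nat

/-! ### Algebraic operations that belong to the model -/

section algebra
variable (M : Type u) [setLang.Structure M]

/-- The addition of `A` belongs to the model. -/
class DefAdd (A : Type u) [Coded M A] [Add A] : Prop where
  defF_add : DefF M fun p : A × A => p.1 + p.2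

/-- The multiplication of `A` belongs to the model. -/
class DefMul (A : Type u) [Coded M A] [Mul A] : Prop where
  defF_mul : DefF M fun p : A × A => p.1 * p.2

/-- The order of `A` belongs to the model. -/
class DefLE (A : Type u) [Coded M A] [LE A] : Prop where
  defP_le : DefP M fun p : A × A => p.1 ≤ p.2

variable {M} {α A : Type u} [Coded M α] [Coded M A] [ZF : Fact (IsModelZF M)] [MSet M α] [MSet M A]
  {f g : α → A}

@[fun_prop]
theorem DefF.add [Add A] [DefAdd M A] (hf : DefF M f) (hg : DefF M g) :
    DefF M fun x => f x + g x :=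
  (DefAdd.defF_add (M := M) (A := A)).comp (hf.prodMk hg)

@[fun_prop]
theorem DefF.mul [Mul A] [DefMul M A] (hf : DefF M f) (hg : DefF M g) :
    DefF M fun x => f x * g x :=
  (DefMul.defF_mul (M := M) (A := A)).comp (hf.prodMk hg)

@[fun_prop]
theorem DefF.sub [AddCommGroup A] [DefAdd M A] (hf : DefF M f) (hg : DefF M g) :
    DefF M fun x => f x - g x :=
  .of_graph (P := fun x y => f x = y + g x) (by fun_prop) fun _ _ => sub_eq_iff_eq_add

@[fun_prop]
theorem DefF.neg [AddCommGroup A] [DefAdd M A] (hf : DefF M f) : DefF M fun x => - f x := by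
  simp only [← zero_sub]
  fun_prop

@[fun_prop]
theorem DefF.inv [Field A] [DefMul M A] (hf : DefF M f) : DefF M fun x => (f x)⁻¹ :=
  .of_graph (P := fun x y => (f x = 0 ∧ y = 0) ∨ f x * y = 1) (by fun_prop) fun x y => by
    by_cases h : f x = 0
    · simp [h, eq_comm]
    · simp [h, mul_eq_one_iff_inv_eq₀ h]

@[fun_prop]
theorem DefF.div [Field A] [DefMul M A] (hf : DefF M f) (hg : DefF M g) :
    DefF M fun x => f x / g x := by
  simp only [div_eq_mul_inv]
  fun_prop

@[fun_prop]
theorem DefP.le [LE A] [DefLE M A] (hf : DefF M f) (hg : DefF M g) : DefP M fun x => f x ≤ g x :=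
  (DefLE.defP_le (M := M) (A := A)).comp (hf.prodMk hg)

@[fun_prop]
theorem DefP.lt [LinearOrder A] [DefLE M A] (hf : DefF M f) (hg : DefF M g) :
    DefP M fun x => f x < g x := by
  simp only [← not_le]
  fun_prop

end algebra

section nat
variable {M : Type u} [setLang.Structure M] {α β γ δ : Type u}
  [Coded M α] [Coded M β] [Coded M γ] [Coded M δ]
  [ZF : Fact (IsModelZF M)] [MSet M α] [MSet M β] [MSet M γ] [MSet M δ]

/-! ### Arithmetic -/

namespace Nat'

theorem exists_add : ∃ f : Nat' M × Nat' M → Nat' M, DefF M f ∧ (∀ m, f (m, 0) = m) ∧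
    ∀ m n, f (m, n.succ) = (f (m, n)).succ :=
  exists_rec (c := fun m : Nat' M => m) (by fun_prop) (s := fun p => p.2.2.succ) (by fun_prop)

noncomputable instance instAdd : Add (Nat' M) := ⟨fun m n => exists_add.choose (m, n)⟩

instance instDefLE : DefLE M (Nat' M) := ⟨by fun_prop⟩
instance instDefAdd : DefAdd M (Nat' M) := ⟨exists_add.choose_spec.1⟩

theorem add_zero' (m : Nat' M) : m + 0 = m := exists_add.choose_spec.2.1 m
theorem add_succ (m n : Nat' M) : m + n.succ = (m + n).succ := exists_add.choose_spec.2.2 m n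

theorem zero_add' (n : Nat' M) : 0 + n = n :=
  induction (P := fun n : Nat' M => 0 + n = n) (by fun_prop) (add_zero' 0)
    (fun n ih => by rw [add_succ, ih]) n

theorem succ_add (m n : Nat' M) : m.succ + n = (m + n).succ :=
  induction (P := fun n : Nat' M => m.succ + n = (m + n).succ) (by fun_prop)
    (by rw [add_zero', add_zero']) (fun n ih => by rw [add_succ, ih, add_succ]) n

theorem add_comm' (m n : Nat' M) : m + n = n + m :=
  induction (P := fun n : Nat' M => m + n = n + m) (by fun_prop)
    (by rw [add_zero', zero_add']) (fun n ih => by rw [add_succ, ih, succ_add]) n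

theorem add_assoc' (k m n : Nat' M) : k + m + n = k + (m + n) :=
  induction (P := fun n : Nat' M => k + m + n = k + (m + n)) (by fun_prop)
    (by rw [add_zero', add_zero']) (fun n ih => by rw [add_succ, add_succ, add_succ, ih]) n

theorem exists_mul : ∃ f : Nat' M × Nat' M → Nat' M, DefF M f ∧ (∀ m, f (m, 0) = 0) ∧
    ∀ m n, f (m, n.succ) = f (m, n) + m :=
  exists_rec (c := fun _ : Nat' M => 0) (by fun_prop) (s := fun p => p.2.2 + p.1) (by fun_prop)

noncomputable instance instMul : Mul (Nat' M) := ⟨fun m n => exists_mul.choose (m, n)⟩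
noncomputable instance instOne : One (Nat' M) := ⟨succ 0⟩

instance instDefMul : DefMul M (Nat' M) := ⟨exists_mul.choose_spec.1⟩

theorem one_def : (1 : Nat' M) = succ 0 := rfl
theorem mul_zero' (m : Nat' M) : m * 0 = 0 := exists_mul.choose_spec.2.1 m
theorem mul_succ (m n : Nat' M) : m * n.succ = m * n + m := exists_mul.choose_spec.2.2 m n

theorem zero_mul' (n : Nat' M) : 0 * n = 0 :=
  induction (P := fun n : Nat' M => 0 * n = 0) (by fun_prop) (mul_zero' 0)
    (fun n ih => by rw [mul_succ, ih, add_zero']) n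

theorem succ_mul (m n : Nat' M) : m.succ * n = m * n + n :=
  induction (P := fun n : Nat' M => m.succ * n = m * n + n) (by fun_prop)
    (by rw [mul_zero', mul_zero', add_zero'])
    (fun n ih => by
      rw [mul_succ, mul_succ, ih, add_succ, add_succ, add_assoc', add_assoc', add_comm' n m]) n

theorem mul_comm' (m n : Nat' M) : m * n = n * m :=
  induction (P := fun n : Nat' M => m * n = n * m) (by fun_prop)
    (by rw [mul_zero', zero_mul']) (fun n ih => by rw [mul_succ, ih, succ_mul]) n

theorem mul_add' (k m n : Nat' M) : k * (m + n) = k * m + k * n :=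
  induction (P := fun n : Nat' M => k * (m + n) = k * m + k * n) (by fun_prop)
    (by rw [add_zero', mul_zero', add_zero'])
    (fun n ih => by rw [add_succ, mul_succ, mul_succ, ih, add_assoc']) n

theorem mul_assoc' (k m n : Nat' M) : k * m * n = k * (m * n) :=
  induction (P := fun n : Nat' M => k * m * n = k * (m * n)) (by fun_prop)
    (by rw [mul_zero', mul_zero', mul_zero'])
    (fun n ih => by rw [mul_succ, mul_succ, mul_add', ih]) n

theorem one_mul' (n : Nat' M) : 1 * n = n := by
  rw [one_def, succ_mul, zero_mul', zero_add']

noncomputable instance instCommSemiring : CommSemiring (Nat' M) where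
  add_assoc := add_assoc'
  zero_add := zero_add'
  add_zero := add_zero'
  add_comm := add_comm'
  nsmul := nsmulRec
  left_distrib := mul_add'
  right_distrib a b c := by rw [mul_comm', mul_add', mul_comm' c, mul_comm' c]
  zero_mul := zero_mul'
  mul_zero := mul_zero'
  mul_assoc := mul_assoc'
  one_mul := one_mul'
  mul_one n := by rw [mul_comm', one_mul']
  mul_comm := mul_comm'

theorem succ_eq (n : Nat' M) : n.succ = n + 1 := by rw [one_def, add_succ, add_zero]

theorem add_lt_add_right' {m n : Nat' M} (h : m < n) (k : Nat' M) : m + k < n + k :=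
  induction (P := fun k : Nat' M => m + k < n + k) (by fun_prop) (by simpa using h)
    (fun k ih => by rw [add_succ, add_succ, succ_lt_succ_iff]; exact ih) k

theorem exists_add_of_le {m n : Nat' M} : m ≤ n → ∃ k, n = m + k := by
  refine induction (P := fun n : Nat' M => m ≤ n → ∃ k, n = m + k) (by fun_prop) ?_ ?_ n
  · exact fun h => ⟨0, by rw [add_zero, le_antisymm h (zero_le' m)]⟩
  · intro n ih h
    rcases h.lt_or_eq with h | rfl
    · obtain ⟨k, rfl⟩ := ih (lt_succ_iff.1 h)
      exact ⟨k.succ, (add_succ _ _).symm⟩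
    · exact ⟨0, (add_zero _).symm⟩

theorem mul_lt_mul_right' {k m n : Nat' M} (h : m < n) : 0 < k → m * k < n * k := by
  refine induction (P := fun k : Nat' M => 0 < k → m * k < n * k) (by fun_prop)
    (fun h => absurd h (lt_irrefl _)) (fun k ih _ => ?_) k
  rw [mul_succ, mul_succ]
  rcases zero_lt_or k with hk | rfl
  · refine (add_lt_add_right' (ih hk) m).trans ?_
    rw [add_comm, add_comm _ n]
    exact add_lt_add_right' h _
  · simpa using h

instance instIsStrictOrderedRing : IsStrictOrderedRing (Nat' M) where
  add_le_add_left a b h c := by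
    rcases h.lt_or_eq with h | rfl
    · exact (add_lt_add_right' h c).le
    · rfl
  le_of_add_le_add_left a b c h := by
    by_contra hcon
    have := add_lt_add_right' (not_le.1 hcon) a
    rw [add_comm, add_comm b] at this
    exact absurd h this.not_ge
  zero_le_one := zero_le' _
  exists_pair_ne := ⟨0, 1, (succ_ne_zero _).symm⟩
  mul_lt_mul_of_pos_left c hc a b h := by
    have := mul_lt_mul_right' h hc
    rwa [mul_comm, mul_comm b] at this
  mul_lt_mul_of_pos_right c hc a b h := mul_lt_mul_right' h hc

instance instCanonicallyOrderedAdd : CanonicallyOrderedAdd (Nat' M) where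
  exists_add_of_le := exists_add_of_le
  le_add_self a b := by
    simpa using add_le_add_left (zero_le' b) a
  le_self_add a b := by
    simpa using add_le_add_right (zero_le' b) a

theorem even_or_odd (n : Nat' M) : ∃ k : Nat' M, n = k + k ∨ n = k + k + 1 := by
  refine induction (P := fun n : Nat' M => ∃ k : Nat' M, n = k + k ∨ n = k + k + 1) (by fun_prop)
    ⟨0, by simp⟩ ?_ n
  rintro n ⟨k, rfl | rfl⟩
  · exact ⟨k, .inr (succ_eq _)⟩
  · exact ⟨k + 1, .inl (by rw [succ_eq]; ring)⟩

theorem add_self_lt {j k : Nat' M} (h : j < k) : j + j + 1 < k + k := by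
  rw [← succ_eq, ← succ_le_iff] at *
  calc (j + j).succ.succ = j.succ + j.succ := by simp only [succ_eq]; ring
    _ ≤ k + k := add_le_add h h

theorem add_self_ne (j k : Nat' M) : j + j + 1 ≠ k + k := by
  intro h
  rcases lt_or_ge j k with h' | h'
  · exact (add_self_lt h').ne h
  · have := add_le_add h' h'
    rw [← h] at this
    exact absurd this (by rw [← succ_eq]; exact (lt_succ_self _).not_ge)

theorem add_self_inj {j k : Nat' M} (h : j + j = k + k) : j = k := by
  rcases lt_trichotomy j k with h' | h' | h'
  · exact absurd h (add_lt_add h' h').ne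
  · exact h'
  · exact absurd h (add_lt_add h' h').ne'

end Nat'

/-! ### Finite sets -/

/-- The set `S` belongs to the model and is finite there. -/
def IsFin (M : Type u) [setLang.Structure M] {α : Type u} [Coded M α] (S : Set α) : Prop :=
  Internal M S ∧ IsFinite M {x : α // x ∈ S}

/-- In the model, `r` is the graph of a bijection between `S` and `{0, …, n - 1}`. -/
def IsEnum (S : Set α) (n : Nat' M) (r : ISet M (α × Nat' M)) : Prop :=
  (∀ x, x ∈ S → ∃! k, (x, k) ∈ r.1) ∧ (∀ k, k < n → ∃! x, (x, k) ∈ r.1) ∧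
    ∀ x k, (x, k) ∈ r.1 → x ∈ S ∧ k < n

/-- The inclusion of the natural number `n = {0, …, n - 1}` in the set of natural numbers. -/
noncomputable def elNat (n : Nat' M) (k : El n.1) : Nat' M := (Nat'.exists_of_mem k.2).choose

theorem elNat_val (n : Nat' M) (k : El n.1) : (elNat n k).1 = k.1 :=
  (Nat'.exists_of_mem k.2).choose_spec

theorem elNat_lt (n : Nat' M) (k : El n.1) : elNat n k < n := by
  rw [Nat'.lt_def, elNat_val]; exact k.2

theorem elNat_injective (n : Nat' M) : Function.Injective (elNat n) := fun j k h =>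
  Subtype.ext (by rw [← elNat_val, h, elNat_val])

theorem exists_elNat {n k : Nat' M} (h : k < n) : ∃ j, elNat n j = k :=
  ⟨⟨k.1, h⟩, Subtype.ext (elNat_val _ _)⟩

@[fun_prop]
theorem defF_elNat (n : Nat' M) : DefF M (elNat n) :=
  defF_of_code_eq fun k => by simp [elNat_val]

/-- The definition of finiteness mentions types that vary with `S` and `n`. A relation on the fixed
type α × ℕ can be quantified over in the model, which makes finiteness a definable condition on `S`.
-/
theorem isFinite_iff_exists_isEnum {S : Set α} (hS : Internal M S) :
    IsFinite M {x : α // x ∈ S} ↔ ∃ n r, IsEnum (M := M) S n r := by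
  have : MSet M {x : α // x ∈ S} := .subtype hS
  constructor
  · rintro ⟨n, f, hf : DefF M f, hfi, hfs⟩
    have hr : DefP M fun p : α × Nat' M => ∃ s : {x // x ∈ S}, s.1 = p.1 ∧ elNat n (f s) = p.2 := by
      fun_prop
    refine ⟨n, ⟨_, hr⟩, ?_, ?_, ?_⟩
    · refine fun x hx => ⟨_, ⟨⟨x, hx⟩, rfl, rfl⟩, ?_⟩
      rintro k ⟨s, rfl, rfl⟩
      rfl
    · intro k hk
      obtain ⟨j, rfl⟩ := exists_elNat hk
      obtain ⟨s, rfl⟩ := hfs j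
      refine ⟨_, ⟨s, rfl, rfl⟩, ?_⟩
      rintro _ ⟨t, rfl, ht⟩
      rw [hfi (elNat_injective _ ht)]
    · rintro _ _ ⟨s, rfl, rfl⟩
      exact ⟨s.2, elNat_lt _ _⟩
  · rintro ⟨n, r, h1, h2, h3⟩
    obtain ⟨f, hf, hf'⟩ := DefF.exists_choice (M := M)
      (P := fun (x : {x // x ∈ S}) (k : El n.1) => (x.1, elNat n k) ∈ r.1) (by fun_prop) (by
        rintro ⟨x, hx⟩
        obtain ⟨k, hk, hk'⟩ := h1 x hx
        obtain ⟨j, rfl⟩ := exists_elNat (h3 _ _ hk).2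
        exact ⟨j, hk, fun i hi => elNat_injective _ (hk' _ hi)⟩)
    refine ⟨n, f, hf, fun x y h => ?_, fun k => ?_⟩
    · have hx := (hf' x _).1 rfl
      have hy := (hf' y _).1 rfl
      rw [h] at hx
      exact Subtype.ext ((h2 _ (elNat_lt _ _)).unique hx hy)
    · obtain ⟨x, hx, -⟩ := h2 _ (elNat_lt _ k)
      exact ⟨⟨x, (h3 _ _ hx).1⟩, (hf' _ _).2 hx⟩

theorem isFin_iff {S : Set α} : IsFin M S ↔ Internal M S ∧ ∃ n r, IsEnum (M := M) S n r :=
  and_congr_right fun h => isFinite_iff_exists_isEnum h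

theorem IsFin.internal {S : Set α} (h : IsFin M S) : Internal M S := h.1

theorem isFin_empty : IsFin M (∅ : Set α) := by
  have h : ∀ (β : Type u) [Coded M β] [MSet M β], Internal M (∅ : Set β) := fun β _ _ =>
    DefP.congr (DefP.const False) fun x => iff_of_false (fun h => h) (fun h => h)
  refine isFin_iff.2 ⟨h α, 0, ⟨∅, h _⟩, ?_, ?_, ?_⟩
  · simp
  · exact fun k hk => absurd hk (Nat'.not_lt_zero' k)
  · simp

protected theorem IsFin.insert {S : Set α} (h : IsFin M S) (x : α) : IsFin M (insert x S) := by
  by_cases hx : x ∈ S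
  · rwa [Set.insert_eq_of_mem hx]
  obtain ⟨hS, n, r, h1, h2, h3⟩ := isFin_iff.1 h
  have hd : DefS M fun x => insert x S := by
    have := DefS.of_internal (α := α) hS
    fun_prop
  have hr : DefS M fun x : α => insert (x, n) r.1 := by fun_prop
  refine isFin_iff.2 ⟨hd.internal x, n.succ, ⟨_, hr.internal x⟩, ?_, ?_, ?_⟩
  · rintro y (rfl | hy)
    · refine ⟨n, .inl rfl, ?_⟩
      rintro k (hk | hk)
      · exact (Prod.mk.inj hk).2
      · exact absurd (h3 _ _ hk).1 hx
    · obtain ⟨k, hk, hk'⟩ := h1 y hy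
      refine ⟨k, .inr hk, ?_⟩
      rintro j (hj | hj)
      · exact absurd ((Prod.mk.inj hj).1 ▸ hy) hx
      · exact hk' _ hj
  · intro k hk
    rcases Nat'.lt_succ'.1 hk with hk | rfl
    · obtain ⟨y, hy, hy'⟩ := h2 k hk
      refine ⟨y, .inr hy, ?_⟩
      rintro z (hz | hz)
      · exact absurd (Prod.mk.inj hz).2 hk.ne
      · exact hy' _ hz
    · refine ⟨x, .inl rfl, ?_⟩
      rintro z (hz | hz)
      · exact (Prod.mk.inj hz).1
      · exact absurd (h3 _ _ hz).2 (lt_irrefl _)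
  · rintro y k (hy | hy)
    · obtain ⟨rfl, rfl⟩ := Prod.mk.inj hy
      exact ⟨.inl rfl, Nat'.lt_succ_self _⟩
    · exact ⟨.inr (h3 _ _ hy).1, (h3 _ _ hy).2.trans (Nat'.lt_succ_self _)⟩

/-- Internal induction on the length of an enumeration: deleting the element with the last index
leaves a set with a shorter enumeration. -/
theorem IsFin.induction_internal {S : Set α} (h : IsFin M S) {P : ISet M α → Prop}
    (hP : DefP M P) (h0 : ∀ S, S.1 = ∅ → P S)
    (hi : ∀ S T x, IsFin M S.1 → x ∉ S.1 → T.1 = insert x S.1 → P S → P T) : P ⟨S, h.1⟩ := by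
  obtain ⟨hS, n, r, hr⟩ := isFin_iff.1 h
  have key : ∀ (n : Nat' M) (S : ISet M α) r, IsEnum S.1 n r → P S := by
    refine Nat'.induction ?_ ?_ ?_
    · simp only [IsEnum]; fun_prop
    · intro S r hr
      refine h0 _ (Set.eq_empty_of_forall_notMem fun x hx => ?_)
      obtain ⟨k, hk, -⟩ := hr.1 x hx
      exact Nat'.not_lt_zero' k (hr.2.2 _ _ hk).2
    · intro n ih S r hr
      obtain ⟨x, hx, hx'⟩ := hr.2.1 n (Nat'.lt_succ_self n)
      have hxS := (hr.2.2 _ _ hx).1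
      have hd : DefS M fun x => S.1 \ {x} := by fun_prop
      have hd' : DefS M fun x : α => r.1 \ {(x, n)} := by fun_prop
      have he : IsEnum (M := M) (S.1 \ {x}) n ⟨_, hd'.internal x⟩ := by
        refine ⟨?_, ?_, ?_⟩
        · rintro y ⟨hy, hyx⟩
          obtain ⟨k, hk, hk'⟩ := hr.1 y hy
          exact ⟨k, ⟨hk, fun h => hyx (Prod.mk.inj h).1⟩, fun j hj => hk' _ hj.1⟩
        · intro k hk
          obtain ⟨y, hy, hy'⟩ := hr.2.1 k (hk.trans (Nat'.lt_succ_self n))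
          exact ⟨y, ⟨hy, fun h => hk.ne (Prod.mk.inj h).2⟩, fun z hz => hy' _ hz.1⟩
        · rintro y k ⟨hy, hyk⟩
          obtain ⟨h1, h2⟩ := hr.2.2 _ _ hy
          have hyx : y ≠ x := by
            rintro rfl
            exact hyk (by rw [(hr.1 _ h1).unique hy hx]; rfl)
          refine ⟨⟨h1, hyx⟩, (Nat'.lt_succ'.1 h2).resolve_right ?_⟩
          rintro rfl
          exact hyx (hx' _ hy)
      exact hi ⟨_, hd.internal x⟩ S x (isFin_iff.2 ⟨hd.internal x, _, _, he⟩) (by simp)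
        (by simp [Set.insert_eq_of_mem hxS]) (ih ⟨_, hd.internal x⟩ _ he)
  exact key n ⟨S, hS⟩ r hr

@[fun_prop]
theorem DefP.isFin {F : β → Set α} (hF : DefS M F) : DefP M fun x => IsFin M (F x) := by
  have : DefP M fun x => ∃ n r, IsEnum (M := M) (F x) n r := by
    simp only [IsEnum]; fun_prop
  exact this.congr fun x => isFin_iff.trans (and_iff_right (hF.internal x))

instance instMSetFin : MSet M (Fin' M α) :=
  .subtype_set (fun _ h => h.1) (DefP.isFin (M := M) (F := fun S : ISet M α => S.1) (by fun_prop))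

theorem Fin'.isFin (F : Fin' M α) : IsFin M F.1 := F.2

theorem Fin'.induction {P : Fin' M α → Prop} (hP : DefP M P) (h0 : ∀ F, F.1 = ∅ → P F)
    (hi : ∀ F G x, x ∉ F.1 → G.1 = insert x F.1 → P F → P G) (F : Fin' M α) : P F := by
  have := F.isFin.induction_internal (P := fun S => ∃ G : Fin' M α, G.1 = S.1 ∧ P G) (by fun_prop)
    (fun S h => ⟨⟨S.1, by rw [h]; exact isFin_empty⟩, rfl, h0 _ h⟩)
    (by
      rintro S T x hS hx hT ⟨G, hG, hPG⟩
      exact ⟨⟨T.1, by rw [hT]; exact hS.insert x⟩, rfl, hi G _ x (hG ▸ hx) (hG ▸ hT) hPG⟩)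
  obtain ⟨G, hG, h⟩ := this
  rwa [← Subtype.ext hG]

theorem isFin_singleton (x : α) : IsFin M {x} := by
  simpa using (isFin_empty (M := M)).insert x

theorem IsFin.union {S T : Set α} (hS : IsFin M S) (hT : IsFin M T) : IsFin M (S ∪ T) := by
  have := DefS.of_internal (α := Fin' M α) hT.internal
  refine Fin'.induction (P := fun F : Fin' M α => IsFin M (F.1 ∪ T)) (by fun_prop)
    (fun F h => by simpa [h]) (fun F G x _ hG h => ?_) ⟨S, hS⟩
  rw [hG, Set.insert_union]
  exact h.insert x

theorem IsFin.image {S : Set α} (hS : IsFin M S) {f : α → β} (hf : DefF M f) :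
    IsFin M (f '' S) := by
  refine Fin'.induction (P := fun F : Fin' M α => IsFin M (f '' F.1)) (by fun_prop)
    (fun F h => by simpa [h] using isFin_empty) (fun F G x _ hG h => ?_) ⟨S, hS⟩
  rw [hG, Set.image_insert_eq]
  exact h.insert _

theorem IsFin.subset {S T : Set α} (hS : IsFin M S) (hT : Internal M T) (h : T ⊆ S) :
    IsFin M T := by
  refine Fin'.induction (P := fun F : Fin' M α => ∀ T : ISet M α, T.1 ⊆ F.1 → IsFin M T.1)
    (by fun_prop) ?_ ?_ ⟨S, hS⟩ ⟨T, hT⟩ h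
  · intro F hF T h
    rw [hF, Set.subset_empty_iff] at h
    rw [h]; exact isFin_empty
  · intro F G x hx hG ih T hT
    have hd : DefS M fun x => T.1 \ {x} := by fun_prop
    have := ih ⟨_, hd.internal x⟩ (by
      rintro y ⟨hy, hyx⟩
      rw [hG] at hT
      exact (hT hy).resolve_left hyx)
    by_cases hxT : x ∈ T.1
    · simpa [Set.insert_eq_of_mem hxT] using this.insert x
    · simpa [Set.sdiff_singleton_eq_self hxT] using this

/-- The finite subsets of a finite set form a finite set. -/
theorem IsFin.powerset {S : Set α} (hS : IsFin M S) : IsFin M {T : Fin' M α | T.1 ⊆ S} := by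
  refine Fin'.induction (P := fun F : Fin' M α => IsFin M {T : Fin' M α | T.1 ⊆ F.1})
    (by fun_prop) ?_ ?_ ⟨S, hS⟩
  · intro F hF
    convert! isFin_singleton (M := M) (⟨∅, isFin_empty⟩ : Fin' M α) using 1
    ext T
    simp [hF, Subtype.ext_iff]
  · intro F G x hx hG ih
    have hf : DefF M fun T : Fin' M α => (⟨insert x T.1, T.isFin.insert x⟩ : Fin' M α) := by
      fun_prop
    -- A subset of F ∪ {x} is a subset of F or arises from one by inserting x.
    refine (ih.union (ih.image hf)).subset
      (DefS.internal (F := fun G : Fin' M α => {T : Fin' M α | T.1 ⊆ G.1}) (by fun_prop) G) ?_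
    intro T hT
    have hd : DefS M fun x => T.1 \ {x} := by fun_prop
    have hsub : T.1 \ {x} ⊆ F.1 := by
      rintro y ⟨hy, hyx⟩
      rw [Set.mem_ofPred_eq, hG] at hT
      exact (hT hy).resolve_left hyx
    by_cases hxT : x ∈ T.1
    · refine .inr ⟨⟨T.1 \ {x}, T.isFin.subset (hd.internal x) Set.sdiff_subset⟩, hsub, ?_⟩
      exact Subtype.ext (by simp [Set.insert_eq_of_mem hxT])
    · exact .inl (by simpa [Set.sdiff_singleton_eq_self hxT] using hsub)

end nat

/-! ### Finite sums -/

section fsum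
variable {M : Type u} [setLang.Structure M] {α ι κ A B : Type u}
  [Coded M α] [Coded M ι] [Coded M κ] [Coded M A] [Coded M B]
  [ZF : Fact (IsModelZF M)] [MSet M α] [MSet M ι] [MSet M κ] [MSet M A] [MSet M B]
  [AddCommMonoid A] [DefAdd M A] [AddCommMonoid B] [DefAdd M B]

/-- No ordering of `ι` is available, so the recursion is on finite sets. `good F τ` demands the
recursion equation only for subsets of `F`, but for every order of adding points; two such
approximations agree on common subsets and thus determine the sum. -/
theorem exists_isFinSums {a : ι → A} (ha : DefF M a) : ∃ σ, IsFinSums M a σ := by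
  let good (F : Fin' M ι) (τ : IFun M (Fin' M ι) A) : Prop := (∀ G, G.1 = ∅ → τ.1 G = 0) ∧
    ∀ (G H : Fin' M ι) (x : ι), H.1 ⊆ F.1 → x ∉ G.1 → H.1 = insert x G.1 → τ.1 H = τ.1 G + a x
  have hgood : DefP M fun p : Fin' M ι × IFun M (Fin' M ι) A => good p.1 p.2 := by
    simp only [good]; fun_prop
  have ex : ∀ F, ∃ τ, good F τ := by
    refine Fin'.induction (by fun_prop) ?_ ?_
    · intro F hF
      refine ⟨⟨fun _ => 0, DefF.const 0⟩, fun _ _ => rfl, fun G H x hH _ h => ?_⟩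
      rw [hF, h] at hH
      exact absurd (hH (.inl rfl)) (Set.notMem_empty x)
    · rintro F F' z hz hF' ⟨τ, h0, h1⟩
      have hr : ∀ G : Fin' M ι, IsFin M (G.1 \ {z}) := fun G =>
        G.isFin.subset (DefS.internal (F := fun G : Fin' M ι => G.1 \ {z}) (by fun_prop) G)
          Set.sdiff_subset
      classical
      -- The new point `z` is stripped off first and its value added last; commutativity of addition
      -- makes the order irrelevant.
      have hτ : DefF M fun G : Fin' M ι =>
          if z ∈ G.1 then τ.1 ⟨G.1 \ {z}, hr G⟩ + a z else τ.1 G := by fun_prop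
      refine ⟨⟨_, hτ⟩, fun G hG => ?_, fun G H x hH hx h => ?_⟩
      · simp [hG, h0 G hG]
      · dsimp only
        by_cases hxz : x = z
        · subst hxz
          have : (⟨H.1 \ {x}, hr H⟩ : Fin' M ι) = G := Subtype.ext (by simp [h, hx])
          rw [if_pos (by rw [h]; exact .inl rfl), if_neg hx, this]
        · by_cases hzG : z ∈ G.1
          · rw [if_pos (by rw [h]; exact .inr hzG), if_pos hzG,
              h1 ⟨G.1 \ {z}, hr G⟩ ⟨H.1 \ {z}, hr H⟩ x ?_ ?_ ?_, add_right_comm]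
            · rw [hF'] at hH
              rintro y ⟨hy, hyz⟩
              exact (hH hy).resolve_left hyz
            · exact fun hx' => hx hx'.1
            · simp only [h]
              rw [Set.insert_sdiff_of_notMem _ (by simpa using hxz)]
          · have hzH : z ∉ H.1 := by
              rw [h]; rintro (h' | h')
              · exact hxz h'.symm
              · exact hzG h'
            rw [if_neg hzH, if_neg hzG, h1 G H x ?_ hx h]
            rw [hF'] at hH
            exact fun y hy => (hH hy).resolve_left fun hyz => hzH (hyz ▸ hy)
  have un : ∀ F F' τ τ', good F τ → good F' τ' → ∀ G : Fin' M ι, G.1 ⊆ F.1 → G.1 ⊆ F'.1 →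
      τ.1 G = τ'.1 G := by
    intro F F' τ τ' h h'
    refine Fin'.induction (by fun_prop) ?_ ?_
    · exact fun G hG _ _ => by rw [h.1 G hG, h'.1 G hG]
    · intro G H x hx hH ih hF hF'
      have hGH : G.1 ⊆ H.1 := by rw [hH]; exact Set.subset_insert _ _
      rw [h.2 G H x hF hx hH, h'.2 G H x hF' hx hH, ih (hGH.trans hF) (hGH.trans hF')]
  obtain ⟨σ, hσ, hσ'⟩ := DefF.exists_choice (M := M)
    (P := fun (F : Fin' M ι) (y : A) => ∃ τ, good F τ ∧ τ.1 F = y) (by fun_prop) (by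
      intro F
      obtain ⟨τ, hτ⟩ := ex F
      refine ⟨_, ⟨τ, hτ, rfl⟩, ?_⟩
      rintro y ⟨τ', hτ', rfl⟩
      exact un F F _ _ hτ' hτ F subset_rfl subset_rfl)
  refine ⟨σ, hσ, fun F hF => ?_, fun F G x hx hG => ?_⟩
  · obtain ⟨τ, hτ⟩ := ex F
    exact (hσ' _ _).2 ⟨τ, hτ, hτ.1 F hF⟩
  · obtain ⟨τ, hτ⟩ := ex G
    have hGF : F.1 ⊆ G.1 := by rw [hG]; exact Set.subset_insert _ _
    rw [(hσ' G _).2 ⟨τ, hτ, rfl⟩, hτ.2 F G x subset_rfl hx hG]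
    congr 1
    refine Eq.symm ((hσ' F _).2 ⟨τ, ⟨hτ.1, fun G' H y hH => hτ.2 G' H y (hH.trans hGF)⟩, rfl⟩)

theorem IsFinSums.unique {a : ι → A} {σ τ : Fin' M ι → A} (h : IsFinSums M a σ)
    (h' : IsFinSums M a τ) : σ = τ := by
  funext F
  have h1 : DefF M σ := h.1
  have h2 : DefF M τ := h'.1
  refine Fin'.induction (P := fun F => σ F = τ F) (by fun_prop) ?_ ?_ F
  · exact fun F hF => by rw [h.2.1 F hF, h'.2.1 F hF]
  · exact fun F G x hx hG ih => by rw [h.2.2 F G x hx hG, h'.2.2 F G x hx hG, ih]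

open Classical in
/-- The sum of the values of `a` over a finite set of the model. -/
noncomputable def fsum (a : ι → A) (F : Fin' M ι) : A :=
  if h : ∃ σ, IsFinSums M a σ then h.choose F else 0

theorem isFinSums_fsum {a : ι → A} (ha : DefF M a) : IsFinSums M a (fsum a) := by
  have h := exists_isFinSums ha
  have : fsum (M := M) a = h.choose := by funext F; simp only [fsum, dif_pos h]
  rw [this]
  exact h.choose_spec

theorem IsFinSums.eq_fsum {a : ι → A} (ha : DefF M a) {σ : Fin' M ι → A} (h : IsFinSums M a σ) :
    σ = fsum a := h.unique (isFinSums_fsum ha)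

@[fun_prop]
theorem DefF.fsum {a : α → ι → A} {F : α → Fin' M ι} (ha : DefF M fun p : α × ι => a p.1 p.2)
    (hF : DefF M F) : DefF M fun x => fsum (a x) (F x) := by
  refine .of_graph (P := fun x y => ∃ σ : IFun M (Fin' M ι) A, ((∀ F, F.1 = ∅ → σ.1 F = 0) ∧
    ∀ (F G : Fin' M ι) (z : ι), z ∉ F.1 → G.1 = insert z F.1 → σ.1 G = σ.1 F + a x z) ∧
    σ.1 (F x) = y) (by fun_prop) fun x y => ?_
  have hx : DefF M (a x) := by fun_prop
  constructor
  · rintro rfl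
    have := isFinSums_fsum hx
    exact ⟨⟨_, this.1⟩, this.2, rfl⟩
  · rintro ⟨σ, h, rfl⟩
    rw [IsFinSums.eq_fsum hx (σ := σ.1) ⟨σ.2, h⟩]

variable {a b : ι → A} {F G : Fin' M ι}

theorem fsum_empty (ha : DefF M a) (hF : F.1 = ∅) : fsum a F = 0 := (isFinSums_fsum ha).2.1 F hF

theorem fsum_insert (ha : DefF M a) {x : ι} (hx : x ∉ F.1) (hG : G.1 = insert x F.1) :
    fsum a G = fsum a F + a x := (isFinSums_fsum ha).2.2 F G x hx hG

theorem fsum_singleton (ha : DefF M a) {x : ι} (hF : F.1 = {x}) : fsum a F = a x := by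
  rw [fsum_insert (F := ⟨∅, isFin_empty⟩) ha (Set.notMem_empty x) (by simpa using hF),
    fsum_empty ha rfl, zero_add]

theorem fsum_congr (ha : DefF M a) (hb : DefF M b) : (∀ x ∈ F.1, a x = b x) →
    fsum a F = fsum b F := by
  refine Fin'.induction (P := fun F => (∀ x, x ∈ F.1 → a x = b x) → fsum a F = fsum b F)
    (by fun_prop) ?_ ?_ F
  · exact fun F hF _ => by rw [fsum_empty ha hF, fsum_empty hb hF]
  · intro F G x hx hG ih h
    rw [fsum_insert ha hx hG, fsum_insert hb hx hG, ih fun y hy => h y (hG ▸ .inr hy),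
      h x (hG ▸ .inl rfl)]

theorem fsum_map (ha : DefF M a) (φ : A →+ B) (hφ : DefF M φ) :
    fsum (fun x => φ (a x)) F = φ (fsum a F) := by
  have hφa : DefF M fun x => φ (a x) := by fun_prop
  refine Fin'.induction (P := fun F => fsum (fun x => φ (a x)) F = φ (fsum a F))
    (by fun_prop) ?_ ?_ F
  · exact fun F hF => by rw [fsum_empty ha hF, fsum_empty hφa hF, map_zero]
  · exact fun F G x hx hG ih => by rw [fsum_insert ha hx hG, fsum_insert hφa hx hG, ih, map_add]

theorem fsum_add (ha : DefF M a) (hb : DefF M b) :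
    fsum (fun x => a x + b x) F = fsum a F + fsum b F := by
  have hab : DefF M fun x => a x + b x := by fun_prop
  refine Fin'.induction (P := fun F => fsum (fun x => a x + b x) F = fsum a F + fsum b F)
    (by fun_prop) ?_ ?_ F
  · exact fun F hF => by rw [fsum_empty ha hF, fsum_empty hb hF, fsum_empty hab hF, add_zero]
  · intro F G x hx hG ih
    rw [fsum_insert ha hx hG, fsum_insert hb hx hG, fsum_insert hab hx hG, ih, add_add_add_comm]

theorem fsum_zero : fsum (fun _ : ι => (0 : A)) F = 0 := by
  have h := DefF.const (M := M) (α := ι) (0 : A)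
  refine Fin'.induction (P := fun F : Fin' M ι => fsum (fun _ : ι => (0 : A)) F = 0)
    (by fun_prop) ?_ ?_ F
  · exact fun F hF => fsum_empty h hF
  · exact fun F G x hx hG ih => by rw [fsum_insert h hx hG, ih, add_zero]

theorem fsum_union (ha : DefF M a) {H : Fin' M ι} : Disjoint F.1 G.1 → H.1 = F.1 ∪ G.1 →
    fsum a H = fsum a F + fsum a G := by
  refine Fin'.induction (P := fun G : Fin' M ι => ∀ H : Fin' M ι, Disjoint F.1 G.1 →
    H.1 = F.1 ∪ G.1 → fsum a H = fsum a F + fsum a G) (by fun_prop) ?_ ?_ G H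
  · intro G hG H _ hH
    rw [fsum_empty ha hG, add_zero]
    congr 1
    exact Subtype.ext (by simp [hH, hG])
  · intro G G' x hx hG ih H hd hH
    rw [hG, Set.disjoint_insert_right] at hd
    let K : Fin' M ι := ⟨F.1 ∪ G.1, F.isFin.union G.isFin⟩
    rw [fsum_insert ha hx hG, ← add_assoc, ← ih K hd.2 rfl]
    refine fsum_insert ha ?_ ?_
    · rintro (h | h)
      · exact hd.1 h
      · exact hx h
    · rw [hH, hG, Set.union_insert]

theorem fsum_image {f : κ → ι} (hf : DefF M f) (hi : Function.Injective f) (ha : DefF M a)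
    {E : Fin' M κ} : F.1 = f '' E.1 → fsum a F = fsum (fun x => a (f x)) E := by
  have haf : DefF M fun x => a (f x) := by fun_prop
  refine Fin'.induction (P := fun E : Fin' M κ => ∀ F : Fin' M ι, F.1 = f '' E.1 →
    fsum a F = fsum (fun x => a (f x)) E) (by fun_prop) ?_ ?_ E F
  · exact fun E hE F hF => by
      rw [fsum_empty haf hE, fsum_empty ha (by simpa [hE] using hF)]
  · intro E E' x hx hE ih F hF
    let F' : Fin' M ι := ⟨f '' E.1, E.isFin.image hf⟩
    rw [fsum_insert haf hx hE, ← ih F' rfl]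
    refine fsum_insert ha ?_ ?_
    · rintro ⟨y, hy, hxy⟩
      exact hx (hi hxy ▸ hy)
    · rw [hF, hE, Set.image_insert_eq]

end fsum

/-! ### Finite sums in ordered monoids -/

section ordered
variable {M : Type u} [setLang.Structure M] {ι A : Type u} [Coded M ι] [Coded M A]
  [ZF : Fact (IsModelZF M)] [MSet M ι] [MSet M A]
  [AddCommMonoid A] [LinearOrder A] [IsOrderedAddMonoid A] [DefAdd M A] [DefLE M A]
  {a b : ι → A} {F G : Fin' M ι}

theorem fsum_le_fsum (ha : DefF M a) (hb : DefF M b) :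
    (∀ x ∈ F.1, a x ≤ b x) → fsum a F ≤ fsum b F := by
  refine Fin'.induction (P := fun F => (∀ x, x ∈ F.1 → a x ≤ b x) → fsum a F ≤ fsum b F)
    (by fun_prop) ?_ ?_ F
  · exact fun F hF _ => by rw [fsum_empty ha hF, fsum_empty hb hF]
  · intro F G x hx hG ih h
    rw [fsum_insert ha hx hG, fsum_insert hb hx hG]
    exact add_le_add (ih fun y hy => h y (hG ▸ .inr hy)) (h x (hG ▸ .inl rfl))

theorem fsum_nonneg (ha : DefF M a) (h : ∀ x, 0 ≤ a x) : 0 ≤ fsum a F := by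
  have := fsum_le_fsum (F := F) (DefF.const (M := M) (0 : A)) ha fun x _ => h x
  rwa [fsum_zero] at this

theorem fsum_mono (ha : DefF M a) (h : ∀ x, 0 ≤ a x) (hFG : F.1 ⊆ G.1) : fsum a F ≤ fsum a G := by
  let H : Fin' M ι := ⟨G.1 \ F.1, G.isFin.subset
    (DefS.internal (F := fun F : Fin' M ι => G.1 \ F.1) (by fun_prop) F) Set.sdiff_subset⟩
  have := fsum_union (F := F) (G := H) (H := G) ha Set.disjoint_sdiff_right
    (by simp [H, Set.union_eq_self_of_subset_left hFG])
  rw [this]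
  exact le_add_of_nonneg_right (fsum_nonneg ha h)

end ordered

/-! ### Differences and fractions of elements of an ordered semiring -/

section embed
open TensorProduct

variable (N : Type u) [CommSemiring N] [LinearOrder N] [IsStrictOrderedRing N]
  [CanonicallyOrderedAdd N]

/-- The ring of differences of elements of a semiring. -/
def DiffRing : Type u := ℤ ⊗[ℕ] N

noncomputable instance instCommRingDiff : CommRing (DiffRing N) :=
  inferInstanceAs (CommRing (ℤ ⊗[ℕ] N))

/-- The canonical map to the ring of differences. -/
noncomputable def toDiff : N →+* DiffRing N :=
  (Algebra.TensorProduct.includeRight : N →ₐ[ℕ] ℤ ⊗[ℕ] N).toRingHom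

/-- Addition is cancellative, so `N` embeds in its Grothendieck group; the action of ℤ on that group
gives a map from the tensor product that sends 1 ⊗ a to the class of a. -/
theorem toDiff_injective : Function.Injective (toDiff N) := by
  let G := Algebra.GrothendieckAddGroup N
  let o : N →+ G := Algebra.GrothendieckAddGroup.of
  have ho : Function.Injective o := by
    intro a b h
    obtain ⟨c, hc⟩ := (AddLocalization.addMonoidOf (⊤ : AddSubmonoid N)).eq_iff_exists.1 h
    exact add_left_cancel hc
  let φ : ℤ ⊗[ℕ] N →ₗ[ℕ] G := TensorProduct.lift
    (LinearMap.mk₂ ℕ (fun (n : ℤ) a => n • o a) (fun m n a => add_smul _ _ _)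
      (fun c m n => by simp [mul_smul]) (fun m a b => by simp) (fun c m n => by
        rw [map_nsmul, smul_comm]))
  intro a b h
  have h' : φ (1 ⊗ₜ a) = φ (1 ⊗ₜ b) := congrArg φ h
  have hφ : ∀ a, φ (1 ⊗ₜ a) = o a := fun a =>
    (TensorProduct.lift.tmul _ _).trans (one_smul ℤ (o a))
  exact ho (by rw [← hφ, h', hφ])

/-- Every tensor is a difference of two elements of `N`; the order is total and canonical, so the
smaller one can be subtracted from the larger. -/
theorem exists_toDiff (z : DiffRing N) : ∃ a, z = toDiff N a ∨ z = - toDiff N a := by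
  have key : ∃ a b, z = toDiff N a - toDiff N b := by
    induction z using TensorProduct.induction_on with
    | zero => exact ⟨0, 0, (sub_self _).symm⟩
    | tmul n a =>
      have h : (n ⊗ₜ[ℕ] a : DiffRing N) = n • toDiff N a := by
        have : n • ((1 : ℤ) ⊗ₜ[ℕ] a) = n ⊗ₜ[ℕ] a := by rw [TensorProduct.smul_tmul']; simp
        exact this.symm
      obtain ⟨k, rfl | rfl⟩ := n.eq_nat_or_neg
      · exact ⟨k • a, 0, by rw [h, map_nsmul]; simp⟩
      · exact ⟨0, k • a, by rw [h, map_nsmul]; simp⟩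
    | add x y hx hy =>
      obtain ⟨a, b, rfl⟩ := hx
      obtain ⟨c, d, rfl⟩ := hy
      refine ⟨a + c, b + d, ?_⟩
      change (_ + _ : DiffRing N) = _
      simp only [map_add]; abel
  obtain ⟨a, b, rfl⟩ := key
  rcases le_total a b with h | h <;> obtain ⟨c, rfl⟩ := exists_add_of_le h
  · exact ⟨c, .inr (by rw [map_add]; abel)⟩
  · exact ⟨c, .inl (by rw [map_add]; abel)⟩

instance instNontrivialDiff : Nontrivial (DiffRing N) := (toDiff_injective N).nontrivial

instance instIsDomainDiff : IsDomain (DiffRing N) := by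
  have : NoZeroDivisors (DiffRing N) := ⟨by
    intro x y h
    have hz : ∀ a, toDiff N a = 0 ↔ a = 0 := fun a => by
      rw [← map_zero (toDiff N), (toDiff_injective N).eq_iff]
    obtain ⟨a, rfl | rfl⟩ := exists_toDiff N x <;> obtain ⟨b, rfl | rfl⟩ := exists_toDiff N y <;>
    · simp only [neg_mul, mul_neg, neg_neg, neg_eq_zero, ← map_mul, hz, mul_eq_zero] at h ⊢
      exact h⟩
  exact NoZeroDivisors.to_isDomain _

/-- A linearly ordered semiring with subtraction embeds in an ordered field of fractions. -/
theorem exists_field_of_fractions : ∃ (K : Type u) (_ : Field K) (_ : LinearOrder K)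
    (_ : IsStrictOrderedRing K) (i : N →+* K), StrictMono i ∧
    ∀ x, ∃ a b c, c ≠ 0 ∧ x = (i a - i b) / i c := by
  let K := FractionRing (DiffRing N)
  let i : N →+* K := (algebraMap (DiffRing N) K).comp (toDiff N)
  have hi : Function.Injective i :=
    (IsFractionRing.injective (DiffRing N) K).comp (toDiff_injective N)
  have hz : ∀ a, i a = 0 ↔ a = 0 := fun a => by rw [← map_zero i, hi.eq_iff]
  have hK : ∀ x : K, ∃ a b, b ≠ 0 ∧ (x = i a / i b ∨ x = - (i a / i b)) := by
    intro x
    obtain ⟨p, q, hq, rfl⟩ := IsFractionRing.div_surjective (A := DiffRing N) x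
    have hq0 : q ≠ 0 := nonZeroDivisors.ne_zero hq
    obtain ⟨a, rfl | rfl⟩ := exists_toDiff N p <;> obtain ⟨b, rfl | rfl⟩ := exists_toDiff N q
    all_goals
      have hb : b ≠ 0 := by rintro rfl; simp at hq0
      refine ⟨a, b, hb, ?_⟩
      simp [i, div_neg, neg_div]
  -- The nonnegative elements are the fractions of elements of `N`. Opposite fractions vanish
  -- because in `N` a sum is zero only if both terms are.
  let P : RingCone K :=
    { carrier := {x | ∃ a b, b ≠ 0 ∧ x = i a / i b}
      mul_mem' := by
        rintro _ _ ⟨a, b, hb, rfl⟩ ⟨c, d, hd, rfl⟩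
        exact ⟨a * c, b * d, mul_ne_zero hb hd, by rw [map_mul, map_mul, div_mul_div_comm]⟩
      one_mem' := ⟨1, 1, one_ne_zero, by simp⟩
      add_mem' := by
        rintro _ _ ⟨a, b, hb, rfl⟩ ⟨c, d, hd, rfl⟩
        refine ⟨a * d + b * c, b * d, mul_ne_zero hb hd, ?_⟩
        rw [div_add_div _ _ (mt (hz b).1 hb) (mt (hz d).1 hd)]
        simp
      zero_mem' := ⟨0, 1, one_ne_zero, by simp⟩
      eq_zero_of_mem_of_neg_mem' := by
        rintro _ ⟨a, b, hb, rfl⟩ ⟨c, d, hd, h⟩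
        have hb' := mt (hz b).1 hb
        have hd' := mt (hz d).1 hd
        have h2 : i (a * d + b * c) = 0 := by
          have h1 : i a / i b + i c / i d = 0 := by rw [← h]; ring
          rw [div_add_div _ _ hb' hd', div_eq_zero_iff, or_iff_left (mul_ne_zero hb' hd')] at h1
          simpa using h1
        rw [hz, add_eq_zero, mul_eq_zero, or_iff_left hd] at h2
        simp [h2.1] }
  have hP : ∀ x, x ∈ P ↔ ∃ a b, b ≠ 0 ∧ x = i a / i b := fun x => Iff.rfl
  have : HasMemOrNegMem P := ⟨fun x => by
    obtain ⟨a, b, hb, rfl | rfl⟩ := hK x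
    · exact .inl ⟨a, b, hb, rfl⟩
    · exact .inr ⟨a, b, hb, neg_neg _⟩⟩
  classical
  let o : LinearOrder K := .mkOfAddGroupCone P
  have h1 : IsOrderedRing K := .mkOfCone P
  have h2 : IsStrictOrderedRing K := IsOrderedRing.toIsStrictOrderedRing K
  refine ⟨K, inferInstance, o, h2, i, ?_, fun x => ?_⟩
  · refine Monotone.strictMono_of_injective (fun a b h => ?_) hi
    obtain ⟨c, rfl⟩ := exists_add_of_le h
    change i (a + c) - i a ∈ P
    exact ⟨c, 1, one_ne_zero, by simp⟩
  · obtain ⟨a, b, hb, rfl | rfl⟩ := hK x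
    · exact ⟨a, 0, b, hb, by simp⟩
    · exact ⟨0, a, b, hb, by simp [neg_div]⟩

end embed

/-! ### Quotients by definable equivalence relations -/

section quotient
variable {M : Type u} [setLang.Structure M] {α β Q : Type u} [Coded M α] [Coded M β]
  [ZF : Fact (IsModelZF M)] [MSet M α] [MSet M β]

variable (M) in
/-- The elements of a quotient of `α` are coded as equivalence classes. -/
@[reducible]
def quotCoded (g : α → Q) : Coded M Q := ⟨fun q m => Coded.Code {a | g a = q} m⟩

/-- A quotient formed outside the model enters it because its elements are coded by the classes of a
relation of the model, and being the class of some `a` is a definable condition on sets. -/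
theorem mset_quotCoded {g : α → Q} (hg : Function.Surjective g)
    (hk : DefP M fun p : α × α => g p.1 = g p.2) :
    letI := quotCoded M g
    MSet M Q ∧ DefF M g := by
  let _ := quotCoded M g
  have hs : DefS M fun a : α => {b | g b = g a} :=
    DefP.comp (P := fun p : α × α => g p.1 = g p.2) (f := fun q : α × α => (q.2, q.1)) hk
      (by fun_prop)
  let e : Q → ISet M α := fun q => ⟨{b | g b = q}, by
    obtain ⟨a, rfl⟩ := hg q
    exact hs.internal a⟩
  have he : Function.Injective e := fun q r h => by
    obtain ⟨a, rfl⟩ := hg q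
    have : a ∈ (e r).1 := h ▸ rfl
    exact this
  have hr : DefP M (· ∈ Set.range e) := by
    refine DefP.congr (P := fun S : ISet M α => ∃ a, S.1 = {b | g b = g a})
      (.exists (DefP.set_eq (by fun_prop) (DefS.comp (F := fun a => {b | g b = g a}) hs .snd)))
      fun S => ⟨?_, ?_⟩
    · rintro ⟨q, rfl⟩
      obtain ⟨a, rfl⟩ := hg q
      exact ⟨a, rfl⟩
    · rintro ⟨a, ha⟩
      exact ⟨g a, Subtype.ext ha.symm⟩
  have h1 : MSet M Q := .of_injective he (fun _ _ => Iff.rfl) hr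
  refine ⟨h1, .of_comp (MSet.defF_of_code_iff (e := e) fun _ _ => Iff.rfl) he ?_⟩
  exact DefF.mkSet hs _

variable [Coded M Q] [MSet M Q]

theorem DefF.of_surjective {g : α → Q} (hg : DefF M g) (hs : Function.Surjective g) {f : Q → β}
    (h : DefF M fun a => f (g a)) : DefF M f := by
  refine .of_graph (P := fun q y => ∃ a, g a = q ∧ f (g a) = y)
    (.exists (.and (by fun_prop) (.eq (h.comp .snd) (by fun_prop)))) fun q y => ?_
  obtain ⟨a, rfl⟩ := hs q
  exact ⟨fun h => ⟨a, rfl, h⟩, by rintro ⟨b, hb, rfl⟩; rw [hb]⟩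

theorem DefP.of_surjective {g : α → Q} (hg : DefF M g) (hs : Function.Surjective g) {P : Q → Prop}
    (h : DefP M fun a => P (g a)) : DefP M P := by
  refine DefP.congr (P := fun q => ∃ a, g a = q ∧ P (g a))
    (.exists (.and (by fun_prop) (DefP.comp (P := fun a => P (g a)) h .snd))) fun q => ?_
  obtain ⟨a, rfl⟩ := hs q
  exact ⟨fun h => ⟨a, rfl, h⟩, by rintro ⟨b, hb, h⟩; rwa [← hb]⟩

end quotient

/-! ### Rational numbers -/

section rationals
variable {M : Type u} [setLang.Structure M] [ZF : Fact (IsModelZF M)]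

/-- The rational numbers of the model. -/
theorem exists_rationals : ∃ (K : Type u) (_ : Field K) (_ : LinearOrder K)
    (_ : IsStrictOrderedRing K) (_ : Coded M K) (_ : MSet M K) (_ : DefAdd M K) (_ : DefMul M K)
    (_ : DefLE M K) (i : Nat' M →+* K), StrictMono i ∧ DefF M i ∧ ∀ x, ∃ n, x ≤ i n := by
  obtain ⟨K, _, _, _, i, hi, hK⟩ := exists_field_of_fractions (Nat' M)
  have hpos : ∀ c, 0 < i (c + 1) := fun c => by
    rw [← map_zero i]
    refine hi ?_
    rw [← Nat'.succ_eq]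
    exact Nat'.zero_le' c |>.trans_lt (Nat'.lt_succ_self c)
  -- The triple (a, b, c) stands for (a - b) / (c + 1); the shift in the denominator admits all
  -- triples.
  let g : Nat' M × Nat' M × Nat' M → K := fun t => (i t.1 - i t.2.1) / i (t.2.2 + 1)
  have hg : Function.Surjective g := fun x => by
    obtain ⟨a, b, c, hc, rfl⟩ := hK x
    obtain ⟨c, rfl⟩ := (Nat'.eq_zero_or_succ c).resolve_left hc
    exact ⟨(a, b, c), by rw [Nat'.succ_eq]⟩
  -- Cross-multiplied and freed of subtraction, the order is a condition on natural numbers and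
  -- therefore definable.
  have hle : ∀ s t, g s ≤ g t ↔ s.1 * (t.2.2 + 1) + t.2.1 * (s.2.2 + 1) ≤
      t.1 * (s.2.2 + 1) + s.2.1 * (t.2.2 + 1) := by
    intro s t
    rw [← hi.le_iff_le, div_le_div_iff₀ (hpos _) (hpos _), ← sub_nonneg,
      ← sub_nonneg (a := i (_ + _))]
    apply iff_of_eq
    congr 1
    simp only [map_add, map_mul]
    ring
  have hk : DefP M fun p : (Nat' M × Nat' M × Nat' M) × (Nat' M × Nat' M × Nat' M) =>
      g p.1 ≤ g p.2 := by
    simp only [hle]; fun_prop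
  have hk' : DefP M fun p : (Nat' M × Nat' M × Nat' M) × (Nat' M × Nat' M × Nat' M) =>
      g p.1 = g p.2 := by
    simp only [le_antisymm_iff, hle]; fun_prop
  let _ : Coded M K := quotCoded M g
  obtain ⟨h1, h2⟩ := mset_quotCoded hg hk'
  have h3 : DefF M fun p : (Nat' M × Nat' M × Nat' M) × (Nat' M × Nat' M × Nat' M) =>
      (g p.1, g p.2) := by fun_prop
  have h3' : Function.Surjective fun p : (Nat' M × Nat' M × Nat' M) × (Nat' M × Nat' M × Nat' M) =>
      (g p.1, g p.2) := hg.prodMap hg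
  refine ⟨K, inferInstance, inferInstance, inferInstance, inferInstance, h1, ⟨?_⟩, ⟨?_⟩, ⟨?_⟩, i,
    hi, ?_, ?_⟩
  · refine .of_surjective h3 h3' ?_
    -- The last entry is (c + 1)(c' + 1) - 1.
    have : (fun p : (Nat' M × Nat' M × Nat' M) × (Nat' M × Nat' M × Nat' M) => g p.1 + g p.2) =
        fun p => g (p.1.1 * (p.2.2.2 + 1) + p.2.1 * (p.1.2.2 + 1),
          p.1.2.1 * (p.2.2.2 + 1) + p.2.2.1 * (p.1.2.2 + 1),
          p.1.2.2 * p.2.2.2 + p.1.2.2 + p.2.2.2) := by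
      funext p
      simp only [g]
      rw [div_add_div _ _ (hpos _).ne' (hpos _).ne']
      simp only [map_add, map_mul, map_one]
      congr 1 <;> ring
    dsimp only
    rw [this]
    fun_prop
  · refine .of_surjective h3 h3' ?_
    have : (fun p : (Nat' M × Nat' M × Nat' M) × (Nat' M × Nat' M × Nat' M) => g p.1 * g p.2) =
        fun p => g (p.1.1 * p.2.1 + p.1.2.1 * p.2.2.1,
          p.1.1 * p.2.2.1 + p.1.2.1 * p.2.1,
          p.1.2.2 * p.2.2.2 + p.1.2.2 + p.2.2.2) := by
      funext p
      simp only [g]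
      rw [div_mul_div_comm]
      simp only [map_add, map_mul, map_one]
      congr 1 <;> ring
    dsimp only
    rw [this]
    fun_prop
  · exact .of_surjective h3 h3' hk
  · have : ⇑i = fun a => g (a, 0, 0) := by
      funext a
      simp [g]
    rw [this]
    fun_prop
  · intro x
    obtain ⟨⟨a, b, c⟩, rfl⟩ := hg x
    refine ⟨a, ?_⟩
    have h0 : ∀ a, 0 ≤ i a := fun a => by rw [← map_zero i]; exact hi.monotone (Nat'.zero_le' a)
    have h1 : i (c + 1) = i c + 1 := by simp
    rw [div_le_iff₀ (hpos c), h1]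
    nlinarith [h0 a, h0 b, h0 c, mul_nonneg (h0 a) (h0 c)]

end rationals

section abs
variable {M : Type u} [setLang.Structure M] {α K : Type u} [Coded M α] [Coded M K]
  [ZF : Fact (IsModelZF M)] [MSet M α] [MSet M K] [AddCommGroup K] [LinearOrder K]
  [IsOrderedAddMonoid K] [DefAdd M K] [DefLE M K] {f g : α → K}

@[fun_prop]
theorem DefF.max (hf : DefF M f) (hg : DefF M g) : DefF M fun x => max (f x) (g x) := by
  classical
  simp only [max_def]
  fun_prop

@[fun_prop]
theorem DefF.abs (hf : DefF M f) : DefF M fun x => |f x| := by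
  unfold _root_.abs
  fun_prop

end abs

/-! ### Cauchy sequences modulo null sequences -/

section cauchy
variable {M : Type u} [setLang.Structure M] [ZF : Fact (IsModelZF M)]
  {K : Type u} [Field K] [LinearOrder K] [IsStrictOrderedRing K] [Coded M K] [MSet M K]
  [DefAdd M K] [DefMul M K] [DefLE M K]

/-- The sequence `f` is eventually bounded. -/
theorem exists_bound_of_cauchy {f : Nat' M → K}
    (hf : ∀ ε : K, 0 < ε → ∃ N, ∀ m, N ≤ m → ∀ n, N ≤ n → |f m - f n| < ε) :
    ∃ N, ∃ B, 0 < B ∧ ∀ n, N ≤ n → |f n| < B := by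
  obtain ⟨N, hN⟩ := hf 1 one_pos
  refine ⟨N, |f N| + 1, by positivity, fun n hn => ?_⟩
  have := hN n hn N le_rfl
  linarith [abs_sub_abs_le_abs_sub (f n) (f N)]

variable (M K) in
/-- The Cauchy sequences of the model. -/
def cauchySubring : Subring (Nat' M → K) where
  carrier := {f | DefF M f ∧
    ∀ ε : K, 0 < ε → ∃ N, ∀ m, N ≤ m → ∀ n, N ≤ n → |f m - f n| < ε}
  mul_mem' := by
    rintro f g ⟨hf, hf'⟩ ⟨hg, hg'⟩
    refine ⟨hf.mul hg, fun ε hε => ?_⟩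
    obtain ⟨N₁, B, hB, h1⟩ := exists_bound_of_cauchy hf'
    obtain ⟨N₂, C, hC, h2⟩ := exists_bound_of_cauchy hg'
    obtain ⟨N₃, h3⟩ := hf' (ε / 2 / C) (by positivity)
    obtain ⟨N₄, h4⟩ := hg' (ε / 2 / B) (by positivity)
    refine ⟨max (max N₁ N₂) (max N₃ N₄), fun m hm n hn => ?_⟩
    simp only [max_le_iff] at hm hn
    have e1 := h1 m hm.1.1
    have e2 := h2 n hn.1.2
    have e3 := h3 m hm.2.1 n hn.2.1
    have e4 := h4 m hm.2.2 n hn.2.2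
    rw [lt_div_iff₀ hC] at e3
    rw [lt_div_iff₀ hB] at e4
    have : (f * g) m - (f * g) n = f m * (g m - g n) + (f m - f n) * g n := by
      simp only [Pi.mul_apply]; ring
    rw [this]
    refine (abs_add_le _ _).trans_lt ?_
    rw [abs_mul, abs_mul]
    have a1 : |f m| * |g m - g n| ≤ |g m - g n| * B := by
      rw [mul_comm]; exact mul_le_mul_of_nonneg_left e1.le (abs_nonneg _)
    have a2 : |f m - f n| * |g n| ≤ |f m - f n| * C :=
      mul_le_mul_of_nonneg_left e2.le (abs_nonneg _)
    linarith
  one_mem' := ⟨DefF.const 1, fun ε hε => ⟨0, fun m _ n _ => by simpa using hε⟩⟩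
  zero_mem' := ⟨DefF.const 0, fun ε hε => ⟨0, fun m _ n _ => by simpa using hε⟩⟩
  add_mem' := by
    rintro f g ⟨hf, hf'⟩ ⟨hg, hg'⟩
    refine ⟨hf.add hg, fun ε hε => ?_⟩
    obtain ⟨N₃, h3⟩ := hf' (ε / 2) (by positivity)
    obtain ⟨N₄, h4⟩ := hg' (ε / 2) (by positivity)
    refine ⟨max N₃ N₄, fun m hm n hn => ?_⟩
    simp only [max_le_iff] at hm hn
    have e3 := h3 m hm.1 n hn.1
    have e4 := h4 m hm.2 n hn.2
    have : (f + g) m - (f + g) n = (f m - f n) + (g m - g n) := by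
      simp only [Pi.add_apply]; ring
    rw [this]
    exact (abs_add_le _ _).trans_lt (by linarith)
  neg_mem' := by
    rintro f ⟨hf, hf'⟩
    refine ⟨hf.neg, fun ε hε => ?_⟩
    obtain ⟨N, h⟩ := hf' ε hε
    refine ⟨N, fun m hm n hn => ?_⟩
    have := h n hn m hm
    rwa [show (-f) m - (-f) n = f n - f m by simp only [Pi.neg_apply]; ring]

variable (M K) in
/-- The null sequences of the model. -/
def nullIdeal : Ideal (cauchySubring M K) where
  carrier := {f | ∀ ε : K, 0 < ε → ∃ N, ∀ n, N ≤ n → |f.1 n| < ε}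
  zero_mem' := fun ε hε => ⟨0, fun n _ => by simpa using hε⟩
  add_mem' := by
    rintro f g hf hg ε hε
    obtain ⟨N₃, h3⟩ := hf (ε / 2) (by positivity)
    obtain ⟨N₄, h4⟩ := hg (ε / 2) (by positivity)
    refine ⟨max N₃ N₄, fun n hn => ?_⟩
    simp only [max_le_iff] at hn
    exact (abs_add_le _ _).trans_lt (by linarith [h3 n hn.1, h4 n hn.2])
  smul_mem' := by
    rintro f g hg ε hε
    obtain ⟨N, B, hB, h1⟩ := exists_bound_of_cauchy f.2.2
    obtain ⟨N', h2⟩ := hg (ε / B) (by positivity)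
    refine ⟨max N N', fun n hn => ?_⟩
    simp only [max_le_iff] at hn
    have e2 := h2 n hn.2
    rw [lt_div_iff₀ hB] at e2
    change |f.1 n * g.1 n| < ε
    rw [abs_mul, mul_comm]
    exact (mul_le_mul_of_nonneg_left (h1 n hn.1).le (abs_nonneg _)).trans_lt e2

theorem mem_nullIdeal {f : cauchySubring M K} :
    f ∈ nullIdeal M K ↔ ∀ ε : K, 0 < ε → ∃ N, ∀ n, N ≤ n → |f.1 n| < ε := Iff.rfl

theorem mem_nullIdeal_of_eventually_zero {f : cauchySubring M K} {N : Nat' M}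
    (h : ∀ n, N ≤ n → f.1 n = 0) : f ∈ nullIdeal M K :=
  fun ε hε => ⟨N, fun n hn => by rwa [h n hn, abs_zero]⟩

/-- The classes of Cauchy sequences of the model modulo null sequences. -/
abbrev CauchyReal (M : Type u) [setLang.Structure M] [ZF : Fact (IsModelZF M)]
    (K : Type u) [Field K] [LinearOrder K] [IsStrictOrderedRing K] [Coded M K] [MSet M K]
    [DefAdd M K] [DefMul M K] [DefLE M K] : Type u := cauchySubring M K ⧸ nullIdeal M K

/-- The class of a Cauchy sequence. -/
def toReal : cauchySubring M K →+* CauchyReal M K := Ideal.Quotient.mk _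

theorem toReal_surjective : Function.Surjective (toReal (M := M) (K := K)) :=
  Ideal.Quotient.mk_surjective

theorem toReal_eq_iff {f g : cauchySubring M K} :
    toReal f = toReal g ↔ f - g ∈ nullIdeal M K := Ideal.Quotient.eq

theorem toReal_eq_zero_iff {f : cauchySubring M K} : toReal f = 0 ↔ f ∈ nullIdeal M K :=
  Ideal.Quotient.eq_zero_iff_mem

theorem toReal_eq_of_eventually {f g : cauchySubring M K} {N : Nat' M}
    (h : ∀ n, N ≤ n → f.1 n = g.1 n) : toReal f = toReal g :=
  toReal_eq_iff.2 (mem_nullIdeal_of_eventually_zero (N := N) fun n hn => sub_eq_zero.2 (h n hn))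

/-- A Cauchy sequence that is not a null sequence is eventually bounded away from zero. -/
theorem exists_lower_bound {f : cauchySubring M K} (hf : f ∉ nullIdeal M K) :
    ∃ ε : K, 0 < ε ∧ ∃ N, (∀ n, N ≤ n → ε ≤ f.1 n) ∨ ∀ n, N ≤ n → f.1 n ≤ -ε := by
  rw [mem_nullIdeal] at hf
  push Not at hf
  obtain ⟨ε, hε, h⟩ := hf
  obtain ⟨N, hN⟩ := f.2.2 (ε / 2) (by positivity)
  obtain ⟨k, hk, hk'⟩ := h N
  refine ⟨ε / 2, by positivity, N, ?_⟩
  rcases le_abs.1 hk' with h1 | h1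
  · exact .inl fun n hn => by linarith [(abs_lt.1 (hN k hk n hn)).2]
  · exact .inr fun n hn => by linarith [(abs_lt.1 (hN k hk n hn)).1]

/-- The termwise inverse is Cauchy because the terms are eventually bounded away from zero. The
terms before `N`, possibly 0⁻¹ = 0, do not matter modulo null sequences. -/
theorem exists_inverse {f : cauchySubring M K} (hf : f ∉ nullIdeal M K) :
    ∃ g : cauchySubring M K, toReal f * toReal g = 1 := by
  obtain ⟨ε, hε, N, h⟩ := exists_lower_bound hf
  have h' : ∀ n, N ≤ n → ε ≤ |f.1 n| := fun n hn =>
    h.elim (fun h => (h n hn).trans (le_abs_self _))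
      fun h => (le_neg.1 (h n hn)).trans (neg_le_abs _)
  have hne : ∀ n, N ≤ n → f.1 n ≠ 0 := fun n hn => abs_pos.1 (hε.trans_le (h' n hn))
  have hfd : DefF M f.1 := f.2.1
  let g : cauchySubring M K := ⟨fun n => (f.1 n)⁻¹, by
    refine ⟨by fun_prop, fun δ hδ => ?_⟩
    obtain ⟨N', hN'⟩ := f.2.2 (δ * (ε * ε)) (by positivity)
    refine ⟨max N N', fun m hm n hn => ?_⟩
    simp only [max_le_iff] at hm hn
    rw [inv_sub_inv (hne m hm.1) (hne n hn.1), abs_div, abs_mul,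
      div_lt_iff₀ (mul_pos (abs_pos.2 (hne m hm.1)) (abs_pos.2 (hne n hn.1)))]
    refine (hN' n hn.2 m hm.2).trans_le (mul_le_mul_of_nonneg_left ?_ hδ.le)
    exact mul_le_mul (h' m hm.1) (h' n hn.1) hε.le (abs_nonneg _)⟩
  refine ⟨g, ?_⟩
  rw [← map_mul, ← map_one toReal]
  exact toReal_eq_of_eventually (N := N) fun n hn => mul_inv_cancel₀ (hne n hn)

noncomputable instance instFieldCauchyReal : Field (CauchyReal M K) :=
  IsField.toField
    { exists_pair_ne := ⟨0, 1, fun h => by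
        have h1 : toReal (1 : cauchySubring M K) = 0 := by rw [map_one]; exact h.symm
        obtain ⟨N, hN⟩ := toReal_eq_zero_iff.1 h1 1 one_pos
        simpa using hN N le_rfl⟩
      mul_comm := mul_comm
      mul_inv_cancel := fun {a} ha => by
        obtain ⟨f, rfl⟩ := toReal_surjective a
        obtain ⟨g, hg⟩ := exists_inverse fun h => ha (toReal_eq_zero_iff.2 h)
        exact ⟨_, hg⟩ }

variable (M K) in
/-- The nonnegative classes. -/
def realCone : RingCone (CauchyReal M K) where
  carrier := {x | ∃ f : cauchySubring M K, toReal f = x ∧ ∀ n, 0 ≤ f.1 n}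
  mul_mem' := by
    rintro _ _ ⟨f, rfl, hf⟩ ⟨g, rfl, hg⟩
    exact ⟨f * g, map_mul _ _ _, fun n => mul_nonneg (hf n) (hg n)⟩
  one_mem' := ⟨1, map_one _, fun n => zero_le_one⟩
  add_mem' := by
    rintro _ _ ⟨f, rfl, hf⟩ ⟨g, rfl, hg⟩
    exact ⟨f + g, map_add _ _ _, fun n => add_nonneg (hf n) (hg n)⟩
  zero_mem' := ⟨0, map_zero _, fun n => le_rfl⟩
  eq_zero_of_mem_of_neg_mem' := by
    rintro _ ⟨f, rfl, hf⟩ ⟨g, hg, hg'⟩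
    -- Since 0 ≤ f ≤ f + g, it is enough that the sum is a null sequence.
    have h1 : f + g ∈ nullIdeal M K := by
      rw [← toReal_eq_zero_iff, map_add, hg, add_neg_cancel]
    refine toReal_eq_zero_iff.2 fun ε hε => ?_
    obtain ⟨N, hN⟩ := h1 ε hε
    refine ⟨N, fun n hn => lt_of_le_of_lt ?_ (hN n hn)⟩
    exact abs_le_abs_of_nonneg (hf n) (le_add_of_nonneg_right (hg' n))

/-- The sequence max f 0 agrees with `f` from `N` on and is a termwise nonnegative representative.
-/
theorem toReal_mem_realCone {f : cauchySubring M K} {N : Nat' M} (h : ∀ n, N ≤ n → 0 ≤ f.1 n) :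
    toReal f ∈ realCone M K := by
  have hfd : DefF M f.1 := f.2.1
  let g : cauchySubring M K := ⟨fun n => max (f.1 n) 0, by
    refine ⟨by fun_prop, fun ε hε => ?_⟩
    obtain ⟨N', hN'⟩ := f.2.2 ε hε
    refine ⟨max N N', fun m hm n hn => ?_⟩
    simp only [max_le_iff] at hm hn
    dsimp only
    rw [max_eq_left (h m hm.1), max_eq_left (h n hn.1)]
    exact hN' m hm.2 n hn.2⟩
  exact ⟨g, toReal_eq_of_eventually (N := N) fun n hn => max_eq_left (h n hn),
    fun n => le_max_right _ _⟩

instance instHasMemOrNegMemRealCone : HasMemOrNegMem (realCone M K) := ⟨fun x => by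
  obtain ⟨f, rfl⟩ := toReal_surjective x
  by_cases hf : f ∈ nullIdeal M K
  · rw [toReal_eq_zero_iff.2 hf]
    exact .inl (zero_mem _)
  · obtain ⟨ε, hε, N, h | h⟩ := exists_lower_bound hf
    · exact .inl (toReal_mem_realCone (N := N) fun n hn => hε.le.trans (h n hn))
    · rw [← map_neg]
      exact .inr (toReal_mem_realCone (N := N) fun n hn =>
        neg_nonneg.2 ((h n hn).trans (neg_nonpos.2 hε.le)))⟩

open Classical in
noncomputable instance instLinearOrderCauchyReal : LinearOrder (CauchyReal M K) :=
  .mkOfAddGroupCone (realCone M K)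

instance instIsStrictOrderedRingCauchyReal : IsStrictOrderedRing (CauchyReal M K) :=
  have : IsOrderedRing (CauchyReal M K) := .mkOfCone (realCone M K)
  IsOrderedRing.toIsStrictOrderedRing _

theorem toReal_le_toReal {f g : cauchySubring M K} {N : Nat' M}
    (h : ∀ n, N ≤ n → f.1 n ≤ g.1 n) : toReal f ≤ toReal g := by
  change toReal g - toReal f ∈ realCone M K
  rw [← map_sub]
  exact toReal_mem_realCone (N := N) fun n hn => sub_nonneg.2 (h n hn)

instance instMSetCauchySubring : MSet M (cauchySubring M K) :=
  .subtype_fun (p := fun f => f ∈ cauchySubring M K) (fun f h => h.1) (by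
    refine DefP.congr (P := fun f : IFun M (Nat' M) K =>
      ∀ ε : K, 0 < ε → ∃ N, ∀ m, N ≤ m → ∀ n, N ≤ n → |f.1 m - f.1 n| < ε) (by fun_prop) fun f => ?_
    exact and_iff_right f.2)

instance instCodedCauchyReal : Coded M (CauchyReal M K) := quotCoded M (toReal (M := M) (K := K))

theorem defP_toReal_eq : DefP M fun p : cauchySubring M K × cauchySubring M K =>
    toReal p.1 = toReal p.2 := by
  refine DefP.congr (P := fun p => ∀ ε : K, 0 < ε → ∃ N, ∀ n, N ≤ n → |p.1.1 n - p.2.1 n| < ε)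
    (by fun_prop) fun p => ?_
  exact toReal_eq_iff

instance instMSetCauchyReal : MSet M (CauchyReal M K) :=
  (mset_quotCoded toReal_surjective defP_toReal_eq).1

@[fun_prop]
theorem defF_toReal : DefF M (toReal (M := M) (K := K)) :=
  (mset_quotCoded toReal_surjective defP_toReal_eq).2

instance instDefAddCauchyReal : DefAdd M (CauchyReal M K) := ⟨by
  refine .of_surjective (g := fun p : cauchySubring M K × cauchySubring M K =>
    (toReal p.1, toReal p.2)) (by fun_prop) (toReal_surjective.prodMap toReal_surjective) ?_
  simp only [← map_add]
  have : DefF M fun p : cauchySubring M K × cauchySubring M K => p.1 + p.2 :=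
    DefF.mkFun (f := fun (p : cauchySubring M K × cauchySubring M K) n => p.1.1 n + p.2.1 n)
      (by fun_prop) fun p => (p.1 + p.2).2
  fun_prop⟩

instance instDefMulCauchyReal : DefMul M (CauchyReal M K) := ⟨by
  refine .of_surjective (g := fun p : cauchySubring M K × cauchySubring M K =>
    (toReal p.1, toReal p.2)) (by fun_prop) (toReal_surjective.prodMap toReal_surjective) ?_
  simp only [← map_mul]
  have : DefF M fun p : cauchySubring M K × cauchySubring M K => p.1 * p.2 :=
    DefF.mkFun (f := fun (p : cauchySubring M K × cauchySubring M K) n => p.1.1 n * p.2.1 n)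
      (by fun_prop) fun p => (p.1 * p.2).2
  fun_prop⟩

instance instDefLECauchyReal : DefLE M (CauchyReal M K) := ⟨by
  have : DefP M fun p : CauchyReal M K × CauchyReal M K =>
    ∃ f : cauchySubring M K, toReal f = p.2 - p.1 ∧ ∀ n, 0 ≤ f.1 n := by fun_prop
  exact this⟩

/-- The constant sequences. -/
def constReal : K →+* CauchyReal M K :=
  toReal.comp
    { toFun := fun c => ⟨fun _ => c, DefF.const c,
        fun ε hε => ⟨0, fun m _ n _ => by simpa using hε⟩⟩
      map_one' := rfl
      map_zero' := rfl
      map_add' := fun _ _ => rfl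
      map_mul' := fun _ _ => rfl }

theorem constReal_le {f : cauchySubring M K} {c : K} {N : Nat' M} (h : ∀ n, N ≤ n → c ≤ f.1 n) :
    constReal c ≤ toReal f :=
  toReal_le_toReal (N := N) h

theorem le_constReal {f : cauchySubring M K} {c : K} {N : Nat' M} (h : ∀ n, N ≤ n → f.1 n ≤ c) :
    toReal f ≤ constReal c :=
  toReal_le_toReal (N := N) h

theorem constReal_mono : Monotone (constReal (M := M) (K := K)) := fun _ _ h =>
  toReal_le_toReal (N := 0) fun _ _ => h

theorem defF_constReal : DefF M (constReal (M := M) (K := K)) := by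
  have h : DefF M fun c : K => (⟨fun _ => c, DefF.const c,
      fun ε hε => ⟨0, fun m _ n _ => by simpa using hε⟩⟩ : cauchySubring M K) :=
    DefF.mkFun (f := fun (c : K) (_ : Nat' M) => c) (by fun_prop) _
  exact defF_toReal.comp h

/-- An ordered field in which Cauchy sequences of rationals converge is complete. -/
theorem exists_isLUB_of_complete {Q : Type u} [Field Q] [LinearOrder Q] [IsStrictOrderedRing Q]
    [Coded M Q] [MSet M Q] [DefAdd M Q] [DefLE M Q]
    {i : Nat' M →+* K} (hi : StrictMono i) (hid : DefF M i) (hK : ∀ x, ∃ n, x ≤ i n)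
    {j : K →+* Q} (hd : DefF M j) (hj : Monotone j) (arch : ∀ x : Q, ∃ n, x ≤ j (i n))
    (hlim : ∀ f : cauchySubring M K, ∃ r : Q,
      (∀ c N, (∀ n, N ≤ n → c ≤ f.1 n) → j c ≤ r) ∧ ∀ c N, (∀ n, N ≤ n → f.1 n ≤ c) → r ≤ j c)
    {S : Set Q} (hS : Internal M S) (hne : S.Nonempty) (hb : BddAbove S) : ∃ s, IsLUB S s := by
  have hpos : ∀ n, 0 < i (n + 1) := fun c => by
    rw [← map_zero i]; exact hi ((Nat'.zero_le' c).trans_lt (lt_add_one c))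
  have small : ∀ x : Q, 0 < x → ∃ n, j (1 / i (n + 1)) ≤ x := by
    intro x hx
    obtain ⟨n, hn⟩ := arch x⁻¹
    refine ⟨n, ?_⟩
    have h1 : x⁻¹ ≤ j (i (n + 1)) := hn.trans (hj (hi.monotone (lt_add_one n).le))
    rw [map_div₀, map_one, one_div]
    exact inv_le_of_inv_le₀ hx h1
  obtain ⟨s₀, hs₀⟩ := hne
  obtain ⟨u, hu⟩ := hb
  -- The shift by `b` puts the candidate k / (n + 1) - b below `s₀` for k = 0, so natural numerators
  -- suffice.
  obtain ⟨b, hbs⟩ := arch (1 - s₀)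
  have hbs' : j (-i b) < s₀ := by rw [map_neg]; linarith
  let U (k n : Nat' M) : Prop := ∀ s, s ∈ S → s ≤ j (i k / i (n + 1) - i b)
  have hSd := DefS.of_internal (α := (Nat' M × Nat' M) × Q) hS
  have hU : DefP M fun p : Nat' M × Nat' M => U p.1 p.2 := by
    simp only [U]; fun_prop
  -- The least numerator whose fraction bounds `S` is a canonical choice, so the sequence of bounds
  -- belongs to the model.
  obtain ⟨p, hp, hp'⟩ := DefF.exists_choice (M := M)
    (P := fun n k => U k n ∧ ∀ j, j < k → ¬ U j n) (by fun_prop) (by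
      intro n
      obtain ⟨c, hc⟩ := arch (u + j (i b))
      have : U (c * (n + 1)) n := fun s hs => by
        rw [map_mul, mul_div_cancel_right₀ _ (hpos n).ne', map_sub]
        linarith [hu hs]
      obtain ⟨k, hk, hk'⟩ := Nat'.exists_least (P := fun k => U k n) (by fun_prop) this
      refine ⟨k, ⟨hk, hk'⟩, ?_⟩
      rintro j ⟨hj, hj'⟩
      rcases lt_trichotomy j k with h | h | h
      · exact absurd hj (hk' j h)
      · exact h
      · exact absurd hk (hj' k h))
  let q : Nat' M → K := fun n => i (p n) / i (n + 1) - i b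
  have hq1 : ∀ n s, s ∈ S → s ≤ j (q n) := fun n => ((hp' n _).1 rfl).1
  -- By minimality, lowering `q n` by 1 / (n + 1) destroys the bound; the numerator zero is excluded
  -- by the shift.
  have hq2 : ∀ n, ∃ s, s ∈ S ∧ j (q n - 1 / i (n + 1)) < s := by
    intro n
    rcases Nat'.eq_zero_or_succ (p n) with h | ⟨k, hk⟩
    · have := hq1 n s₀ hs₀
      simp only [q, h, map_zero, zero_div, zero_sub] at this
      exact absurd this hbs'.not_ge
    · have := ((hp' n _).1 rfl).2 k (by rw [hk]; exact Nat'.lt_succ_self k)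
      simp only [U] at this
      push Not at this
      obtain ⟨s, hs, hs'⟩ := this
      refine ⟨s, hs, ?_⟩
      convert hs' using 2
      simp only [q, hk, Nat'.succ_eq, map_add, map_one]
      ring
  have hq3 : ∀ m n, q n - 1 / i (n + 1) ≤ q m := by
    intro m n
    obtain ⟨s, hs, hs'⟩ := hq2 n
    by_contra hcon
    exact absurd (hs'.trans_le (hq1 m s hs)) (hj (not_le.1 hcon).le).not_gt
  have hanti : ∀ m n, m ≤ n → 1 / i (n + 1) ≤ 1 / i (m + 1) := fun m n h =>
    one_div_le_one_div_of_le (hpos m) (hi.monotone (add_le_add_left h 1))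
  let f : cauchySubring M K := ⟨q, by
    refine ⟨by fun_prop, fun ε hε => ?_⟩
    obtain ⟨N, hN⟩ := hK (ε⁻¹)
    have hN' : 1 / i (N + 1) < ε := by
      rw [one_div]
      exact inv_lt_of_inv_lt₀ hε (hN.trans_lt (hi (lt_add_one N)))
    refine ⟨N, fun m hm n hn => ?_⟩
    rw [abs_lt]
    constructor <;> linarith [hq3 m n, hq3 n m, hanti N m hm, hanti N n hn]⟩
  obtain ⟨r, hr1, hr2⟩ := hlim f
  have hf1 : ∀ n, r ≤ j (q n) + j (1 / i (n + 1)) := fun n => by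
    rw [← map_add]
    exact hr2 _ n fun m hm => by linarith [hq3 n m, hanti n m hm]
  have hf2 : ∀ n, j (q n) - j (1 / i (n + 1)) ≤ r := fun n => by
    rw [← map_sub]
    exact hr1 _ n fun m hm => hq3 m n
  refine ⟨r, fun s hs => ?_, fun v hv => ?_⟩
  · by_contra hcon
    obtain ⟨n, hn⟩ := small ((s - r) / 2) (by linarith [not_le.1 hcon])
    linarith [hq1 n s hs, hf2 n, not_le.1 hcon]
  · by_contra hcon
    obtain ⟨n, hn⟩ := small ((r - v) / 2) (by linarith [not_le.1 hcon])
    obtain ⟨s, hs, hs'⟩ := hq2 n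
    rw [map_sub] at hs'
    linarith [hv hs, hf1 n]

theorem exists_isLUB {i : Nat' M →+* K} (hi : StrictMono i) (hid : DefF M i)
    (hK : ∀ x, ∃ n, x ≤ i n) {S : Set (CauchyReal M K)} (hS : Internal M S) (hne : S.Nonempty)
    (hb : BddAbove S) : ∃ s, IsLUB S s := by
  refine exists_isLUB_of_complete hi hid hK defF_constReal constReal_mono (fun x => ?_)
    (fun f => ⟨toReal f, fun c N => constReal_le, fun c N => le_constReal⟩) hS hne hb
  obtain ⟨f, rfl⟩ := toReal_surjective x
  obtain ⟨N, B, -, hB⟩ := exists_bound_of_cauchy f.2.2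
  obtain ⟨n, hn⟩ := hK B
  exact ⟨n, le_constReal (N := N) fun m hm => ((le_abs_self _).trans (hB m hm).le).trans hn⟩

end cauchy

/-! ### Existence of the real numbers -/

section exists_real
variable {M : Type u} [setLang.Structure M] [ZF : Fact (IsModelZF M)]

/-- Every set of objects is in bijection with the elements of a set of the model. -/
theorem exists_equiv_el {α : Type u} [Coded M α] [MSet M α] :
    ∃ (X : M) (e : El X ≃ α), DefF M e ∧ DefF M e.symm := by
  obtain ⟨X, hX⟩ := MSet.exists_set (M := M) (α := α)
  let f : α → El X := fun a => ⟨code M a, (hX _).2 ⟨a, code_spec a⟩⟩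
  have hf : Function.Bijective f := by
    refine ⟨fun a b h => code_injective (congrArg Subtype.val h), fun x => ?_⟩
    obtain ⟨a, ha⟩ := (hX x.1).1 x.2
    exact ⟨a, Subtype.ext (code_iff.1 ha).symm⟩
  have hd : DefF M (Equiv.ofBijective f hf) := defF_of_code_eq fun a => by simp [f]
  exact ⟨X, (Equiv.ofBijective f hf).symm, hd.equiv_symm, hd⟩

/-- Without this, statements about all `R` might be vacuous. The Cauchy reals over the rationals of
the model are transported to the elements of a set of `M`. -/
theorem nonempty_realField : Nonempty (RealField M) := by
  obtain ⟨K, _, _, _, _, _, _, _, _, i, hi, hid, hK⟩ := exists_rationals (M := M)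
  obtain ⟨X, e, he, he'⟩ := exists_equiv_el (M := M) (α := CauchyReal M K)
  let _ : Field (El X) := e.field
  let _ : LinearOrder (El X) := LinearOrder.lift' e e.injective
  have hadd : ∀ x y, e (x + y) = e x + e y := fun x y => e.apply_symm_apply _
  have hmul : ∀ x y, e (x * y) = e x * e y := fun x y => e.apply_symm_apply _
  have h0 : e 0 = 0 := e.apply_symm_apply _
  have h1 : e 1 = 1 := e.apply_symm_apply _
  have hle : ∀ x y, x ≤ y ↔ e x ≤ e y := fun x y => Iff.rfl
  refine ⟨⟨X, inferInstance, inferInstance, ?_, ?_, ?_, ?_, ?_⟩⟩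
  · exact Function.Injective.isStrictOrderedRing e h0 h1 hadd hmul Iff.rfl Iff.rfl
  · have : DefF M fun p : El X × El X => e.symm (e p.1 + e p.2) := by fun_prop
    exact this
  · have : DefF M fun p : El X × El X => e.symm (e p.1 * e p.2) := by fun_prop
    exact this
  · have : DefP M fun p : El X × El X => e p.1 ≤ e p.2 := by fun_prop
    exact this
  · intro S hS hne hb
    have hSd := DefS.of_internal (α := CauchyReal M K) hS
    have hS' : DefP M fun y => e.symm y ∈ S := by fun_prop
    obtain ⟨s, hs⟩ := exists_isLUB hi hid hK (S := {y | e.symm y ∈ S}) hS'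
      (hne.elim fun x hx => ⟨e x, by simpa⟩)
      (hb.elim fun b hb => ⟨e b, fun y hy => by simpa [hle] using hb hy⟩)
    refine ⟨e.symm s, fun x hx => ?_, fun b hb => ?_⟩
    · rw [hle, e.apply_symm_apply]
      exact hs.1 (by simpa)
    · rw [hle, e.apply_symm_apply]
      exact hs.2 fun y hy => by simpa [hle] using hb hy

end exists_real

section real
variable {M : Type u} [setLang.Structure M] [ZF : Fact (IsModelZF M)] {R : RealField M}
  {α : Type u} [Coded M α] [MSet M α]

/-! ### Real and complex numbers -/

instance instDefAddRe : DefAdd M R.Re := ⟨R.internal_add⟩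
instance instDefMulRe : DefMul M R.Re := ⟨R.internal_mul⟩
instance instDefLERe : DefLE M R.Re := ⟨R.internal_le⟩

/-- The root is the supremum of the z ≥ 0 with z² ≤ x; it supplies the normalising factors of the
blocks. -/
theorem exists_sqrt {x : R.Re} (hx : 0 ≤ x) : ∃ y : R.Re, 0 ≤ y ∧ y * y = x := by
  have hS : DefP M fun z : R.Re => 0 ≤ z ∧ z * z ≤ x := by fun_prop
  obtain ⟨y, hy⟩ := R.complete {z | 0 ≤ z ∧ z * z ≤ x} hS ⟨0, le_rfl, by simpa⟩
    ⟨x + 1, fun z hz => by nlinarith [hz.1, hz.2]⟩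
  have hy0 : 0 ≤ y := hy.1 ⟨le_rfl, by simpa⟩
  refine ⟨y, hy0, le_antisymm ?_ ?_⟩
  · by_contra hcon
    have h1 : x < y * y := not_le.1 hcon
    have hy1 : 0 < y := by
      rcases hy0.lt_or_eq with h | h
      · exact h
      · rw [← h, mul_zero] at h1; exact absurd hx h1.not_ge
    -- The Newton step is an upper bound, because 2zy ≤ z² + y² ≤ x + y²; it would lie below `y` if
    -- y² > x.
    have h2 : y ≤ (y * y + x) / (2 * y) := by
      refine hy.2 fun z hz => ?_
      rw [le_div_iff₀ (by positivity)]
      nlinarith [sq_nonneg (z - y), hz.2]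
    rw [le_div_iff₀ (by positivity)] at h2
    linarith
  · by_contra hcon
    have h1 : y * y < x := not_le.1 hcon
    -- As δ ≤ 1, one has (y + δ)² ≤ y² + δ(2y + 1) ≤ x.
    let δ := min 1 ((x - y * y) / (2 * y + 1))
    have hδ : 0 < δ := lt_min one_pos (div_pos (by linarith) (by linarith))
    have hδ1 : δ ≤ 1 := min_le_left _ _
    have hδ2 : δ * (2 * y + 1) ≤ x - y * y := by
      rw [← le_div_iff₀ (by linarith)]; exact min_le_right _ _
    have := hy.1 (show y + δ ∈ _ from ⟨by linarith, by nlinarith⟩)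
    linarith

theorem cx_code (z : R.Cx) (m : M) : Coded.Code z m ↔ Coded.Code (z.re, z.im) m := Iff.rfl

theorem cx_pair_injective : Function.Injective fun z : R.Cx => (z.re, z.im) := fun _ _ h =>
  QuadraticAlgebra.ext (congrArg Prod.fst h) (congrArg Prod.snd h)

instance instMSetCx : MSet M R.Cx :=
  .of_injective cx_pair_injective cx_code
    ((DefP.const True).congr fun p => iff_true_intro ⟨⟨p.1, p.2⟩, rfl⟩)

theorem defF_cx_pair : DefF M fun z : R.Cx => (z.re, z.im) :=
  MSet.defF_of_code_iff cx_code

@[fun_prop]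
theorem DefF.re {f : α → R.Cx} (hf : DefF M f) : DefF M fun x => (f x).re :=
  DefF.fst.comp (defF_cx_pair.comp hf)
@[fun_prop]
theorem DefF.im {f : α → R.Cx} (hf : DefF M f) : DefF M fun x => (f x).im :=
  DefF.snd.comp (defF_cx_pair.comp hf)
@[fun_prop]
theorem DefF.cxMk {f g : α → R.Re} (hf : DefF M f) (hg : DefF M g) :
    DefF M fun x => (⟨f x, g x⟩ : R.Cx) :=
  .of_comp defF_cx_pair cx_pair_injective (hf.prodMk hg)

instance instDefAddCx : DefAdd M R.Cx := ⟨by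
  have : DefF M fun p : R.Cx × R.Cx => (⟨p.1.re + p.2.re, p.1.im + p.2.im⟩ : R.Cx) := by fun_prop
  exact this⟩

instance instDefMulCx : DefMul M R.Cx := ⟨by
  have : DefF M fun p : R.Cx × R.Cx => (⟨p.1.re * p.2.re + (-1) * p.1.im * p.2.im,
    p.1.re * p.2.im + p.1.im * p.2.re + 0 * p.1.im * p.2.im⟩ : R.Cx) := by fun_prop
  exact this⟩

theorem norm_eq (z : R.Cx) : QuadraticAlgebra.norm z = z.re * z.re + z.im * z.im := by
  rw [QuadraticAlgebra.norm_def]; ring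

theorem norm_nonneg (z : R.Cx) : 0 ≤ QuadraticAlgebra.norm z := by
  rw [norm_eq]; exact add_nonneg (mul_self_nonneg _) (mul_self_nonneg _)

theorem norm_eq_zero {z : R.Cx} (h : QuadraticAlgebra.norm z = 0) : z = 0 := by
  rw [norm_eq] at h
  have h1 : z.re * z.re = 0 := by nlinarith [mul_self_nonneg z.re, mul_self_nonneg z.im]
  have h2 : z.im * z.im = 0 := by nlinarith [mul_self_nonneg z.re, mul_self_nonneg z.im]
  exact QuadraticAlgebra.ext (mul_self_eq_zero.1 h1) (mul_self_eq_zero.1 h2)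

theorem norm_add_le (z w : R.Cx) : QuadraticAlgebra.norm (z + w) ≤
    2 * QuadraticAlgebra.norm z + 2 * QuadraticAlgebra.norm w := by
  simp only [norm_eq, QuadraticAlgebra.re_add, QuadraticAlgebra.im_add]
  nlinarith [sq_nonneg (z.re - w.re), sq_nonneg (z.im - w.im)]

@[fun_prop]
theorem DefF.norm {f : α → R.Cx} (hf : DefF M f) :
    DefF M fun x => QuadraticAlgebra.norm (f x) := by
  simp only [norm_eq]; fun_prop

@[fun_prop]
theorem DefF.star {f : α → R.Cx} (hf : DefF M f) : DefF M fun x => star (f x) := by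
  have : ∀ z : R.Cx, Star.star z = ⟨z.re, -z.im⟩ := fun z =>
    QuadraticAlgebra.ext (by simp) (by simp)
  simp only [this]
  fun_prop

/-! ### Sums of nonnegative functions -/

/-- Only the mutual cofinality of `P` and Q + S matters. This serves where finite sums match only
after the index sets have been enlarged. -/
theorem isLUB_add {P Q S : Set R.Re} {s t : R.Re} (h1 : ∀ x ∈ P, ∃ y ∈ Q, ∃ z ∈ S, x ≤ y + z)
    (h2 : ∀ y ∈ Q, ∀ z ∈ S, ∃ x ∈ P, y + z ≤ x) (hs : IsLUB Q s) (ht : IsLUB S t) :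
    IsLUB P (s + t) := by
  refine ⟨fun x hx => ?_, fun u hu => ?_⟩
  · obtain ⟨y, hy, z, hz, h⟩ := h1 x hx
    exact h.trans (add_le_add (hs.1 hy) (ht.1 hz))
  · have : ∀ z ∈ S, s ≤ u - z := fun z hz => hs.2 fun y hy => by
      obtain ⟨x, hx, h⟩ := h2 y hy z hz
      linarith [hu hx]
    have : t ≤ u - s := ht.2 fun z hz => by linarith [this z hz]
    linarith

variable {ι κ : Type u} [Coded M ι] [MSet M ι] [Coded M κ] [MSet M κ] {a b : ι → R.Re}
  {t s : R.Re}

theorem hasTotal_iff (ha : DefF M a) : HasTotal R a t ↔ IsLUB (Set.range (fsum (M := M) a)) t := by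
  constructor
  · rintro ⟨σ, hσ, h⟩
    rwa [hσ.eq_fsum ha] at h
  · exact fun h => ⟨_, isFinSums_fsum ha, h⟩

theorem HasTotal.unique (ha : DefF M a) (h : HasTotal R a s) (h' : HasTotal R a t) : s = t :=
  ((hasTotal_iff ha).1 h).unique ((hasTotal_iff ha).1 h')

theorem exists_hasTotal (ha : DefF M a) {B : R.Re} (hB : ∀ F : Fin' M ι, fsum a F ≤ B) :
    ∃ t, HasTotal R a t := by
  obtain ⟨t, ht⟩ := R.complete (Set.range (fsum (M := M) a)) (by
    have : DefP M fun y : R.Re => ∃ F, fsum (M := M) a F = y := by fun_prop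
    exact this) ⟨_, ⟨∅, isFin_empty⟩, rfl⟩ ⟨B, by rintro _ ⟨F, rfl⟩; exact hB F⟩
  exact ⟨t, (hasTotal_iff ha).2 ht⟩

theorem HasTotal.fsum_le (ha : DefF M a) (h : HasTotal R a t) (F : Fin' M ι) : fsum a F ≤ t :=
  ((hasTotal_iff ha).1 h).1 ⟨F, rfl⟩

theorem HasTotal.le_of_fsum_le (ha : DefF M a) (h : HasTotal R a t)
    (hB : ∀ F : Fin' M ι, fsum a F ≤ s) :
    t ≤ s :=
  ((hasTotal_iff ha).1 h).2 (by rintro _ ⟨F, rfl⟩; exact hB F)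

theorem HasTotal.exists_lt (ha : DefF M a) (h0 : ∀ x, 0 ≤ a x) (h : HasTotal R a t) {ε : R.Re}
    (hε : 0 < ε) : ∃ F : Fin' M ι, ∀ G : Fin' M ι, F.1 ⊆ G.1 → t - ε < fsum a G := by
  by_contra! hcon
  have : t ≤ t - ε := h.le_of_fsum_le ha fun F => by
    obtain ⟨G, hFG, hG⟩ := hcon F
    exact (fsum_mono ha h0 hFG).trans hG
  linarith

theorem fsum_mul_left (ha : DefF M a) (c : R.Re) (F : Fin' M ι) :
    fsum (fun x => c * a x) F = c * fsum a F :=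
  fsum_map ha (AddMonoidHom.mulLeft c)
    (by change DefF M fun x : R.Re => c * x; fun_prop)

/-! ### Square-summable families -/

theorem defP_ell2 : DefP M fun η : IFun M ι R.Cx => Internal M η.1 ∧
    ∃ t, HasTotal R (fun x => QuadraticAlgebra.norm (η.1 x)) t := by
  refine DefP.congr (P := fun η : IFun M ι R.Cx =>
    ∃ t : R.Re, (∀ F : Fin' M ι, fsum (fun x => QuadraticAlgebra.norm (η.1 x)) F ≤ t) ∧
      ∀ s : R.Re, (∀ F : Fin' M ι, fsum (fun x => QuadraticAlgebra.norm (η.1 x)) F ≤ s) → t ≤ s)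
    (by fun_prop) fun η => (and_iff_right η.2).trans (exists_congr fun t => ?_)
  rw [hasTotal_iff (by fun_prop)]
  exact ⟨fun h => ⟨fun F => h.1 ⟨F, rfl⟩, fun s hs => h.2 (by rintro _ ⟨F, rfl⟩; exact hs F)⟩,
    fun h => ⟨by rintro _ ⟨F, rfl⟩; exact h.1 F, fun s hs => h.2 s fun F => hs ⟨F, rfl⟩⟩⟩

theorem instMSetEll2Aux : MSet M {η : ι → R.Cx // Internal M η ∧
    ∃ t, HasTotal R (fun x => QuadraticAlgebra.norm (η x)) t} :=
  .subtype_fun (fun _ h => h.1) defP_ell2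

instance instMSetEll2 : MSet M (Ell2 R ι) := instMSetEll2Aux

@[fun_prop]
theorem DefF.ell2_app {f : α → Ell2 R ι} {g : α → ι} (hf : DefF M f) (hg : DefF M g) :
    DefF M fun x => (f x).1 (g x) := by
  have := instMSetEll2Aux (R := R) (ι := ι)
  exact DefF.app (p := fun η : ι → R.Cx => Internal M η ∧
    ∃ t, HasTotal R (fun x => QuadraticAlgebra.norm (η x)) t) (f := f) hf hg

theorem DefF.ell2_mk {f : α → Ell2 R ι} (hf : DefF M fun q : α × ι => (f q.1).1 q.2) :
    DefF M f := by
  have := instMSetEll2Aux (R := R) (ι := ι)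
  exact DefF.mkFun (p := fun η : ι → R.Cx => Internal M η ∧
    ∃ t, HasTotal R (fun x => QuadraticAlgebra.norm (η x)) t) (f := fun x => (f x).1) hf
    (fun x => (f x).2)

end real

section inner
variable {M : Type u} [setLang.Structure M] [ZF : Fact (IsModelZF M)] {R : RealField M}
  {ι κ μ : Type u} [Coded M ι] [MSet M ι] [Coded M κ] [MSet M κ] [Coded M μ] [MSet M μ]

/-! ### Linear combinations, inner products and isometries -/

@[simp]
theorem smul_add_apply (c : R.Cx) (f g : ι → R.Cx) (x : ι) : (c • f + g) x = c * f x + g x := rfl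

@[fun_prop]
theorem Ell2.defF (η : Ell2 R ι) : DefF M η.1 := η.2.1

theorem Ell2.ext {η ζ : Ell2 R ι} (h : ∀ x, η.1 x = ζ.1 x) : η = ζ := Subtype.ext (funext h)

/-- The square-summable family `f`, where the sums of `‖f x‖ ^ 2` are bounded by `B`. -/
def Ell2.ofBound (f : ι → R.Cx) (hf : DefF M f) (B : R.Re)
    (hB : ∀ F : Fin' M ι, fsum (fun x => QuadraticAlgebra.norm (f x)) F ≤ B) : Ell2 R ι :=
  ⟨f, hf, exists_hasTotal (by fun_prop) hB⟩

/-- From |z + w|² ≤ 2|z|² + 2|w|². -/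
theorem exists_smul_add (c : R.Cx) (η ζ : Ell2 R ι) : ∃ ξ : Ell2 R ι, ξ.1 = c • η.1 + ζ.1 := by
  obtain ⟨s, hs⟩ := η.2.2
  obtain ⟨t, ht⟩ := ζ.2.2
  refine ⟨.ofBound (fun x => c * η.1 x + ζ.1 x) (by fun_prop)
    (2 * QuadraticAlgebra.norm c * s + 2 * t) fun F => ?_, rfl⟩
  have h1 : fsum (fun x => QuadraticAlgebra.norm (c * η.1 x + ζ.1 x)) F ≤
      fsum (fun x => 2 * QuadraticAlgebra.norm c * QuadraticAlgebra.norm (η.1 x) +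
        2 * QuadraticAlgebra.norm (ζ.1 x)) F :=
    fsum_le_fsum (by fun_prop) (by fun_prop) fun x _ => by
      refine (norm_add_le _ _).trans_eq ?_
      rw [map_mul]; ring
  rw [fsum_add (by fun_prop) (by fun_prop), fsum_mul_left (by fun_prop),
    fsum_mul_left (by fun_prop)] at h1
  refine h1.trans (add_le_add ?_ ?_)
  · exact mul_le_mul_of_nonneg_left (hs.fsum_le (by fun_prop) F)
      (mul_nonneg zero_le_two (norm_nonneg c))
  · exact mul_le_mul_of_nonneg_left (ht.fsum_le (by fun_prop) F) zero_le_two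

/-- The vector `c • η + ζ`. -/
noncomputable def Ell2.lin (c : R.Cx) (η ζ : Ell2 R ι) : Ell2 R ι := (exists_smul_add c η ζ).choose

theorem Ell2.lin_val (c : R.Cx) (η ζ : Ell2 R ι) : (Ell2.lin c η ζ).1 = c • η.1 + ζ.1 :=
  (exists_smul_add c η ζ).choose_spec

theorem Ell2.lin_apply (c : R.Cx) (η ζ : Ell2 R ι) (x : ι) :
    (Ell2.lin c η ζ).1 x = c * η.1 x + ζ.1 x := by rw [Ell2.lin_val, smul_add_apply]

/-- The imaginary unit. -/
def im1 : R.Cx := ⟨0, 1⟩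

theorem re_mul_star (z w : R.Cx) : (z * star w).re =
    (QuadraticAlgebra.norm (1 * w + z) - QuadraticAlgebra.norm (-1 * w + z)) / 4 := by
  simp [norm_eq]; ring

theorem im_mul_star (z w : R.Cx) : (z * star w).im =
    (QuadraticAlgebra.norm (im1 * w + z) - QuadraticAlgebra.norm (-im1 * w + z)) / 4 := by
  simp [norm_eq, im1]; ring

theorem re_fsum {a : ι → R.Cx} (ha : DefF M a) (F : Fin' M ι) :
    (fsum a F).re = fsum (fun x => (a x).re) F :=
  (fsum_map ha (⟨⟨fun z : R.Cx => z.re, rfl⟩, fun _ _ => rfl⟩ : R.Cx →+ R.Re)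
    (by change DefF M fun z : R.Cx => z.re; fun_prop)).symm

theorem im_fsum {a : ι → R.Cx} (ha : DefF M a) (F : Fin' M ι) :
    (fsum a F).im = fsum (fun x => (a x).im) F :=
  (fsum_map ha (⟨⟨fun z : R.Cx => z.im, rfl⟩, fun _ _ => rfl⟩ : R.Cx →+ R.Re)
    (by change DefF M fun z : R.Cx => z.im; fun_prop)).symm

theorem fsum_sub_div {a b : ι → R.Re} (ha : DefF M a) (hb : DefF M b) (c : R.Re) (F : Fin' M ι) :
    fsum (fun x => (a x - b x) / c) F = (fsum a F - fsum b F) / c := by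
  have : (fun x => (a x - b x) / c) = fun x => c⁻¹ * a x + (-c⁻¹) * b x := by
    funext x; ring
  rw [this, fsum_add (by fun_prop) (by fun_prop), fsum_mul_left ha, fsum_mul_left hb]
  ring

/-- Both limits are compared on the union of two finite sets. As `norm` is the squared modulus, the
triangle inequality is replaced by |z + w|² ≤ 2|z|² + 2|w|², whence the tolerance ε / 4. -/
theorem HasInner.unique {η ζ : Ell2 R ι} {c d : R.Cx} (h : HasInner η ζ c) (h' : HasInner η ζ d) :
    c = d := by
  obtain ⟨σ, hσ, h⟩ := h
  obtain ⟨τ, hτ, h'⟩ := h'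
  obtain rfl : σ = τ := hσ.unique hτ
  refine sub_eq_zero.1 (norm_eq_zero (le_antisymm (le_of_forall_pos_le_add fun ε hε => ?_)
    (norm_nonneg _)))
  obtain ⟨F, hF⟩ := h (ε / 4) (by linarith)
  obtain ⟨G, hG⟩ := h' (ε / 4) (by linarith)
  have h1 := hF ⟨F.1 ∪ G.1, F.isFin.union G.isFin⟩ Set.subset_union_left
  have h2 := hG ⟨F.1 ∪ G.1, F.isFin.union G.isFin⟩ Set.subset_union_right
  generalize σ _ = z at h1 h2
  have h3 := norm_add_le (z - d) (-(z - c))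
  have h4 : QuadraticAlgebra.norm (-(z - c)) = QuadraticAlgebra.norm (z - c) := by
    simp only [norm_eq, QuadraticAlgebra.re_neg, QuadraticAlgebra.im_neg, neg_mul_neg]
  rw [h4, show z - d + -(z - c) = c - d by ring] at h3
  linarith

/-- Polarisation writes the real and imaginary parts of the finite sums as differences of monotone
sums, whose suprema are given. It yields the existence of inner products and shows that norms
determine them. -/
theorem hasInner_polar {η ζ : Ell2 R ι} {a b c d : R.Re}
    (ha : HasTotal R (fun x => QuadraticAlgebra.norm (1 * ζ.1 x + η.1 x)) a)
    (hb : HasTotal R (fun x => QuadraticAlgebra.norm (-1 * ζ.1 x + η.1 x)) b)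
    (hc : HasTotal R (fun x => QuadraticAlgebra.norm (im1 * ζ.1 x + η.1 x)) c)
    (hd : HasTotal R (fun x => QuadraticAlgebra.norm (-im1 * ζ.1 x + η.1 x)) d) :
    HasInner η ζ ⟨(a - b) / 4, (c - d) / 4⟩ := by
  refine ⟨_, isFinSums_fsum (by fun_prop), fun ε hε => ?_⟩
  -- The real and imaginary errors are at most δ / 4; with δ ≤ 1 their squares are below δ / 2.
  let δ := min 1 ε
  have hδ : 0 < δ := lt_min one_pos hε
  have hδ1 : δ ≤ 1 := min_le_left _ _
  have hδε : δ ≤ ε := min_le_right _ _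
  obtain ⟨Fa, hFa⟩ := ha.exists_lt (by fun_prop) (fun _ => norm_nonneg _) hδ
  obtain ⟨Fb, hFb⟩ := hb.exists_lt (by fun_prop) (fun _ => norm_nonneg _) hδ
  obtain ⟨Fc, hFc⟩ := hc.exists_lt (by fun_prop) (fun _ => norm_nonneg _) hδ
  obtain ⟨Fd, hFd⟩ := hd.exists_lt (by fun_prop) (fun _ => norm_nonneg _) hδ
  refine ⟨⟨(Fa.1 ∪ Fb.1) ∪ (Fc.1 ∪ Fd.1),
    (Fa.isFin.union Fb.isFin).union (Fc.isFin.union Fd.isFin)⟩, fun F hF => ?_⟩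
  have a1 := hFa F ((Set.subset_union_left.trans Set.subset_union_left).trans hF)
  have b1 := hFb F ((Set.subset_union_right.trans Set.subset_union_left).trans hF)
  have c1 := hFc F ((Set.subset_union_left.trans Set.subset_union_right).trans hF)
  have d1 := hFd F ((Set.subset_union_right.trans Set.subset_union_right).trans hF)
  have a2 := ha.fsum_le (by fun_prop) F
  have b2 := hb.fsum_le (by fun_prop) F
  have c2 := hc.fsum_le (by fun_prop) F
  have d2 := hd.fsum_le (by fun_prop) F
  rw [norm_eq, QuadraticAlgebra.re_sub, QuadraticAlgebra.im_sub, re_fsum (by fun_prop),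
    im_fsum (by fun_prop)]
  simp only [re_mul_star, im_mul_star]
  rw [fsum_sub_div (by fun_prop) (by fun_prop), fsum_sub_div (by fun_prop) (by fun_prop)]
  generalize fsum (fun x => QuadraticAlgebra.norm (1 * ζ.1 x + η.1 x)) F = a' at *
  generalize fsum (fun x => QuadraticAlgebra.norm (-1 * ζ.1 x + η.1 x)) F = b' at *
  generalize fsum (fun x => QuadraticAlgebra.norm (im1 * ζ.1 x + η.1 x)) F = c' at *
  generalize fsum (fun x => QuadraticAlgebra.norm (-im1 * ζ.1 x + η.1 x)) F = d' at *
  have key : ∀ s : R.Re, -δ ≤ 4 * s → 4 * s ≤ δ → s * s < δ / 2 := fun s h1 h2 => by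
    have : 4 * s * (4 * s) ≤ δ * δ := by nlinarith
    nlinarith
  have k1 := key ((a' - b') / 4 - (a - b) / 4) (by linarith) (by linarith)
  have k2 := key ((c' - d') / 4 - (c - d) / 4) (by linarith) (by linarith)
  linarith

theorem exists_hasInner (η ζ : Ell2 R ι) : ∃ c, HasInner η ζ c := by
  have h : ∀ c : R.Cx, ∃ t, HasTotal R (fun x => QuadraticAlgebra.norm (c * ζ.1 x + η.1 x)) t :=
    fun c => by
      have := (Ell2.lin c ζ η).2.2
      rwa [Ell2.lin_val] at this
  obtain ⟨a, ha⟩ := h 1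
  obtain ⟨b, hb⟩ := h (-1)
  obtain ⟨c, hc⟩ := h im1
  obtain ⟨d, hd⟩ := h (-im1)
  exact ⟨_, hasInner_polar ha hb hc hd⟩

/-- A linear bijection that preserves the norm is an isometric isomorphism. -/
theorem hasInner_of_isometry {U : Ell2 R ι → Ell2 R κ}
    (hl : ∀ (c : R.Cx) (η ζ ξ : Ell2 R ι), ξ.1 = c • η.1 + ζ.1 → (U ξ).1 = c • (U η).1 + (U ζ).1)
    (hn : ∀ η t, HasTotal R (fun x => QuadraticAlgebra.norm (η.1 x)) t →
      HasTotal R (fun x => QuadraticAlgebra.norm ((U η).1 x)) t)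
    (η ζ : Ell2 R ι) (e : R.Cx) (he : HasInner η ζ e) : HasInner (U η) (U ζ) e := by
  have h : ∀ c : R.Cx, ∃ t, HasTotal R (fun x => QuadraticAlgebra.norm (c * ζ.1 x + η.1 x)) t ∧
      HasTotal R (fun x => QuadraticAlgebra.norm (c * (U ζ).1 x + (U η).1 x)) t := fun c => by
    obtain ⟨t, ht⟩ := (Ell2.lin c ζ η).2.2
    have ht' := hn _ _ ht
    rw [hl c _ _ _ (Ell2.lin_val c ζ η)] at ht'
    rw [Ell2.lin_val] at ht
    exact ⟨t, ht, ht'⟩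
  obtain ⟨a, ha, ha'⟩ := h 1
  obtain ⟨b, hb, hb'⟩ := h (-1)
  obtain ⟨c, hc, hc'⟩ := h im1
  obtain ⟨d, hd, hd'⟩ := h (-im1)
  rw [he.unique (hasInner_polar ha hb hc hd)]
  exact hasInner_polar ha' hb' hc' hd'

theorem hasInner_self {η : Ell2 R ι} {t : R.Re}
    (ht : HasTotal R (fun x => QuadraticAlgebra.norm (η.1 x)) t) : HasInner η η ⟨t, 0⟩ := by
  refine ⟨_, isFinSums_fsum (by fun_prop), fun ε hε => ?_⟩
  let δ := min 1 ε
  have hδ : 0 < δ := lt_min one_pos hε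
  have hδ1 : δ ≤ 1 := min_le_left _ _
  have hδε : δ ≤ ε := min_le_right _ _
  obtain ⟨F₀, hF₀⟩ := ht.exists_lt (by fun_prop) (fun _ => norm_nonneg _) hδ
  refine ⟨F₀, fun F hF => ?_⟩
  have h1 := hF₀ F hF
  have h2 := ht.fsum_le (by fun_prop) F
  have hre : ∀ z : R.Cx, (z * star z).re = QuadraticAlgebra.norm z := fun z => by
    simp [norm_eq]
  have him : ∀ z : R.Cx, (z * star z).im = 0 := fun z => by
    simp; ring
  rw [norm_eq, QuadraticAlgebra.re_sub, QuadraticAlgebra.im_sub, re_fsum (by fun_prop),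
    im_fsum (by fun_prop)]
  simp only [hre, him]
  rw [fsum_zero]
  nlinarith

theorem HasInner.hasTotal {η : Ell2 R ι} {c : R.Cx} (h : HasInner η η c) :
    HasTotal R (fun x => QuadraticAlgebra.norm (η.1 x)) c.re := by
  obtain ⟨t, ht⟩ := η.2.2
  rwa [h.unique (hasInner_self ht)]

theorem Ell2Iso.symm (h : Ell2Iso R ι κ) : Ell2Iso R κ ι := by
  obtain ⟨U, hU, hb, hl, hi⟩ := h
  let e := Equiv.ofBijective U hb
  have he : ∀ η, U (e.symm η) = η := e.apply_symm_apply
  refine ⟨e.symm, DefF.equiv_symm (M := M) (e := e) hU, e.symm.bijective, fun c η ζ ξ h => ?_,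
    fun η ζ c h => ?_⟩
  · have h1 : ξ = U (Ell2.lin c (e.symm η) (e.symm ζ)) := Subtype.ext (by
      rw [hl c _ _ _ (Ell2.lin_val c (e.symm η) (e.symm ζ)), he, he, h])
    have h2 : e.symm ξ = Ell2.lin c (e.symm η) (e.symm ζ) := by
      rw [h1]; exact e.symm_apply_apply _
    rw [h2, Ell2.lin_val]
  · obtain ⟨d, hd⟩ := exists_hasInner (e.symm η) (e.symm ζ)
    have := hi _ _ _ hd
    rw [he, he] at this
    rwa [h.unique this]

theorem Ell2Iso.trans (h : Ell2Iso R ι κ) (h' : Ell2Iso R κ μ) : Ell2Iso R ι μ := by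
  obtain ⟨U, hU, hb, hl, hi⟩ := h
  obtain ⟨V, hV, hb', hl', hi'⟩ := h'
  have hU' : DefF M U := hU
  have hV' : DefF M V := hV
  exact ⟨V ∘ U, hV'.comp hU',
    hb'.comp hb, fun c η ζ ξ h => hl' _ _ _ _ (hl _ _ _ _ h),
    fun η ζ c h => hi' _ _ _ (hi _ _ _ h)⟩

theorem HasTotal.comp_equiv {e : κ ≃ ι} (he : DefF M e) {a : ι → R.Re} (ha : DefF M a) {t : R.Re}
    (h : HasTotal R a t) : HasTotal R (fun x => a (e x)) t := by
  rw [hasTotal_iff (by fun_prop)]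
  rw [hasTotal_iff ha] at h
  convert h using 1
  ext s
  constructor
  · rintro ⟨F, rfl⟩
    exact ⟨⟨e '' F.1, F.isFin.image he⟩, fsum_image he e.injective ha rfl⟩
  · rintro ⟨F, rfl⟩
    refine ⟨⟨e.symm '' F.1, F.isFin.image (DefF.equiv_symm he)⟩,
      (fsum_image he e.injective ha ?_).symm⟩
    simp

theorem Ell2Iso.of_equiv {e : ι ≃ κ} (he : DefF M e) : Ell2Iso R ι κ := by
  have he' := DefF.equiv_symm he
  have hex : ∀ η : Ell2 R ι, ∃ ζ : Ell2 R κ, ζ.1 = fun y => η.1 (e.symm y) := fun η => by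
    obtain ⟨t, ht⟩ := η.2.2
    exact ⟨⟨_, show DefF M fun y => η.1 (e.symm y) by fun_prop, t,
      ht.comp_equiv he' (by fun_prop)⟩, rfl⟩
  choose U hU using hex
  have hU' : DefF M U := DefF.ell2_mk (by simp only [hU]; fun_prop)
  have hl : ∀ (c : R.Cx) (η ζ ξ : Ell2 R ι), ξ.1 = c • η.1 + ζ.1 →
      (U ξ).1 = c • (U η).1 + (U ζ).1 := fun c η ζ ξ h => by
    rw [hU, hU, hU, h]; rfl
  refine ⟨U, hU', ⟨fun η ζ h => ?_, fun η => ?_⟩, hl, hasInner_of_isometry hl fun η t ht => ?_⟩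
  · refine Ell2.ext fun x => ?_
    have := congrFun (congrArg Subtype.val h) (e x)
    simpa [hU] using this
  · obtain ⟨t, ht⟩ := η.2.2
    let ζ : Ell2 R ι := ⟨_, show DefF M fun x => η.1 (e x) by fun_prop, t,
      ht.comp_equiv he (by fun_prop)⟩
    refine ⟨ζ, Ell2.ext fun y => ?_⟩
    exact (congrFun (hU ζ) y).trans (congrArg η.1 (e.apply_symm_apply y))
  · rw [hU]
    exact ht.comp_equiv he' (by fun_prop)

end inner

section splits
variable {M : Type u} [setLang.Structure M] [ZF : Fact (IsModelZF M)] {R : RealField M}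
  {ι κ μ : Type u} [Coded M ι] [MSet M ι] [Coded M κ] [MSet M κ] [Coded M μ] [MSet M μ]
  {p : ι → R.Re} {q : κ → R.Re} {r : μ → R.Re}

/-! ### Splitting a total into two -/

/-- The finite sums of `p` and the sums of a finite sum of `q` and one of `r` are cofinal in each
other. -/
structure Splits (p : ι → R.Re) (q : κ → R.Re) (r : μ → R.Re) : Prop where
  exists_ge : ∀ F : Fin' M ι, ∃ (G : Fin' M κ) (T : Fin' M μ), fsum p F ≤ fsum q G + fsum r T
  exists_le : ∀ (G : Fin' M κ) (T : Fin' M μ), ∃ F : Fin' M ι, fsum q G + fsum r T ≤ fsum p F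

theorem Splits.hasTotal (h : Splits p q r) (hp : DefF M p) (hq : DefF M q) (hr : DefF M r)
    {s t : R.Re} (hs : HasTotal R q s) (ht : HasTotal R r t) : HasTotal R p (s + t) := by
  rw [hasTotal_iff hp]
  refine isLUB_add ?_ ?_ ((hasTotal_iff hq).1 hs) ((hasTotal_iff hr).1 ht)
  · rintro _ ⟨F, rfl⟩
    obtain ⟨G, T, h⟩ := h.exists_ge F
    exact ⟨_, ⟨G, rfl⟩, _, ⟨T, rfl⟩, h⟩
  · rintro _ ⟨G, rfl⟩ _ ⟨T, rfl⟩
    obtain ⟨F, h⟩ := h.exists_le G T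
    exact ⟨_, ⟨F, rfl⟩, h⟩

theorem Splits.exists_hasTotal (h : Splits p q r) (hp : DefF M p) (hq : DefF M q) (hr : DefF M r)
    (hq0 : ∀ x, 0 ≤ q x) (hr0 : ∀ x, 0 ≤ r x) {B : R.Re} (hB : HasTotal R p B) :
    ∃ s t, HasTotal R q s ∧ HasTotal R r t ∧ B = s + t := by
  obtain ⟨s, hs⟩ := ZFHilbert.exists_hasTotal hq (B := B) fun G => by
    obtain ⟨F, hF⟩ := h.exists_le G ⟨∅, isFin_empty⟩
    linarith [hB.fsum_le hp F, fsum_nonneg (F := (⟨∅, isFin_empty⟩ : Fin' M μ)) hr hr0]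
  obtain ⟨t, ht⟩ := ZFHilbert.exists_hasTotal hr (B := B) fun T => by
    obtain ⟨F, hF⟩ := h.exists_le ⟨∅, isFin_empty⟩ T
    linarith [hB.fsum_le hp F, fsum_nonneg (F := (⟨∅, isFin_empty⟩ : Fin' M κ)) hq hq0]
  exact ⟨s, t, hs, ht, hB.unique hp (h.hasTotal hp hq hr hs ht)⟩

/-- Each finite subset of `ι` is the disjoint union of the images of finite subsets of `κ` and `μ`:
in the induction, a new point joins the side that it comes from. -/
theorem Splits.of_complementary {u : κ → ι} {v : μ → ι} (hu : DefF M u) (hv : DefF M v)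
    (hui : Function.Injective u) (hvi : Function.Injective v) (hd : ∀ x y, u x ≠ v y)
    (hc : ∀ z, (∃ x, u x = z) ∨ ∃ y, v y = z) (hp : DefF M p) :
    Splits p (fun x => p (u x)) (fun y => p (v y)) := by
  have hdisj : ∀ (G : Set κ) (T : Set μ), Disjoint (u '' G) (v '' T) := fun G T =>
    Set.disjoint_left.2 (by rintro _ ⟨x, _, rfl⟩ ⟨y, _, h⟩; exact hd x y h.symm)
  have key : ∀ (F : Fin' M ι) (G : Fin' M κ) (T : Fin' M μ), F.1 = u '' G.1 ∪ v '' T.1 →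
      fsum p F = fsum (fun x => p (u x)) G + fsum (fun y => p (v y)) T := fun F G T h => by
    rw [fsum_union (F := ⟨u '' G.1, G.isFin.image hu⟩) (G := ⟨v '' T.1, T.isFin.image hv⟩) hp
      (hdisj _ _) h, fsum_image hu hui hp rfl, fsum_image hv hvi hp rfl]
  refine ⟨fun F => ?_, fun G T => ⟨⟨u '' G.1 ∪ v '' T.1,
    (G.isFin.image hu).union (T.isFin.image hv)⟩, (key _ _ _ rfl).ge⟩⟩
  suffices h : ∃ (G : Fin' M κ) (T : Fin' M μ), F.1 = u '' G.1 ∪ v '' T.1 by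
    obtain ⟨G, T, h⟩ := h
    exact ⟨G, T, (key _ _ _ h).le⟩
  refine Fin'.induction (P := fun F : Fin' M ι => ∃ (G : Fin' M κ) (T : Fin' M μ),
    F.1 = u '' G.1 ∪ v '' T.1) (by fun_prop) ?_ ?_ F
  · exact fun F hF => ⟨⟨∅, isFin_empty⟩, ⟨∅, isFin_empty⟩, by simpa using hF⟩
  · rintro F F' z - hF' ⟨G, T, h⟩
    rcases hc z with ⟨x, rfl⟩ | ⟨y, rfl⟩
    · exact ⟨⟨insert x G.1, G.isFin.insert x⟩, T, by
        rw [hF', h, Set.image_insert_eq, Set.insert_union]⟩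
    · exact ⟨G, ⟨insert y T.1, T.isFin.insert y⟩, by
        rw [hF', h, Set.image_insert_eq, Set.union_insert]⟩

end splits

section blocks
variable {M : Type u} [setLang.Structure M] [ZF : Fact (IsModelZF M)] {R : RealField M}
  {ι J K α : Type u} [Coded M ι] [MSet M ι] [Coded M J] [MSet M J] [Coded M K] [MSet M K]
  [Coded M α] [MSet M α]

/-! ### Changing the mean values of a function on disjoint finite blocks -/

/-- The real number `r` as a complex number. -/
def ofRe (r : R.Re) : R.Cx := ⟨r, 0⟩

@[fun_prop]
theorem DefF.ofRe {f : α → R.Re} (hf : DefF M f) : DefF M fun x => ofRe (f x) := by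
  unfold ZFHilbert.ofRe; fun_prop

theorem fsum_const (w : R.Cx) (F : Fin' M ι) :
    fsum (fun _ => w) F = ofRe (fsum (fun _ => (1 : R.Re)) F) * w := by
  have := fsum_map (F := F) (DefF.const (M := M) (α := ι) (1 : R.Re))
    (AddMonoidHom.mk' (fun r : R.Re => ofRe r * w) fun a b => by
      rw [← add_mul]; congr 1; exact QuadraticAlgebra.ext rfl (add_zero 0).symm)
    (by change DefF M fun r : R.Re => ofRe r * w; fun_prop)
  refine Eq.trans ?_ this
  congr 1
  funext x
  ext <;> simp [ofRe]

theorem fsum_mul_left' {a : ι → R.Cx} (ha : DefF M a) (c : R.Cx) (F : Fin' M ι) :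
    fsum (fun x => c * a x) F = c * fsum a F :=
  fsum_map ha (AddMonoidHom.mulLeft c)
    (by change DefF M fun x : R.Cx => c * x; fun_prop)

/-- The finite sets `A j` are pairwise disjoint, `idx x = j` for `x` in `A j`, and `s j` is the
reciprocal of the square root of the number of elements of `A j`. -/
structure IsBlocks (A : J → Fin' M ι) (s : J → R.Re) (idx : ι → J) : Prop where
  defF : DefF M A
  defF_s : DefF M s
  defF_idx : DefF M idx
  idx_eq : ∀ {j x}, x ∈ (A j).1 → idx x = j
  mul_s : ∀ j, s j * s j * fsum (fun _ => (1 : R.Re)) (A j) = 1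

/-- The normalised sum of `f` over the block `A j`. -/
noncomputable def coef (A : J → Fin' M ι) (s : J → R.Re) (f : ι → R.Cx) (j : J) : R.Cx :=
  ofRe (s j) * fsum f (A j)

open Classical in
/-- The function `f`, changed by constants on the blocks so that its normalised sums become `d`. -/
noncomputable def recoef (A : J → Fin' M ι) (s : J → R.Re) (idx : ι → J) (f : ι → R.Cx)
    (d : J → R.Cx) (x : ι) : R.Cx :=
  f x + if x ∈ (A (idx x)).1 then ofRe (s (idx x)) * (d (idx x) - coef A s f (idx x)) else 0

variable {A : J → Fin' M ι} {s : J → R.Re} {idx : ι → J}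

namespace IsBlocks
variable (h : IsBlocks A s idx) {f g : ι → R.Cx} {d e : J → R.Cx} {j : J} {x : ι}
include h

theorem ofRe_mul_s (j : J) :
    (ofRe (s j) * ofRe (s j) * ofRe (fsum (fun _ => (1 : R.Re)) (A j)) : R.Cx) = 1 := by
  rw [QuadraticAlgebra.ext_iff]
  simp only [ofRe, QuadraticAlgebra.re_mul, QuadraticAlgebra.im_mul, mul_zero, add_zero, zero_mul]
  exact ⟨h.mul_s j, rfl⟩

theorem defF_coef {f : α → ι → R.Cx} {k : α → J} (hf : DefF M fun p : α × ι => f p.1 p.2)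
    (hk : DefF M k) : DefF M fun x => coef A s (f x) (k x) := by
  have h1 := h.defF
  have h2 := h.defF_s
  unfold coef
  fun_prop

theorem defF_recoef {f : α → ι → R.Cx} {d : α → J → R.Cx} {x : α → ι}
    (hf : DefF M fun p : α × ι => f p.1 p.2) (hd : DefF M fun p : α × J => d p.1 p.2)
    (hx : DefF M x) : DefF M fun y => recoef A s idx (f y) (d y) (x y) := by
  have h1 := h.defF
  have h2 := h.defF_s
  have h3 := h.defF_idx
  have h4 : DefF M fun y => coef A s (f y) (idx (x y)) := h.defF_coef hf (by fun_prop)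
  unfold recoef
  fun_prop

theorem recoef_of_mem (hx : x ∈ (A j).1) :
    recoef A s idx f d x = f x + ofRe (s j) * (d j - coef A s f j) := by
  rw [recoef, h.idx_eq hx, if_pos hx]

omit h in
theorem recoef_of_notMem (hx : x ∉ (A (idx x)).1) : recoef A s idx f d x = f x := by
  rw [recoef, if_neg hx, add_zero]

/-- Adding the constant s (d - c) to `f` on a block changes the normalised sum c by s² |A j| (d - c)
= d - c. -/
theorem coef_recoef (hf : DefF M f) (hd : DefF M d) : coef A s (recoef A s idx f d) j = d j := by
  have h1 : DefF M (recoef A s idx f d) :=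
    h.defF_recoef (α := ι) (f := fun _ => f) (d := fun _ => d) (by fun_prop) (by fun_prop)
      (DefF.id)
  rw [coef, fsum_congr h1 (b := fun x => f x + ofRe (s j) * (d j - coef A s f j)) (by fun_prop)
    fun x hx => h.recoef_of_mem hx, fsum_add hf (by fun_prop), fsum_const, coef]
  have h3 := h.ofRe_mul_s j
  linear_combination (d j - ofRe (s j) * fsum f (A j)) * h3

theorem recoef_coef : recoef A s idx f (coef A s f) = f := by
  funext x
  by_cases hx : x ∈ (A (idx x)).1
  · rw [h.recoef_of_mem hx, sub_self, mul_zero, add_zero]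
  · rw [recoef_of_notMem hx]

theorem recoef_recoef (hf : DefF M f) (hd : DefF M d) :
    recoef A s idx (recoef A s idx f d) e = recoef A s idx f e := by
  funext x
  by_cases hx : x ∈ (A (idx x)).1
  · rw [h.recoef_of_mem hx, h.recoef_of_mem hx, h.coef_recoef hf hd, h.recoef_of_mem hx]
    ring
  · rw [recoef_of_notMem hx, recoef_of_notMem hx, recoef_of_notMem hx]

theorem coef_smul_add (hf : DefF M f) (hg : DefF M g) (c : R.Cx) (j : J) :
    coef A s (c • f + g) j = c * coef A s f j + coef A s g j := by
  have : fsum (c • f + g) (A j) = c * fsum f (A j) + fsum g (A j) := by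
    rw [← fsum_mul_left' hf, ← fsum_add (by fun_prop) hg]
    rfl
  rw [coef, coef, coef, this]
  ring

theorem recoef_smul_add (hf : DefF M f) (hg : DefF M g) (c : R.Cx) (x : ι) :
    recoef A s idx (c • f + g) (c • d + e) x =
      c * recoef A s idx f d x + recoef A s idx g e x := by
  by_cases hx : x ∈ (A (idx x)).1
  · rw [h.recoef_of_mem hx, h.recoef_of_mem hx, h.recoef_of_mem hx, h.coef_smul_add hf hg,
      smul_add_apply, smul_add_apply]
    ring
  · rw [recoef_of_notMem hx, recoef_of_notMem hx, recoef_of_notMem hx, smul_add_apply]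

/-- Pythagoras on one block: there `f` is a function `g` of sum zero plus the constant `w`. The
cross terms vanish, and |w|² times the number of points is the squared modulus of the coefficient.
-/
theorem fsum_block (hf : DefF M f) (j : J) :
    fsum (fun x => QuadraticAlgebra.norm (f x)) (A j) =
      fsum (fun x => QuadraticAlgebra.norm (recoef A s idx f (fun _ => 0) x)) (A j) +
        QuadraticAlgebra.norm (coef A s f j) := by
  set g := recoef A s idx f (fun _ => 0) with hg
  have hgd : DefF M g :=
    h.defF_recoef (α := ι) (f := fun _ => f) (d := fun _ _ => 0) (by fun_prop) (by fun_prop)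
      (DefF.id)
  let w := ofRe (s j) * coef A s f j
  have h0 : fsum g (A j) = 0 := by
    have h1 : coef A s g j = 0 := h.coef_recoef (d := fun _ => 0) hf (by fun_prop)
    have h2 := h.ofRe_mul_s j
    rw [coef] at h1
    linear_combination (ofRe (s j) * ofRe (fsum (fun _ => (1 : R.Re)) (A j))) * h1 -
      fsum g (A j) * h2
  have hre : fsum (fun x => (g x).re) (A j) = 0 := by rw [← re_fsum hgd, h0]; rfl
  have him : fsum (fun x => (g x).im) (A j) = 0 := by rw [← im_fsum hgd, h0]; rfl
  have hw : QuadraticAlgebra.norm w * fsum (fun _ => (1 : R.Re)) (A j) =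
      QuadraticAlgebra.norm (coef A s f j) := by
    have : QuadraticAlgebra.norm (ofRe (s j) : R.Cx) = s j * s j := by simp [norm_eq, ofRe]
    rw [map_mul, this]
    linear_combination QuadraticAlgebra.norm (coef A s f j) * h.mul_s j
  have hfg : ∀ x ∈ (A j).1, QuadraticAlgebra.norm (f x) = QuadraticAlgebra.norm (g x) +
      (2 * w.re * (g x).re + (2 * w.im * (g x).im + QuadraticAlgebra.norm w * 1)) := fun x hx => by
    have h3 : f x = g x + w := by rw [hg, h.recoef_of_mem hx]; simp only [w]; ring
    rw [h3]
    simp only [norm_eq, QuadraticAlgebra.re_add, QuadraticAlgebra.im_add]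
    ring
  rw [fsum_congr (by fun_prop) (by fun_prop) hfg, fsum_add (by fun_prop) (by fun_prop),
    fsum_add (by fun_prop) (by fun_prop), fsum_add (by fun_prop) (by fun_prop),
    fsum_mul_left (by fun_prop), fsum_mul_left (by fun_prop), fsum_mul_left (by fun_prop), hre, him,
    hw]
  ring

/-- Pythagoras applies to whole blocks, and outside the blocks the two functions agree. Hence finite
sets are first enlarged until they contain every block that they meet. -/
theorem splits (hf : DefF M f) : Splits (M := M) (fun x => QuadraticAlgebra.norm (f x))
    (fun x => QuadraticAlgebra.norm (recoef A s idx f (fun _ => 0) x))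
    (fun j => QuadraticAlgebra.norm (coef A s f j)) := by
  have hA := h.defF
  have hidx := h.defF_idx
  have hgd : DefF M (recoef A s idx f (fun _ => 0)) :=
    h.defF_recoef (α := ι) (f := fun _ => f) (d := fun _ _ => 0) (by fun_prop) (by fun_prop)
      (DefF.id)
  have hcd : DefF M (coef A s f) :=
    h.defF_coef (α := J) (f := fun _ => f) (by fun_prop) DefF.id
  have key : ∀ (F : Fin' M ι), (∀ x ∈ F.1, x ∉ (A (idx x)).1) → ∀ T : Fin' M J, ∃ G : Fin' M ι,
      (∀ x, x ∈ G.1 ↔ x ∈ F.1 ∨ ∃ j ∈ T.1, x ∈ (A j).1) ∧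
      fsum (fun x => QuadraticAlgebra.norm (f x)) G =
        fsum (fun x => QuadraticAlgebra.norm (recoef A s idx f (fun _ => 0) x)) G +
        fsum (fun j => QuadraticAlgebra.norm (coef A s f j)) T := by
    intro F hF
    refine Fin'.induction (by fun_prop) ?_ ?_
    · intro T hT
      refine ⟨F, fun x => by simp [hT], ?_⟩
      rw [fsum_empty (by fun_prop) hT, add_zero]
      exact fsum_congr (by fun_prop) (by fun_prop) fun x hx => by rw [recoef_of_notMem (hF x hx)]
    · rintro T T' j hj hT' ⟨G, hG, hs⟩
      have hd : Disjoint G.1 (A j).1 := Set.disjoint_left.2 fun x hx hxj => by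
        rcases (hG x).1 hx with hx | ⟨i, hi, hxi⟩
        · exact hF x hx (by rwa [h.idx_eq hxj])
        · rw [h.idx_eq hxi |>.symm.trans (h.idx_eq hxj)] at hi
          exact hj hi
      let G' : Fin' M ι := ⟨G.1 ∪ (A j).1, G.isFin.union (A j).isFin⟩
      refine ⟨G', fun x => ?_, ?_⟩
      · rw [hT']
        simp only [G', Set.mem_union, hG, Set.mem_insert_iff, exists_eq_or_imp]
        rw [or_assoc, or_comm (b := x ∈ (A j).1)]
      · rw [fsum_union (H := G') (by fun_prop) hd rfl, fsum_union (H := G') (by fun_prop) hd rfl,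
          fsum_insert (by fun_prop) hj hT', hs, h.fsum_block hf]
        ring
  have key2 : ∀ (F : Fin' M ι) (T : Fin' M J), ∃ (G : Fin' M ι) (U : Fin' M J), F.1 ⊆ G.1 ∧
      T.1 ⊆ U.1 ∧ fsum (fun x => QuadraticAlgebra.norm (f x)) G =
        fsum (fun x => QuadraticAlgebra.norm (recoef A s idx f (fun _ => 0) x)) G +
        fsum (fun j => QuadraticAlgebra.norm (coef A s f j)) U := by
    intro F T
    have hI : Internal M {x | x ∈ F.1 ∧ x ∉ (A (idx x)).1} := by
      have : DefP M fun x => x ∈ F.1 ∧ x ∉ (A (idx x)).1 := by fun_prop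
      exact this
    -- The points of `F` outside the blocks, the blocks indexed by `T`, and the blocks indexed by
    -- `idx '' F`, among which is every block that meets `F`.
    obtain ⟨G, hG, hs⟩ := key ⟨_, F.isFin.subset hI fun x hx => hx.1⟩ (fun x hx => hx.2)
      ⟨T.1 ∪ idx '' F.1, T.isFin.union (F.isFin.image hidx)⟩
    refine ⟨G, _, fun x hx => (hG x).2 ?_, Set.subset_union_left, hs⟩
    by_cases hxA : x ∈ (A (idx x)).1
    · exact .inr ⟨idx x, .inr ⟨x, hx, rfl⟩, hxA⟩
    · exact .inl ⟨hx, hxA⟩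
  refine ⟨fun F => ?_, fun F T => ?_⟩
  · obtain ⟨G, U, hFG, -, hs⟩ := key2 F ⟨∅, isFin_empty⟩
    exact ⟨G, U, (fsum_mono (by fun_prop) (fun _ => norm_nonneg _) hFG).trans hs.le⟩
  · obtain ⟨G, U, hFG, hTU, hs⟩ := key2 F T
    refine ⟨G, le_trans (add_le_add ?_ ?_) hs.ge⟩
    · exact fsum_mono (by fun_prop) (fun _ => norm_nonneg _) hFG
    · exact fsum_mono (by fun_prop) (fun _ => norm_nonneg _) hTU

end IsBlocks
end blocks

section iso
variable {M : Type u} [setLang.Structure M] [ZF : Fact (IsModelZF M)] {R : RealField M}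
  {ι J K : Type u} [Coded M ι] [MSet M ι] [Coded M J] [MSet M J] [Coded M K] [MSet M K]
  {A : J → Fin' M ι} {s : J → R.Re} {idx : ι → J}

/-! ### Absorbing blocks -/

/-- The factor `s j` is the unique nonnegative root of 1 / |A j|, and disjointness determines the
block of a point, so both functions belong to the model without any choice of points in the blocks.
-/
theorem exists_isBlocks [Nonempty J] (hA : DefF M A)
    (hd : ∀ i j, i ≠ j → Disjoint (A i).1 (A j).1) (hne : ∀ j, (A j).1.Nonempty) :
    ∃ (s : J → R.Re) (idx : ι → J), IsBlocks A s idx := by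
  obtain ⟨j₀⟩ := ‹Nonempty J›
  have hinj : ∀ {i j x}, x ∈ (A i).1 → x ∈ (A j).1 → i = j := fun {i j x} hi hj => by
    by_contra hij
    exact Set.disjoint_left.1 (hd i j hij) hi hj
  have hpos : ∀ j, 0 < fsum (fun _ => (1 : R.Re)) (A j) := fun j => by
    obtain ⟨x, hx⟩ := hne j
    have h1 : fsum (fun _ => (1 : R.Re)) ⟨{x}, isFin_singleton x⟩ ≤
        fsum (fun _ => (1 : R.Re)) (A j) :=
      fsum_mono (by fun_prop) (fun _ => zero_le_one) (Set.singleton_subset_iff.2 hx)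
    rw [fsum_singleton (x := x) (by fun_prop) rfl] at h1
    exact zero_lt_one.trans_le h1
  obtain ⟨s, hs, hs'⟩ := DefF.exists_choice (M := M) (P := fun (j : J) (y : R.Re) =>
    0 ≤ y ∧ y * y * fsum (fun _ => (1 : R.Re)) (A j) = 1) (by fun_prop) fun j => by
      obtain ⟨y, hy, h⟩ := exists_sqrt (inv_nonneg.2 (hpos j).le)
      refine ⟨y, ⟨hy, by rw [h, inv_mul_cancel₀ (hpos j).ne']⟩, fun z hz => ?_⟩
      refine (mul_self_inj hz.1 hy).1 ?_
      rw [h]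
      exact eq_inv_of_mul_eq_one_left hz.2
  -- Points outside all blocks get the index `j₀`; this is harmless because `recoef` tests whether
  -- `x` lies in `A (idx x)`.
  obtain ⟨idx, hi, hi'⟩ := DefF.exists_choice (M := M) (P := fun (x : ι) (j : J) =>
    x ∈ (A j).1 ∨ (∀ i, x ∉ (A i).1) ∧ j = j₀) (by fun_prop) fun x => by
      by_cases h : ∃ j, x ∈ (A j).1
      · obtain ⟨j, hj⟩ := h
        exact ⟨j, .inl hj, fun i hi => hi.elim (fun hi => hinj hi hj) fun hi => absurd hj (hi.1 j)⟩
      · push Not at h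
        exact ⟨j₀, .inr ⟨h, rfl⟩, fun i hi => hi.elim (fun hi => absurd hi (h i)) (·.2)⟩
  exact ⟨s, idx, hA, hs, hi, fun {j x} hx => (hi' x j).2 (.inl hx), fun j => ((hs' j _).1 rfl).2⟩

/-- The image of `f` under the isomorphism that absorbs the blocks `A (β k)`. -/
noncomputable def absorb (A : J → Fin' M ι) (s : J → R.Re) (idx : ι → J) (α : J → J) (β : K → J)
    (f : ι → R.Cx) : ι ⊕ K → R.Cx :=
  Sum.elim (recoef A s idx f fun j => coef A s f (α j)) (fun k => coef A s f (β k))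

namespace IsBlocks
variable (h : IsBlocks A s idx) {α : J → J} {β : K → J} (hα : DefF M α) (hβ : DefF M β)
  (hαi : Function.Injective α) (hβi : Function.Injective β) (hαβ : ∀ i k, α i ≠ β k)
  (hc : ∀ j, (∃ i, α i = j) ∨ ∃ k, β k = j)
include h hα hβ

theorem defF_absorb {γ : Type u} [Coded M γ] [MSet M γ] {f : γ → ι → R.Cx} {z : γ → ι ⊕ K}
    (hf : DefF M fun p : γ × ι => f p.1 p.2) (hz : DefF M z) :
    DefF M fun y => absorb A s idx α β (f y) (z y) := by
  have h1 : DefF M fun p : γ × K => coef A s (f p.1) (β p.2) :=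
    h.defF_coef (by fun_prop) (by fun_prop)
  have h2 : DefF M fun p : (γ × ι) × J => coef A s (f p.1.1) (α p.2) :=
    h.defF_coef (by fun_prop) (by fun_prop)
  have h3 : DefF M fun p : γ × ι => recoef A s idx (f p.1) (fun j => coef A s (f p.1) (α j)) p.2 :=
    h.defF_recoef (by fun_prop) h2 (by fun_prop)
  unfold absorb
  fun_prop

/-- The first component has the coefficients `coef A s f (α i)`, and the second consists of the
`coef A s f (β k)`. As `α` and `β` cover `J`, all coefficients of `f` are recovered; these and the
first component determine `f`. -/
theorem absorb_injective (hc : ∀ j, (∃ i, α i = j) ∨ ∃ k, β k = j) {f g : ι → R.Cx}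
    (hf : DefF M f) (hg : DefF M g) (hfg : absorb A s idx α β f = absorb A s idx α β g) :
    f = g := by
  have hcd : ∀ {f : ι → R.Cx}, DefF M f → DefF M fun j => coef A s f (α j) := fun {f} hf =>
    h.defF_coef (α := J) (f := fun _ => f) (by fun_prop) hα
  have key : ∀ {f : ι → R.Cx}, DefF M f → recoef A s idx (fun x => absorb A s idx α β f (.inl x))
      (coef A s f) = f := fun {f} hf =>
    (h.recoef_recoef (d := fun j => coef A s f (α j)) hf (hcd hf)).trans h.recoef_coef
  have key' : ∀ {f : ι → R.Cx}, DefF M f → ∀ j,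
      coef A s (fun x => absorb A s idx α β f (.inl x)) j = coef A s f (α j) := fun {f} hf j =>
    h.coef_recoef (d := fun j => coef A s f (α j)) hf (hcd hf)
  have h2 : coef A s f = coef A s g := by
    funext j
    rcases hc j with ⟨i, rfl⟩ | ⟨k, rfl⟩
    · rw [← key' hf, ← key' hg, hfg]
    · exact congrFun hfg (.inr k)
  rw [← key hf, ← key hg, h2, hfg]

include hαi hβi hαβ hc

/-- Both squared norms are the sum of three parts: the part of `f` with vanishing coefficients, the
coefficients along `α` and those along `β`. Only the grouping differs: `s1` and `s3` on one side,
`s4` and `s2` on the other. -/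
theorem hasTotal_absorb {f : ι → R.Cx} (hf : DefF M f) {t : R.Re} :
    (HasTotal R (fun x => QuadraticAlgebra.norm (f x)) t →
      HasTotal R (fun z => QuadraticAlgebra.norm (absorb A s idx α β f z)) t) ∧
    (HasTotal R (fun z => QuadraticAlgebra.norm (absorb A s idx α β f z)) t →
      ∃ t, HasTotal R (fun x => QuadraticAlgebra.norm (f x)) t) := by
  have hcd : DefF M (coef A s f) := h.defF_coef (α := J) (f := fun _ => f) (by fun_prop) DefF.id
  have hgd : DefF M (absorb A s idx α β f) :=
    h.defF_absorb hα hβ (γ := ι ⊕ K) (f := fun _ => f) (by fun_prop) DefF.id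
  let g := recoef A s idx f fun j => coef A s f (α j)
  have hg : DefF M g :=
    h.defF_recoef (α := ι) (f := fun _ => f) (d := fun _ j => coef A s f (α j)) (by fun_prop)
      (by fun_prop) DefF.id
  have hqd : DefF M (recoef A s idx f fun _ => 0) :=
    h.defF_recoef (α := ι) (f := fun _ => f) (d := fun _ j => 0) (by fun_prop)
      (by fun_prop) DefF.id
  have s1 := h.splits hf
  have s2 := h.splits hg
  have e1 : recoef A s idx g (fun _ => 0) = recoef A s idx f fun _ => 0 :=
    h.recoef_recoef hf (by fun_prop)
  have e2 : coef A s g = fun j => coef A s f (α j) := funext fun j =>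
    h.coef_recoef hf (by fun_prop)
  rw [e1, e2] at s2
  have s3 : Splits (fun j => QuadraticAlgebra.norm (coef A s f j)) _ _ :=
    Splits.of_complementary hα hβ hαi hβi hαβ hc (by fun_prop)
  have s4 : Splits (fun z => QuadraticAlgebra.norm (absorb A s idx α β f z))
      (fun x => QuadraticAlgebra.norm (g x)) (fun k => QuadraticAlgebra.norm (coef A s f (β k))) :=
    Splits.of_complementary (M := M) (u := Sum.inl) (v := Sum.inr) (by fun_prop) (by fun_prop)
      Sum.inl_injective Sum.inr_injective (fun _ _ => Sum.inl_ne_inr)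
      (fun z => by rcases z with x | k <;> simp) (by fun_prop)
  have n0 : ∀ {μ : Type u} {f : μ → R.Cx} (x : μ), 0 ≤ QuadraticAlgebra.norm (f x) :=
    fun _ => norm_nonneg _
  constructor
  · intro ht
    obtain ⟨a, b, ha, hb, rfl⟩ :=
      s1.exists_hasTotal (by fun_prop) (by fun_prop) (by fun_prop) n0 n0 ht
    obtain ⟨c, d, hc, hd, rfl⟩ :=
      s3.exists_hasTotal (by fun_prop) (by fun_prop) (by fun_prop) n0 n0 hb
    rw [← add_assoc]
    exact s4.hasTotal (by fun_prop) (by fun_prop) (by fun_prop)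
      (s2.hasTotal (by fun_prop) (by fun_prop) (by fun_prop) ha hc) hd
  · intro ht
    obtain ⟨a, b, ha, hb, rfl⟩ :=
      s4.exists_hasTotal (by fun_prop) (by fun_prop) (by fun_prop) n0 n0 ht
    obtain ⟨c, d, hc, hd, rfl⟩ :=
      s2.exists_hasTotal (by fun_prop) (by fun_prop) (by fun_prop) n0 n0 ha
    exact ⟨_, s1.hasTotal (by fun_prop) (by fun_prop) (by fun_prop) hc
      (s3.hasTotal (by fun_prop) (by fun_prop) (by fun_prop) hd hb)⟩

theorem ell2Iso_absorb : Ell2Iso R ι (ι ⊕ K) := by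
  have hcd : ∀ {f : ι → R.Cx}, DefF M f → DefF M (coef A s f) := fun {f} hf =>
    h.defF_coef (α := J) (f := fun _ => f) (by fun_prop) DefF.id
  have hex : ∀ η : Ell2 R ι, ∃ ζ : Ell2 R (ι ⊕ K), ζ.1 = absorb A s idx α β η.1 := fun η => by
    obtain ⟨t, ht⟩ := η.2.2
    exact ⟨⟨_, h.defF_absorb hα hβ (γ := ι ⊕ K) (f := fun _ => η.1) (by fun_prop) DefF.id, t,
      (h.hasTotal_absorb hα hβ hαi hβi hαβ hc η.defF).1 ht⟩, rfl⟩
  choose U hU using hex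
  have hU' : DefF M U := DefF.ell2_mk (by
    simp only [hU]
    exact h.defF_absorb hα hβ (γ := Ell2 R ι × (ι ⊕ K)) (f := fun p => p.1.1) (by fun_prop)
      (by fun_prop))
  have hl : ∀ (c : R.Cx) (η ζ ξ : Ell2 R ι), ξ.1 = c • η.1 + ζ.1 →
      (U ξ).1 = c • (U η).1 + (U ζ).1 := fun c η ζ ξ hξ => by
    have hcl := h.coef_smul_add η.defF ζ.defF c
    funext z
    rw [smul_add_apply, hU, hU, hU, hξ]
    rcases z with x | k
    · simp only [absorb, Sum.elim_inl]
      rw [← h.recoef_smul_add η.defF ζ.defF]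
      congr 1
      funext j
      exact hcl _
    · simp only [absorb, Sum.elim_inr]
      exact hcl _
  refine ⟨U, hU', ⟨fun η ζ hηζ => ?_, fun ξ => ?_⟩, hl, hasInner_of_isometry hl fun η t ht => ?_⟩
  · refine Subtype.ext (h.absorb_injective hα hβ hc η.defF ζ.defF ?_)
    rw [← hU, ← hU, hηζ]
  · have hξ := ξ.defF
    let ζ : ι → R.Cx := fun x => ξ.1 (.inl x)
    have hζ : DefF M ζ := by fun_prop
    have hcζ := hcd hζ
    -- The coefficients of the preimage of `ξ`: at α i the i-th coefficient of the first component,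
    -- at β k the value of the second component.
    obtain ⟨d, hd, hd'⟩ := DefF.exists_choice (M := M) (P := fun (j : J) (y : R.Cx) =>
      (∃ i, α i = j ∧ coef A s ζ i = y) ∨ ∃ k, β k = j ∧ ξ.1 (.inr k) = y) (by fun_prop) fun j => by
        rcases hc j with ⟨i, rfl⟩ | ⟨k, rfl⟩
        · refine ⟨_, .inl ⟨i, rfl, rfl⟩, ?_⟩
          rintro y (⟨i', hi, rfl⟩ | ⟨k, hk, -⟩)
          · rw [hαi hi]
          · exact absurd hk.symm (hαβ i k)
        · refine ⟨_, .inr ⟨k, rfl, rfl⟩, ?_⟩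
          rintro y (⟨i', hi, -⟩ | ⟨k', hk, rfl⟩)
          · exact absurd hi (hαβ i' k)
          · rw [hβi hk]
    have hdα : ∀ i, d (α i) = coef A s ζ i := fun i => (hd' _ _).2 (.inl ⟨i, rfl, rfl⟩)
    have hdβ : ∀ k, d (β k) = ξ.1 (.inr k) := fun k => (hd' _ _).2 (.inr ⟨k, rfl, rfl⟩)
    let f := recoef A s idx ζ d
    have hf : DefF M f := h.defF_recoef (α := ι) (f := fun _ => ζ) (d := fun _ => d) (by fun_prop)
      (by fun_prop) DefF.id
    have hcf : ∀ j, coef A s f j = d j := fun j => h.coef_recoef hζ hd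
    have habs : absorb A s idx α β f = ξ.1 := by
      funext z
      rcases z with x | k
      · simp only [absorb, Sum.elim_inl, hcf, hdα]
        refine congrFun (?_ : _ = ζ) x
        exact (h.recoef_recoef hζ hd).trans h.recoef_coef
      · simp only [absorb, Sum.elim_inr, hcf, hdβ]
    obtain ⟨t, ht⟩ := ξ.2.2
    rw [← habs] at ht
    let η : Ell2 R ι := ⟨f, hf, (h.hasTotal_absorb hα hβ hαi hβi hαβ hc hf).2 ht⟩
    exact ⟨η, Subtype.ext ((hU η).trans habs)⟩
  · rw [hU]
    exact (h.hasTotal_absorb hα hβ hαi hβi hαβ hc η.defF).1 ht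

end IsBlocks

/-- If `ι` contains a sequence of disjoint nonempty finite sets, then `ℓ²(ι) ≅ ℓ²(ι ⊕ ℕ)`. -/
theorem ell2Iso_sum_nat {A : Nat' M → Fin' M ι} (hA : DefF M A)
    (hd : ∀ i j, i ≠ j → Disjoint (A i).1 (A j).1) (hne : ∀ j, (A j).1.Nonempty) :
    Ell2Iso R ι (ι ⊕ Nat' M) := by
  have : Nonempty (Nat' M) := ⟨0⟩
  obtain ⟨s, idx, h⟩ := exists_isBlocks (R := R) hA hd hne
  -- Coefficients with even index fill the old blocks; those with odd index become the new
  -- coordinates.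
  refine h.ell2Iso_absorb (α := fun n => n + n) (β := fun n => n + n + 1) (by fun_prop)
    (by fun_prop) (fun i j => Nat'.add_self_inj) (fun i j h => ?_) (fun i j h => ?_) fun j => ?_
  · exact Nat'.add_self_inj (add_right_cancel h)
  · exact Nat'.add_self_ne j i h.symm
  · obtain ⟨k, hk | hk⟩ := Nat'.even_or_odd j
    · exact .inl ⟨k, hk.symm⟩
    · exact .inr ⟨k, hk.symm⟩

end iso

section basis
variable {M : Type u} [setLang.Structure M] [ZF : Fact (IsModelZF M)] {R : RealField M}
  {ι κ α A : Type u} [Coded M ι] [MSet M ι] [Coded M κ] [MSet M κ] [Coded M α] [MSet M α]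
  [Coded M A] [MSet M A] [AddCommMonoid A] [DefAdd M A]

/-! ### Orthonormal bases -/

theorem norm_zero : QuadraticAlgebra.norm (0 : R.Cx) = 0 := by
  rw [norm_eq, QuadraticAlgebra.re_zero, QuadraticAlgebra.im_zero, mul_zero, add_zero]

open Classical in
theorem fsum_eq_single {a : ι → A} (ha : DefF M a) {x : ι} (hx : ∀ y, y ≠ x → a y = 0)
    (F : Fin' M ι) : fsum a F = if x ∈ F.1 then a x else 0 := by
  refine Fin'.induction (P := fun F : Fin' M ι => fsum a F = if x ∈ F.1 then a x else 0)
    (by fun_prop) ?_ ?_ F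
  · intro F hF
    rw [fsum_empty ha hF, if_neg (by simp [hF])]
  · intro F G z hz hG ih
    rw [fsum_insert ha hz hG, ih]
    by_cases hzx : z = x
    · subst hzx
      rw [if_neg hz, zero_add, if_pos (by simp [hG])]
    · rw [hx z hzx, add_zero]
      simp [hG, Ne.symm hzx]

open Classical in
/-- The function that is `1` at `x` and `0` elsewhere. -/
noncomputable def unitFun (x y : ι) : R.Cx := if y = x then 1 else 0

@[fun_prop]
theorem defF_unitFun {f g : α → ι} (hf : DefF M f) (hg : DefF M g) :
    DefF M fun p => (unitFun (f p) (g p) : R.Cx) := by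
  unfold unitFun; fun_prop

theorem unitFun_self (x : ι) : (unitFun x x : R.Cx) = 1 := if_pos rfl

theorem unitFun_of_ne {x y : ι} (h : y ≠ x) : (unitFun x y : R.Cx) = 0 := if_neg h

/-- The unit vector at `x`. -/
noncomputable def unitVec (R : RealField M) (x : ι) : Ell2 R ι :=
  .ofBound (unitFun x) (by fun_prop) 1 fun F => by
    rw [fsum_eq_single (x := x) (by fun_prop) fun y hy => by rw [unitFun_of_ne hy, norm_zero]]
    split_ifs with h
    · rw [unitFun_self, map_one]
    · exact zero_le_one

theorem unitVec_val (x : ι) : (unitVec R x).1 = unitFun x := rfl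

theorem unitVec_injective : Function.Injective (unitVec (ι := ι) R) := fun x y h => by
  by_contra hxy
  have h1 : (unitFun x x : R.Cx) = unitFun y x := by rw [← unitVec_val, h, unitVec_val]
  rw [unitFun_self, unitFun_of_ne hxy] at h1
  exact one_ne_zero h1

theorem defF_unitVec : DefF M (unitVec (ι := ι) R) :=
  DefF.ell2_mk (by simp only [unitVec_val]; fun_prop)

theorem hasInner_unitVec (x : ι) (ζ : Ell2 R ι) : HasInner (unitVec R x) ζ (star (ζ.1 x)) := by
  refine ⟨_, isFinSums_fsum (by fun_prop), fun ε hε => ⟨⟨{x}, isFin_singleton x⟩, fun F hF => ?_⟩⟩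
  rw [fsum_eq_single (x := x) (by fun_prop) fun y hy => by
    rw [unitVec_val, unitFun_of_ne hy, zero_mul], if_pos (hF rfl), unitVec_val, unitFun_self,
    one_mul, sub_self, norm_zero]
  exact hε

/-- The truncation of `ξ` to a finite set lies in `S` by induction on that set, which is possible
because `S` belongs to the model. The error has total at most t minus the partial sum over `F`,
hence less than ε. -/
theorem IsClosedSubspace.eq_univ {S : Set (Ell2 R ι)} (hS : IsClosedSubspace S)
    (hI : Internal M S) (h : ∀ x, unitVec R x ∈ S) : S = Set.univ := by
  refine Set.eq_univ_of_forall fun ξ => hS.closed ξ fun ε hε => ?_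
  have key : ∀ F : Fin' M ι, ∃ η : Ell2 R ι, η ∈ S ∧ ∀ x, (x ∈ F.1 → η.1 x = ξ.1 x) ∧
      (x ∉ F.1 → η.1 x = 0) := by
    have hSd : DefS M fun _ : Fin' M ι × Ell2 R ι => S := .of_internal hI
    refine Fin'.induction (by fun_prop) ?_ ?_
    · intro F hF
      let z : Ell2 R ι := .ofBound (fun _ => 0) (by fun_prop) 0 fun F => by
        simp only [norm_zero]
        rw [fsum_zero]
      exact ⟨z, hS.zero z rfl, fun x => ⟨by simp [hF], fun _ => rfl⟩⟩
    · rintro F G z hz hG ⟨η, hη, hF⟩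
      refine ⟨_, hS.smul_add (ξ.1 z) _ _ _ (h z) hη (Ell2.lin_val _ _ _), fun x => ?_⟩
      rw [Ell2.lin_apply, unitVec_val, hG]
      by_cases hxz : x = z
      · subst hxz
        rw [unitFun_self, (hF x).2 hz]
        simp
      · rw [unitFun_of_ne hxz]
        simpa [hxz] using hF x
  obtain ⟨t, ht⟩ := ξ.2.2
  obtain ⟨F, hF⟩ := ht.exists_lt (by fun_prop) (fun _ => norm_nonneg _) hε
  have hF := hF F subset_rfl
  obtain ⟨η, hη, hηF⟩ := key F
  have hd : DefF M fun x => QuadraticAlgebra.norm (ξ.1 x - η.1 x) := by fun_prop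
  have bound : ∀ G : Fin' M ι, fsum (fun x => QuadraticAlgebra.norm (ξ.1 x - η.1 x)) G ≤
      t - fsum (fun x => QuadraticAlgebra.norm (ξ.1 x)) F := fun G => by
    let D : Fin' M ι := ⟨G.1 \ F.1, G.isFin.subset
      (DefS.internal (F := fun F : Fin' M ι => G.1 \ F.1) (by fun_prop) F) Set.sdiff_subset⟩
    let H : Fin' M ι := ⟨F.1 ∪ D.1, F.isFin.union D.isFin⟩
    have hFD : Disjoint F.1 D.1 := Set.disjoint_sdiff_right
    have h1 := fsum_mono hd (fun _ => norm_nonneg _)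
      (show G.1 ⊆ H.1 by simp [H, D])
    rw [fsum_union (H := H) hd hFD rfl, fsum_congr (F := F) (b := fun _ => 0) hd (by fun_prop)
      fun x hx => by rw [(hηF x).1 hx, sub_self, norm_zero], fsum_zero, zero_add,
      fsum_congr (F := D) (b := fun x => QuadraticAlgebra.norm (ξ.1 x)) hd (by fun_prop)
      fun x hx => by rw [(hηF x).2 hx.2, sub_zero]] at h1
    have h2 := ht.fsum_le (by fun_prop) H
    rw [fsum_union (H := H) (by fun_prop) hFD rfl] at h2
    linarith
  obtain ⟨r, hr⟩ := exists_hasTotal hd bound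
  exact ⟨η, hη, r, by linarith [hr.le_of_fsum_le hd bound], hr⟩

/-- The basis is the image of the unit vectors. It spans because the preimage of a closed subspace
under the isometry is a closed subspace, and it contains all unit vectors if the given one contains
the basis. -/
theorem exists_orthonormalBasis (h : Ell2Iso R κ ι) :
    ∃ B : Set (Ell2 R ι), IsOrthonormalBasis B ∧ Equipotent M {e // e ∈ B} κ := by
  obtain ⟨V, hV, hb, hl, hi⟩ := h
  have hV' : DefF M V := hV
  have hw : DefF M fun y : κ => V (unitVec R y) := hV'.comp defF_unitVec
  have hwi : Function.Injective fun y : κ => V (unitVec R y) := hb.1.comp unitVec_injective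
  have hB : Internal M (Set.range fun y : κ => V (unitVec R y)) := by
    have h : ∀ {w : κ → Ell2 R ι}, DefF M w → DefP M fun e => ∃ y, w y = e := fun hw => by fun_prop
    exact h hw
  refine ⟨Set.range fun y => V (unitVec R y), ⟨hB, ?_, ?_, fun S hS hcl hBS => ?_⟩, ?_⟩
  · rintro _ ⟨y, rfl⟩
    refine hi _ _ _ ?_
    simpa [unitVec_val, unitFun_self] using hasInner_unitVec y (unitVec R y)
  · rintro _ ⟨y, rfl⟩ _ ⟨z, rfl⟩ hne
    refine hi _ _ _ ?_
    have hyz : y ≠ z := fun h => hne (by rw [h])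
    simpa [unitVec_val, unitFun_of_ne hyz] using hasInner_unitVec y (unitVec R z)
  · have hS' : Internal M (V ⁻¹' S) := by
      have hSd : DefS M fun _ : Ell2 R κ => S := .of_internal hS
      have : DefP M fun η : Ell2 R κ => V η ∈ S := by fun_prop
      exact this
    have hcl' : IsClosedSubspace (V ⁻¹' S) := by
      refine ⟨fun ξ hξ => hcl.zero _ ?_, fun c η ζ ξ hη hζ h => hcl.smul_add c _ _ _ hη hζ
        (hl _ _ _ _ h), fun ξ hξ => hcl.closed _ fun ε hε => ?_⟩
      · have := hl 1 ξ ξ ξ (by rw [hξ, smul_zero, add_zero])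
        rwa [one_smul, left_eq_add] at this
      · obtain ⟨η, hη, t, htε, ht⟩ := hξ ε hε
        refine ⟨V η, hη, t, htε, ?_⟩
        -- The difference is made a vector, so that the distance becomes a norm, which `V`
        -- preserves.
        have h1 : ∀ x, (Ell2.lin (-1) η ξ).1 x = ξ.1 x - η.1 x := fun x => by
          rw [Ell2.lin_apply]; ring
        have h2 : ∀ x, (V (Ell2.lin (-1) η ξ)).1 x = (V ξ).1 x - (V η).1 x := fun x => by
          rw [hl _ _ _ _ (Ell2.lin_val (-1) η ξ), smul_add_apply]; ring
        simp only [← h1] at ht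
        have h3 := (hi _ _ _ (hasInner_self ht)).hasTotal
        simpa only [h2] using h3
    have huniv := hcl'.eq_univ hS' fun y => hBS ⟨y, rfl⟩
    refine Set.eq_univ_of_forall fun ξ => ?_
    obtain ⟨η, rfl⟩ := hb.2 ξ
    exact Set.eq_univ_iff_forall.1 huniv η
  · have : MSet M {e // e ∈ Set.range fun y : κ => V (unitVec R y)} := MSet.subtype hB
    let e := Equiv.ofInjective _ hwi
    have he : DefF M e := DefF.mk hw _
    exact ⟨e.symm, DefF.equiv_symm (M := M) he, e.symm.bijective⟩

/-! ### Dedekind-finite sets -/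

theorem DefF.exists_extend {f : ι → κ} (hf : DefF M f) (hi : Function.Injective f) {g : ι → α}
    (hg : DefF M g) {h : κ → α} (hh : DefF M h) : ∃ k : κ → α, DefF M k ∧ (∀ x, k (f x) = g x) ∧
      ∀ y, (∀ x, f x ≠ y) → k y = h y := by
  obtain ⟨k, hk, hk'⟩ := DefF.exists_choice (M := M) (P := fun (y : κ) (z : α) =>
    (∃ x, f x = y ∧ g x = z) ∨ (∀ x, f x ≠ y) ∧ h y = z) (by fun_prop) fun y => by
      by_cases hy : ∃ x, f x = y
      · obtain ⟨x, rfl⟩ := hy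
        refine ⟨_, .inl ⟨x, rfl, rfl⟩, ?_⟩
        rintro z (⟨x', hx, rfl⟩ | ⟨hx, -⟩)
        · rw [hi hx]
        · exact absurd rfl (hx x)
      · push Not at hy
        refine ⟨h y, .inr ⟨hy, rfl⟩, ?_⟩
        rintro z (⟨x', hx, rfl⟩ | ⟨-, rfl⟩)
        · exact absurd hx (hy x')
        · rfl
  exact ⟨k, hk, fun x => (hk' _ _).2 (.inl ⟨x, rfl, rfl⟩), fun y hy => (hk' _ _).2 (.inr ⟨hy, rfl⟩)⟩

/-- A self-injection of `ι` is copied to the range of `f` and extended by the identity to a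
self-injection of `κ`; the surjectivity of the latter carries back. -/
theorem DedekindFinite.of_injective {f : ι → κ} (hf : DefF M f) (hi : Function.Injective f)
    (h : DedekindFinite M κ) : DedekindFinite M ι := by
  intro g hg hgi x
  have hg : DefF M g := hg
  obtain ⟨k, hk, hkf, hkn⟩ := hf.exists_extend hi (hf.comp hg) DefF.id
  have hki : Function.Injective k := fun y z hyz => by
    by_cases hy : ∃ x, f x = y
    · obtain ⟨x, rfl⟩ := hy
      by_cases hz : ∃ x, f x = z
      · obtain ⟨x', rfl⟩ := hz
        rw [hkf, hkf] at hyz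
        rw [hgi (hi hyz)]
      · push Not at hz
        rw [hkf, hkn z hz] at hyz
        exact absurd hyz (hz _)
    · push Not at hy
      by_cases hz : ∃ x, f x = z
      · obtain ⟨x', rfl⟩ := hz
        rw [hkf, hkn y hy] at hyz
        exact absurd hyz.symm (hy _)
      · push Not at hz
        rwa [hkn y hy, hkn z hz] at hyz
  obtain ⟨y, hy⟩ := h k hk hki (f x)
  by_cases hyx : ∃ x', f x' = y
  · obtain ⟨x', rfl⟩ := hyx
    rw [hkf] at hy
    exact ⟨x', hi hy⟩
  · push Not at hyx
    rw [hkn y hyx] at hy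
    exact absurd hy.symm (hyx x)

theorem not_dedekindFinite_nat : ¬ DedekindFinite M (Nat' M) := fun h => by
  obtain ⟨n, hn⟩ := h Nat'.succ (show DefF M Nat'.succ from Nat'.defF_succ) Nat'.succ_injective 0
  exact Nat'.succ_ne_zero n hn

end basis

section seq
variable {M : Type u} [setLang.Structure M] [ZF : Fact (IsModelZF M)]
  {α β γ δ : Type u} [Coded M α] [MSet M α] [Coded M β] [MSet M β] [Coded M γ] [MSet M γ]
  [Coded M δ] [MSet M δ]

/-! ### Equipotence -/

theorem equipotent_of_equiv {e : α ≃ β} (he : DefF M e) : Equipotent M α β := ⟨e, he, e.bijective⟩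

theorem Equipotent.exists_equiv (h : Equipotent M α β) : ∃ e : α ≃ β, DefF M e :=
  let ⟨_, hf, hb⟩ := h
  ⟨.ofBijective _ hb, hf⟩

theorem Equipotent.symm (h : Equipotent M α β) : Equipotent M β α :=
  let ⟨_, he⟩ := h.exists_equiv
  equipotent_of_equiv (DefF.equiv_symm he)

theorem Equipotent.trans (h : Equipotent M α β) (h' : Equipotent M β γ) : Equipotent M α γ := by
  obtain ⟨f, hf, hb⟩ := h
  obtain ⟨g, hg, hb'⟩ := h'
  have hf : DefF M f := hf
  have hg : DefF M g := hg
  exact ⟨g ∘ f, hg.comp hf, hb'.comp hb⟩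

theorem Equipotent.refl : Equipotent M α α :=
  ⟨fun x => x, DefF.id (M := M) (α := α), Function.bijective_id⟩

theorem Equipotent.sum (h : Equipotent M α β) (h' : Equipotent M γ δ) :
    Equipotent M (α ⊕ γ) (β ⊕ δ) := by
  obtain ⟨e, he⟩ := h.exists_equiv
  obtain ⟨e', he'⟩ := h'.exists_equiv
  have : DefF M fun z : α ⊕ γ =>
      Sum.elim (fun x => (.inl (e x) : β ⊕ δ)) (fun y => .inr (e' y)) z := by
    fun_prop
  refine equipotent_of_equiv (e := Equiv.sumCongr e e') ?_
  convert this using 1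
  funext z
  rcases z with x | y <;> rfl

theorem Equipotent.sum_assoc : Equipotent M ((α ⊕ β) ⊕ γ) (α ⊕ (β ⊕ γ)) := by
  have : DefF M fun z : (α ⊕ β) ⊕ γ => Sum.elim
    (fun w => Sum.elim (fun x => (.inl x : α ⊕ (β ⊕ γ))) (fun y => .inr (.inl y)) w)
      (fun y => .inr (.inr y)) z := by
    fun_prop
  refine equipotent_of_equiv (e := Equiv.sumAssoc α β γ) ?_
  convert this using 1
  funext z
  rcases z with (x | y) | z <;> rfl

theorem Equipotent.elNat_add (m n : Nat' M) : Equipotent M (El m.1 ⊕ El n.1) (El (m + n).1) := by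
  have hf : DefF M fun z : El m.1 ⊕ El n.1 => Sum.elim (elNat m) (fun k => m + elNat n k) z := by
    fun_prop
  have hlt : ∀ z, Sum.elim (elNat m) (fun k => m + elNat n k) z < m + n := by
    rintro (k | k)
    · exact (elNat_lt m k).trans_le le_self_add
    · exact add_lt_add_right (elNat_lt n k) m
  choose g hg using fun z => exists_elNat (hlt z)
  have hgd : DefF M g := .of_comp (defF_elNat _) (elNat_injective _) (by simpa only [hg] using hf)
  refine ⟨g, hgd, fun z w h => ?_, fun k => ?_⟩
  · have h := congrArg (elNat (m + n)) h
    rw [hg, hg] at h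
    have key : ∀ i j, elNat m i ≠ m + elNat n j := fun i j =>
      ((elNat_lt m i).trans_le le_self_add).ne
    rcases z with i | j <;> rcases w with i' | j'
    · rw [elNat_injective m h]
    · exact absurd h (key i j')
    · exact absurd h.symm (key i' j)
    · rw [elNat_injective n (add_left_cancel h)]
  · have hk := elNat_lt _ k
    rcases lt_or_ge (elNat _ k) m with h | h
    · obtain ⟨i, hi⟩ := exists_elNat h
      exact ⟨.inl i, elNat_injective _ (by rw [hg, Sum.elim_inl, hi])⟩
    · obtain ⟨d, hd⟩ := Nat'.exists_add_of_le h
      rw [hd] at hk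
      obtain ⟨j, hj⟩ := exists_elNat (lt_of_add_lt_add_left hk)
      exact ⟨.inr j, elNat_injective _ (by rw [hg, Sum.elim_inr, hj, hd])⟩

theorem Equipotent.elNat_sum_nat (n : Nat' M) : Equipotent M (El n.1 ⊕ Nat' M) (Nat' M) := by
  have hf : DefF M fun z : El n.1 ⊕ Nat' M => Sum.elim (elNat n) (fun k => n + k) z := by
    fun_prop
  refine ⟨_, hf, fun z w h => ?_, fun k => ?_⟩
  · have key : ∀ i j, elNat n i ≠ n + j := fun i j => ((elNat_lt n i).trans_le le_self_add).ne
    rcases z with i | j <;> rcases w with i' | j'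
    · rw [elNat_injective n h]
    · exact absurd h (key i j')
    · exact absurd h.symm (key i' j)
    · rw [add_left_cancel h]
  · rcases lt_or_ge k n with h | h
    · obtain ⟨i, hi⟩ := exists_elNat h
      exact ⟨.inl i, hi⟩
    · obtain ⟨d, hd⟩ := Nat'.exists_add_of_le h
      exact ⟨.inr d, hd.symm⟩

theorem Ell2Iso.of_equipotent {R : RealField M} (h : Equipotent M α β) : Ell2Iso R α β :=
  let ⟨_, he⟩ := h.exists_equiv
  .of_equiv he

theorem DedekindFinite.of_equipotent (h : Equipotent M α β) (hβ : DedekindFinite M β) :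
    DedekindFinite M α :=
  let ⟨_, he⟩ := h.exists_equiv
  .of_injective he (Equiv.injective _) hβ

/-! ### Sequences of finite sets -/

/-- A non-surjective injection is iterated, starting from a point `c` outside its range; the
sequence is injective because `c` is met only at index zero. -/
theorem exists_injective_of_not_dedekindFinite (h : ¬ DedekindFinite M α) :
    ∃ g : Nat' M → α, DefF M g ∧ Function.Injective g := by
  unfold DedekindFinite at h
  push Not at h
  obtain ⟨f, hf, hfi, hfs⟩ := h
  have hf : DefF M f := hf
  rw [Function.Surjective] at hfs
  push Not at hfs
  obtain ⟨c, hc⟩ := hfs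
  obtain ⟨g, hg, h0, hs⟩ := Nat'.exists_seq c hf
  refine ⟨g, hg, fun m => ?_⟩
  refine Nat'.induction (P := fun m : Nat' M => ∀ n, g m = g n → m = n) (by fun_prop) ?_ ?_ m
  · intro n hn
    rcases Nat'.eq_zero_or_succ n with rfl | ⟨n, rfl⟩
    · rfl
    · rw [h0, hs] at hn
      exact absurd hn.symm (hc _)
  · intro m ih n hn
    rcases Nat'.eq_zero_or_succ n with rfl | ⟨n, rfl⟩
    · rw [h0, hs] at hn
      exact absurd hn (hc _)
    · rw [hs, hs] at hn
      rw [ih n (hfi hn)]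

theorem not_dedekindFinite_of_injective {g : Nat' M → α} (hg : DefF M g)
    (hi : Function.Injective g) : ¬ DedekindFinite M α := fun h =>
  not_dedekindFinite_nat (M := M) (h.of_injective hg hi)

/-- A point lies in at most one of the sets, so a finite set is avoided from some index on. -/
theorem exists_add_disjoint {A : Nat' M → Fin' M α} (hA : DefF M A)
    (hd : ∀ i j, i ≠ j → Disjoint (A i).1 (A j).1) (F : Fin' M α) :
    ∃ k, ∀ n, Disjoint (A (n + k)).1 F.1 := by
  refine Fin'.induction (P := fun F : Fin' M α => ∃ k, ∀ n, Disjoint (A (n + k)).1 F.1)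
    (by fun_prop) ?_ ?_ F
  · exact fun F hF => ⟨0, fun n => by simp [hF]⟩
  · rintro F G x - hG ⟨k, hk⟩
    by_cases hx : ∃ j, x ∈ (A j).1
    · obtain ⟨j, hj⟩ := hx
      -- All indices from here on exceed `j`, the only one whose set contains `x`.
      refine ⟨k + (j + 1), fun n => ?_⟩
      rw [hG, Set.disjoint_insert_right]
      refine ⟨fun hx' => ?_, ?_⟩
      · refine Set.disjoint_left.1 (hd _ j ?_) hx' hj
        rw [← add_assoc]
        exact ((Nat'.lt_succ_self j).trans_le
          ((Nat'.succ_eq j).trans_le le_add_self)).ne'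
      · rw [add_comm k, ← add_assoc]
        exact hk _
    · push Not at hx
      exact ⟨k, fun n => by rw [hG, Set.disjoint_insert_right]; exact ⟨hx _, hk n⟩⟩

theorem exists_add_notMem {g : Nat' M → α} (hg : DefF M g) (hi : Function.Injective g)
    (F : Fin' M α) : ∃ k, ∀ n, g (n + k) ∉ F.1 := by
  obtain ⟨k, hk⟩ := exists_add_disjoint
    (A := fun n => (⟨{g n}, isFin_singleton (g n)⟩ : Fin' M α)) (by fun_prop)
    (fun i j hij => by simpa using fun h => hij (hi h)) F
  exact ⟨k, fun n => by simpa using hk n⟩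

/-- If `Fin(α)` is Dedekind-infinite, then there is a sequence of disjoint nonempty finite subsets
of `α`. -/
theorem exists_disjoint_seq (h : ¬ CohenFinite M α) : ∃ A : Nat' M → Fin' M α, DefF M A ∧
    (∀ i j, i ≠ j → Disjoint (A i).1 (A j).1) ∧ ∀ j, (A j).1.Nonempty := by
  obtain ⟨g, hg, hgi⟩ := exists_injective_of_not_dedekindFinite h
  -- The first index whose set is not contained in `F`: one exists because `F` has only finitely
  -- many subsets and `g` is injective. Taking the first avoids choice.
  obtain ⟨μ, hμ, hμ'⟩ := DefF.exists_choice (M := M) (P := fun (F : Fin' M α) (n : Nat' M) =>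
    ¬ (g n).1 ⊆ F.1 ∧ ∀ m, m < n → (g m).1 ⊆ F.1) (by fun_prop) fun F => by
      have h1 : ∃ n, ¬ (g n).1 ⊆ F.1 := by
        obtain ⟨k, hk⟩ := exists_add_notMem hg hgi ⟨_, F.isFin.powerset⟩
        exact ⟨_, hk 0⟩
      obtain ⟨n, hn⟩ := h1
      obtain ⟨n, hn, hn'⟩ := Nat'.exists_least (P := fun n => ¬ (g n).1 ⊆ F.1) (by fun_prop) hn
      push Not at hn'
      refine ⟨n, ⟨hn, hn'⟩, fun m hm => ?_⟩
      rcases lt_trichotomy m n with h | h | h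
      · exact absurd (hn' m h) hm.1
      · exact h
      · exact absurd (hm.2 n h) hn
  -- `U n` is the union of the sets used so far. The n-th block consists of the new points of the
  -- next set; there is one by the definition of `μ`.
  obtain ⟨U, hU, -, hUs⟩ := Nat'.exists_seq (M := M) (⟨∅, isFin_empty⟩ : Fin' M α)
    (s := fun F : Fin' M α => ⟨F.1 ∪ (g (μ F)).1, F.isFin.union (g (μ F)).isFin⟩) (by fun_prop)
  have hfin : ∀ n, IsFin M ((g (μ (U n))).1 \ (U n).1) := fun n =>
    (g (μ (U n))).isFin.subset (DefS.internal
      (F := fun n : Nat' M => (g (μ (U n))).1 \ (U n).1) (by fun_prop) n) Set.sdiff_subset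
  have hmono : ∀ m n, m < n → (g (μ (U m))).1 ⊆ (U n).1 := fun m => by
    refine Nat'.induction (P := fun n : Nat' M => m < n → (g (μ (U m))).1 ⊆ (U n).1)
      (by fun_prop) (fun h => absurd h (Nat'.not_lt_zero' m)) fun n ih hmn => ?_
    rw [hUs]
    rcases (Nat'.lt_succ_iff.1 hmn).lt_or_eq with h | rfl
    · exact (ih h).trans Set.subset_union_left
    · exact Set.subset_union_right
  have hlt : ∀ m n, m < n → Disjoint ((g (μ (U m))).1 \ (U m).1) ((g (μ (U n))).1 \ (U n).1) :=
    fun m n hmn => Set.disjoint_left.2 fun x hx hx' => hx'.2 (hmono m n hmn hx.1)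
  refine ⟨fun n => ⟨_, hfin n⟩, by fun_prop, fun i j hij => ?_, fun n => ?_⟩
  · rcases hij.lt_or_gt with h | h
    · exact hlt i j h
    · exact (hlt j i h).symm
  · exact Set.sdiff_nonempty.2 ((hμ' _ _).1 rfl).1

theorem isFin_univ_el (m : Nat' M) : IsFin M (Set.univ : Set (El m.1)) := by
  have hI : Internal M (Set.univ : Set (El m.1)) := (DefP.const True).internal
  have : MSet M {x : El m.1 // x ∈ Set.univ} := MSet.subtype hI
  refine ⟨hI, m, Subtype.val, ?_, Subtype.val_injective, fun x => ⟨⟨x, trivial⟩, rfl⟩⟩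
  have : DefF M fun x : {x : El m.1 // x ∈ Set.univ} => x.1 := by fun_prop
  exact this

theorem isFin_range_inr (m : Nat' M) : IsFin M (Set.range (Sum.inr : El m.1 → α ⊕ El m.1)) := by
  rw [← Set.image_univ]
  exact (isFin_univ_el m).image (by fun_prop)

theorem IsFin.preimage {f : α → β} (hf : DefF M f) (hi : Function.Injective f) {S : Set β}
    (hS : IsFin M S) : IsFin M (f ⁻¹' S) := by
  refine Fin'.induction (P := fun F : Fin' M β => IsFin M (f ⁻¹' F.1)) (by fun_prop) ?_ ?_ ⟨S, hS⟩
  · intro F hF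
    rw [hF]
    exact isFin_empty
  · intro F G x hx hG ih
    by_cases h : ∃ y, f y = x
    · obtain ⟨y, rfl⟩ := h
      convert! ih.insert y using 1
      ext z
      simp [hG, hi.eq_iff]
    · push Not at h
      convert! ih using 1
      ext z
      simp [hG, h z]

/-- An injective sequence in the larger set eventually avoids the finitely many added points, so a
tail of it runs in `α`. -/
theorem DedekindFinite.sum_el (h : DedekindFinite M α) (m : Nat' M) :
    DedekindFinite M (α ⊕ El m.1) := by
  by_contra hcon
  obtain ⟨g, hg, hgi⟩ := exists_injective_of_not_dedekindFinite hcon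
  obtain ⟨k, hk⟩ := exists_add_notMem hg hgi ⟨_, isFin_range_inr m⟩
  have hex : ∀ n, ∃ x, g (n + k) = .inl x := fun n => by
    rcases hz : g (n + k) with x | y
    · exact ⟨x, rfl⟩
    · exact absurd ⟨y, hz.symm⟩ (hk n)
  choose f hf using hex
  have hfd : DefF M f := .of_comp (e := Sum.inl (β := El m.1)) (by fun_prop) Sum.inl_injective (by
    simp only [← hf]; fun_prop)
  refine not_dedekindFinite_of_injective hfd (fun i j hij => ?_) h
  exact add_right_cancel (hgi ((hf i).trans ((congrArg _ hij).trans (hf j).symm)))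

/-- A set that arises from `α` by adding finitely many points and then removing finitely many has a
sequence of disjoint nonempty finite subsets if `α` has one. -/
theorem exists_disjoint_seq_of_equipotent {m n : Nat' M}
    (h : Equipotent M (α ⊕ El m.1) (β ⊕ El n.1)) {A : Nat' M → Fin' M α} (hA : DefF M A)
    (hd : ∀ i j, i ≠ j → Disjoint (A i).1 (A j).1) (hne : ∀ j, (A j).1.Nonempty) :
    ∃ B : Nat' M → Fin' M β, DefF M B ∧ (∀ i j, i ≠ j → Disjoint (B i).1 (B j).1) ∧
      ∀ j, (B j).1.Nonempty := by
  obtain ⟨e, he⟩ := h.exists_equiv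
  have hf : DefF M fun x : α => e (.inl x) := by fun_prop
  have hfi : Function.Injective fun x : α => e (.inl x) := e.injective.comp Sum.inl_injective
  let A' : Nat' M → Fin' M (β ⊕ El n.1) := fun j => ⟨_, (A j).isFin.image hf⟩
  have hA' : DefF M A' := by fun_prop
  have hd' : ∀ i j, i ≠ j → Disjoint (A' i).1 (A' j).1 := fun i j hij =>
    (Set.disjoint_image_iff hfi).2 (hd i j hij)
  -- From index `k` on, the transported blocks avoid the points of `El n`, so pulling them back to
  -- `β` leaves them nonempty.
  obtain ⟨k, hk⟩ := exists_add_disjoint hA' hd' ⟨_, isFin_range_inr n⟩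
  have hinl : DefF M (Sum.inl : β → β ⊕ El n.1) := by fun_prop
  refine ⟨fun j => ⟨_, (A' (j + k)).isFin.preimage hinl Sum.inl_injective⟩, by fun_prop,
    fun i j hij => (hd' _ _ fun h => hij (add_right_cancel h)).preimage _, fun j => ?_⟩
  obtain ⟨x, hx⟩ := hne (j + k)
  rcases hz : e (.inl x) with y | y
  · exact ⟨y, x, hx, hz⟩
  · exact absurd ⟨y, rfl⟩ (Set.disjoint_left.1 (hk j) ⟨x, hx, hz⟩)

/-- If m < n, the bijection from α ⊔ n to α ⊔ m, followed by the inclusion in α ⊔ n, is injective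
and misses the point m, although α ⊔ n is Dedekind-finite. -/
theorem nat_le_of_equipotent_sum (h : DedekindFinite M α) {m n : Nat' M}
    (he : Equipotent M (α ⊕ El m.1) (α ⊕ El n.1)) : n ≤ m := by
  by_contra! hlt
  obtain ⟨e, he⟩ := he.symm.exists_equiv
  choose i hi using fun k : El m.1 => exists_elNat ((elNat_lt m k).trans hlt)
  have hid : DefF M i := .of_comp (defF_elNat n) (elNat_injective n) (by
    simp only [hi]; fun_prop)
  have hii : Function.Injective i := fun a b hab => elNat_injective m (by rw [← hi, hab, hi])
  have hj : DefF M fun z : α ⊕ El n.1 =>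
      Sum.elim (fun x => (.inl x : α ⊕ El n.1)) (fun k => .inr (i k)) (e z) := by fun_prop
  obtain ⟨k, hk⟩ := exists_elNat hlt
  obtain ⟨z, hz⟩ := h.sum_el n _ hj (fun z w hzw => e.injective (by
    generalize e z = z at *
    generalize e w = w at *
    rcases z with x | a <;> rcases w with y | b
    · simpa using hzw
    · simp at hzw
    · simp at hzw
    · simp only [Sum.elim_inr, Sum.inr.injEq] at hzw
      rw [hii hzw])) (.inr k)
  rcases hez : e z with x | a
  · simp [hez] at hz
  · simp only [hez, Sum.elim_inr, Sum.inr.injEq] at hz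
    rw [← hz, hi] at hk
    exact (elNat_lt m a).ne hk

theorem nat_eq_of_equipotent_sum (h : DedekindFinite M α) {m n : Nat' M}
    (he : Equipotent M (α ⊕ El m.1) (α ⊕ El n.1)) : m = n :=
  le_antisymm (nat_le_of_equipotent_sum h he.symm) (nat_le_of_equipotent_sum h he)

end seq

section pairing
variable {M : Type u} [setLang.Structure M] [ZF : Fact (IsModelZF M)]
  {α β γ : Type u} [Coded M α] [MSet M α] [Coded M β] [MSet M β] [Coded M γ] [MSet M γ]

/-! ### Sequences of pairs -/

/-- On the set `S`, the involution `σ` has no fixed points, and `k` enumerates its orbits. -/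
structure IsPairingOn (S : Set α) (σ : α → α) (k : α → Nat' M) : Prop where
  mem : ∀ x, x ∈ S → σ x ∈ S
  ne : ∀ x, x ∈ S → σ x ≠ x
  invol : ∀ x, x ∈ S → σ (σ x) = x
  eq_iff : ∀ x, x ∈ S → ∀ y, y ∈ S → (k x = k y ↔ x = y ∨ σ x = y)
  surj : ∀ n, ∃ x, x ∈ S ∧ k x = n

/-- The involution `σ` has no fixed points, and `k` enumerates its orbits. -/
structure IsPairing (σ : α → α) (k : α → Nat' M) : Prop where
  ne : ∀ x, σ x ≠ x
  invol : ∀ x, σ (σ x) = x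
  eq_iff : ∀ x y, k x = k y ↔ x = y ∨ σ x = y
  surj : Function.Surjective k

/-- The set `α` is the union of a sequence of disjoint pairs. -/
def HasPairing (M : Type u) [setLang.Structure M] (α : Type u) [Coded M α] : Prop :=
  ∃ (σ : IFun M α α) (k : IFun M α (Nat' M)), IsPairing σ.1 k.1

/-- The involution exchanges the two points of each pair, and `k` is the index of the pair. Both are
determined by the sequence, so no pair has to be ordered. -/
theorem isRussell_iff : IsRussell M α ↔ DedekindFinite M α ∧ HasPairing M α := by
  refine and_congr_right fun _ => ⟨?_, ?_⟩
  · rintro ⟨A, hA, hp, hd, hU⟩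
    have hI : ∀ n, Internal M (A n) := fun n => by
      obtain ⟨a, b, -, h⟩ := hp n
      rw [h]
      exact DefS.internal (F := fun a : α => ({a, b} : Set α)) (by fun_prop) a
    have hA' : DefF M fun n => (⟨A n, hI n⟩ : ISet M α) := hA
    have hAm : DefP M fun p : α × Nat' M => p.1 ∈ A p.2 := by
      have : ∀ {B : Nat' M → ISet M α}, DefF M B → DefP M fun p : α × Nat' M => p.1 ∈ (B p.2).1 :=
        fun hB => by fun_prop
      exact this hA'
    have huniq : ∀ {x m n}, x ∈ A m → x ∈ A n → m = n := fun {x m n} hm hn => by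
      by_contra h
      exact Set.disjoint_left.1 (hd m n h) hm hn
    obtain ⟨k, hk, hk'⟩ := DefF.exists_choice (M := M) (P := fun (x : α) (n : Nat' M) => x ∈ A n)
      hAm fun x => by
        obtain ⟨n, hn⟩ := Set.mem_iUnion.1 (hU ▸ Set.mem_univ x)
        exact ⟨n, hn, fun m hm => huniq hm hn⟩
    obtain ⟨σ, hσ, hσ'⟩ := DefF.exists_choice (M := M) (P := fun (x y : α) => k x = k y ∧ y ≠ x)
      (by fun_prop) fun x => by
        have hx := (hk' x _).1 rfl
        obtain ⟨a, b, hab, h⟩ := hp (k x)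
        have hmem : ∀ y, k x = k y ↔ y = a ∨ y = b := fun y => by
          rw [eq_comm, hk', h]; rfl
        rw [h] at hx
        simp only [hmem]
        rcases hx with rfl | rfl
        · exact ⟨b, ⟨.inr rfl, hab.symm⟩, fun y hy => hy.1.resolve_left hy.2⟩
        · exact ⟨a, ⟨.inl rfl, hab⟩, fun y hy => hy.1.resolve_right hy.2⟩
    have h1 : ∀ x, k x = k (σ x) ∧ σ x ≠ x := fun x => (hσ' x _).1 rfl
    refine ⟨⟨σ, hσ⟩, ⟨k, hk⟩, fun x => (h1 x).2,
      fun x => (hσ' _ _).2 ⟨(h1 x).1.symm, (h1 x).2.symm⟩,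
      fun x y => ⟨fun h => ?_, ?_⟩, fun n => ?_⟩
    · by_cases hxy : x = y
      · exact .inl hxy
      · exact .inr ((hσ' x y).2 ⟨h, Ne.symm hxy⟩)
    · rintro (rfl | rfl)
      · rfl
      · exact (h1 x).1
    · obtain ⟨a, b, -, h⟩ := hp n
      exact ⟨a, (hk' _ _).2 (h ▸ .inl rfl)⟩
  · rintro ⟨⟨σ, hσ⟩, ⟨k, hk⟩, h⟩
    have hσ : DefF M σ := hσ
    have hk : DefF M k := hk
    have hI : ∀ n, Internal M {x | k x = n} := fun n =>
      DefS.internal (F := fun n : Nat' M => {x | k x = n}) (by fun_prop) n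
    have hA : DefF M fun n => (⟨{x | k x = n}, hI n⟩ : ISet M α) := by fun_prop
    refine ⟨fun n => {x | k x = n}, hA, fun n => ?_, fun m n hmn => ?_, ?_⟩
    · obtain ⟨x, rfl⟩ := h.surj n
      refine ⟨x, σ x, (h.ne x).symm, Set.ext fun y => ?_⟩
      rw [Set.mem_ofPred_eq, eq_comm, h.eq_iff]
      simp [eq_comm]
    · refine Set.disjoint_left.2 fun x hx hx' => hmn ?_
      exact Eq.trans (Eq.symm hx) hx'
    · exact Set.eq_univ_of_forall fun x => Set.mem_iUnion.2 ⟨k x, rfl⟩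

theorem IsPairing.conj {σ : α → α} {k : α → Nat' M} (h : IsPairing σ k) (e : α ≃ β) :
    IsPairing (fun y => e (σ (e.symm y))) (fun y => k (e.symm y)) where
  ne y hy := h.ne (e.symm y) ((e.symm_apply_apply _).symm.trans (congrArg e.symm hy))
  invol y := by simp [h.invol]
  eq_iff x y := by
    rw [h.eq_iff, e.symm.injective.eq_iff, ← e.eq_symm_apply]
  surj := h.surj.comp e.symm.surjective

theorem HasPairing.of_equipotent (h : HasPairing M α) (he : Equipotent M α β) :
    HasPairing M β := by
  obtain ⟨e, he⟩ := he.exists_equiv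
  have he' := DefF.equiv_symm he
  obtain ⟨⟨σ, hσ⟩, ⟨k, hk⟩, h⟩ := h
  have hσ : DefF M σ := hσ
  have hk : DefF M k := hk
  have h1 : DefF M fun y => e (σ (e.symm y)) := by fun_prop
  have h2 : DefF M fun y => k (e.symm y) := by fun_prop
  exact ⟨⟨_, h1⟩, ⟨_, h2⟩, h.conj e⟩

theorem hasPairing_congr (he : Equipotent M α β) : HasPairing M α ↔ HasPairing M β :=
  ⟨fun h => h.of_equipotent he, fun h => h.of_equipotent he.symm⟩

/-- Replaces the type `α` by a subset of a fixed type, so that families of such sets can be handled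
in the model. Outside `S` the extended functions take default values: the identity and zero. -/
theorem hasPairing_iff_on {f : α → β} (hf : DefF M f) (hi : Function.Injective f) {S : Set β}
    (hS : ∀ y, y ∈ S ↔ ∃ x, f x = y) :
    HasPairing M α ↔ ∃ (σ : IFun M β β) (k : IFun M β (Nat' M)), IsPairingOn S σ.1 k.1 := by
  have hfS : ∀ x, f x ∈ S := fun x => (hS _).2 ⟨x, rfl⟩
  constructor
  · rintro ⟨⟨σ, hσ⟩, ⟨k, hk⟩, h⟩
    have hσ : DefF M σ := hσ
    have h : IsPairing σ k := h
    obtain ⟨σ', hσ', h1, -⟩ := hf.exists_extend hi (hf.comp hσ) DefF.id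
    obtain ⟨k', hk', h2, -⟩ := hf.exists_extend hi (show DefF M k from hk) (DefF.const 0)
    refine ⟨⟨σ', hσ'⟩, ⟨k', hk'⟩, ?_, ?_, ?_, ?_, fun n => ?_⟩
    · intro y hy
      obtain ⟨x, rfl⟩ := (hS y).1 hy
      simpa only [h1] using hfS _
    · intro y hy
      obtain ⟨x, rfl⟩ := (hS y).1 hy
      simpa only [h1] using fun h' => h.ne x (hi h')
    · intro y hy
      obtain ⟨x, rfl⟩ := (hS y).1 hy
      simp only [h1, h.invol]
    · intro y hy z hz
      obtain ⟨x, rfl⟩ := (hS y).1 hy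
      obtain ⟨w, rfl⟩ := (hS z).1 hz
      simp only [h1, h2, h.eq_iff, hi.eq_iff]
    · obtain ⟨x, hx⟩ := h.surj n
      exact ⟨f x, hfS x, (h2 x).trans hx⟩
  · rintro ⟨⟨σ, hσ⟩, ⟨k, hk⟩, h⟩
    have hσ : DefF M σ := hσ
    have hk : DefF M k := hk
    choose s hs using fun x => (hS _).1 (h.mem _ (hfS x))
    have hsd : DefF M s := .of_comp hf hi (by simp only [hs]; fun_prop)
    have hkd : DefF M fun x => k (f x) := by fun_prop
    refine ⟨⟨s, hsd⟩, ⟨_, hkd⟩, fun x hx => ?_, fun x => hi ?_, fun x y => ?_, fun n => ?_⟩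
    · have := hs x
      dsimp only at hx this
      rw [hx] at this
      exact h.ne _ (hfS x) this.symm
    · dsimp only
      rw [hs, hs, h.invol _ (hfS x)]
    · dsimp only
      rw [h.eq_iff _ (hfS x) _ (hfS y), ← hs x, hi.eq_iff, hi.eq_iff]
    · obtain ⟨y, hy, rfl⟩ := h.surj n
      obtain ⟨x, rfl⟩ := (hS y).1 hy
      exact ⟨x, rfl⟩

/-- The function `f` is a bijection from `α` to `β` without the point `p`. -/
structure IsAddPoint (f : α → β) (p : β) : Prop where
  inj : Function.Injective f
  ne : ∀ x, f x ≠ p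
  cover : ∀ y, y = p ∨ ∃ x, f x = y

/-- The two new points form the pair of index zero; the other indices move up by one. -/
theorem HasPairing.add_two {f : α → β} {p : β} {g : β → γ} {q : γ} (hf : DefF M f) (hg : DefF M g)
    (h : IsAddPoint f p) (h' : IsAddPoint g q) (hα : HasPairing M α) : HasPairing M γ := by
  obtain ⟨⟨σ, hσ⟩, ⟨k, hk⟩, hp⟩ := hα
  have hσ : DefF M σ := hσ
  have hk : DefF M k := hk
  have hp : IsPairing σ k := hp
  classical
  have hgf : DefF M fun x => g (f x) := by fun_prop
  have hi : Function.Injective fun x => g (f x) := h'.inj.comp h.inj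
  have hk1 : DefF M fun x => k x + 1 := by fun_prop
  have hsw : DefF M fun z => if z = q then g p else q := by fun_prop
  obtain ⟨s, hs, s1, s2⟩ := hgf.exists_extend hi (hgf.comp hσ) hsw
  obtain ⟨l, hl, l1, l2⟩ := hgf.exists_extend hi hk1 (DefF.const 0)
  have hgp : ∀ x, g (f x) ≠ g p := fun x hx => h.ne x (h'.inj hx)
  have sq : s q = g p := (s2 q fun x => h'.ne _).trans (if_pos rfl)
  have sp : s (g p) = q := (s2 (g p) hgp).trans (if_neg (h'.ne _))
  have lq : l q = 0 := l2 q fun x => h'.ne _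
  have lp : l (g p) = 0 := l2 (g p) hgp
  have hc : ∀ z, z = q ∨ z = g p ∨ ∃ x, g (f x) = z := fun z => by
    rcases h'.cover z with hz | ⟨y, rfl⟩
    · exact .inl hz
    · rcases h.cover y with rfl | ⟨x, rfl⟩
      · exact .inr (.inl rfl)
      · exact .inr (.inr ⟨x, rfl⟩)
  have h0 : ∀ x, k x + 1 ≠ 0 := fun x => by rw [← Nat'.succ_eq]; exact Nat'.succ_ne_zero _
  have hpq := h'.ne p
  have hq := fun x => h'.ne (f x)
  refine ⟨⟨s, hs⟩, ⟨l, hl⟩, fun z => ?_, fun z => ?_, fun z w => ?_, fun n => ?_⟩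
  · dsimp only
    rcases hc z with rfl | rfl | ⟨x, rfl⟩
    · rw [sq]; exact hpq
    · rw [sp]; exact hpq.symm
    · rw [s1]; exact fun hx => hp.ne x (hi hx)
  · dsimp only
    rcases hc z with rfl | rfl | ⟨x, rfl⟩
    · rw [sq, sp]
    · rw [sp, sq]
    · rw [s1, s1, hp.invol]
  · dsimp only
    rcases hc z with rfl | rfl | ⟨x, rfl⟩ <;> rcases hc w with rfl | rfl | ⟨y, rfl⟩
    · simp
    · simp [lq, lp, sq]
    · simp [lq, l1, sq, (h0 y).symm, (hq y).symm, (hgp y).symm]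
    · simp [lq, lp, sp]
    · simp
    · simp [lp, l1, sp, (h0 y).symm, (hq y).symm, (hgp y).symm]
    · simp [lq, l1, s1, h0, hq]
    · simp [lp, l1, s1, h0, hgp]
    · have e1 : g (f x) = g (f y) ↔ x = y := hi.eq_iff
      have e2 : g (f (σ x)) = g (f y) ↔ σ x = y := hi.eq_iff
      rw [l1, l1, s1, add_left_inj, hp.eq_iff, e1, e2]
  · rcases Nat'.eq_zero_or_succ n with rfl | ⟨n, rfl⟩
    · exact ⟨q, lq⟩
    · obtain ⟨x, rfl⟩ := hp.surj n
      exact ⟨g (f x), (l1 x).trans (Nat'.succ_eq _).symm⟩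

/-- Conjugation by the transposition of `g p` and the partner of `q` makes the two points a pair;
this pair is deleted and the gap in the enumeration closed. -/
theorem HasPairing.remove_two {f : α → β} {p : β} {g : β → γ} {q : γ} (hf : DefF M f)
    (hg : DefF M g) (h : IsAddPoint f p) (h' : IsAddPoint g q) (hγ : HasPairing M γ) :
    HasPairing M α := by
  classical
  obtain ⟨⟨σ, hσ⟩, ⟨k, hk⟩, hp⟩ := hγ
  have hσ : DefF M σ := hσ
  have hk : DefF M k := hk
  have hp : IsPairing σ k := hp
  obtain ⟨σ, k, hσ, hk, hp, hqp⟩ : ∃ (s : γ → γ) (l : γ → Nat' M), DefF M s ∧ DefF M l ∧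
      IsPairing s l ∧ s q = g p := by
    let e := Equiv.swap (g p) (σ q)
    have he : DefF M e := by
      have : DefF M fun z => if z = g p then σ q else if z = σ q then g p else z := by fun_prop
      exact this
    have he' := DefF.equiv_symm he
    refine ⟨_, _, ?_, ?_, hp.conj e, ?_⟩
    · fun_prop
    · fun_prop
    · have : e.symm q = q := by
        rw [Equiv.symm_swap, Equiv.swap_apply_of_ne_of_ne (h'.ne p).symm (hp.ne q).symm]
      rw [this]
      exact Equiv.swap_apply_right _ _
  have hgf : DefF M fun x => g (f x) := by fun_prop
  have hi : Function.Injective fun x => g (f x) := h'.inj.comp h.inj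
  have hgp : ∀ x, g (f x) ≠ g p := fun x hx => h.ne x (h'.inj hx)
  have hpq : σ (g p) = q := by rw [← hqp, hp.invol]
  have hc : ∀ z, z ≠ q → z ≠ g p → ∃ x, g (f x) = z := fun z hz hz' => by
    obtain ⟨y, rfl⟩ := (h'.cover z).resolve_left hz
    obtain ⟨x, rfl⟩ := (h.cover y).resolve_left fun hy => hz' (hy ▸ rfl)
    exact ⟨x, rfl⟩
  have hσx : ∀ x, ∃ y, g (f y) = σ (g (f x)) := fun x => hc _
    (fun hx => hgp x (by rw [← hqp, ← hx, hp.invol]))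
    (fun hx => h'.ne (f x) (by rw [← hpq, ← hx, hp.invol]))
  choose s hs using hσx
  have hsd : DefF M s := .of_comp hgf hi (by simp only [hs]; fun_prop)
  let j := k q
  -- The increasing enumeration of the numbers other than `j`.
  let sk : Nat' M → Nat' M := fun n => if n < j then n else n + 1
  have hsk : DefF M sk := by fun_prop
  have hlt : ∀ n : Nat' M, n < n + 1 := fun n => by rw [← Nat'.succ_eq]; exact Nat'.lt_succ_self n
  have hski : Function.Injective sk := fun m n hmn => by
    simp only [sk] at hmn
    split_ifs at hmn with h1 h2 h2
    · exact hmn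
    · rw [hmn] at h1
      exact absurd ((hlt n).trans h1) h2
    · rw [← hmn] at h2
      exact absurd ((hlt m).trans h2) h1
    · exact add_right_cancel hmn
  have hskj : ∀ n, sk n ≠ j := fun n hn => by
    simp only [sk] at hn
    split_ifs at hn with h1
    · exact h1.ne hn
    · exact h1 (hn ▸ hlt n)
  have hsks : ∀ n, n ≠ j → ∃ m, sk m = n := fun n hn => by
    rcases hn.lt_or_gt with h1 | h1
    · exact ⟨n, if_pos h1⟩
    · rcases Nat'.eq_zero_or_succ n with rfl | ⟨m, rfl⟩
      · exact absurd h1 (Nat'.not_lt_zero' _)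
      · exact ⟨m, (if_neg (not_lt.2 (Nat'.lt_succ_iff.1 h1))).trans (Nat'.succ_eq m).symm⟩
  have hkx : ∀ x, k (g (f x)) ≠ j := fun x hx => by
    rcases (hp.eq_iff q (g (f x))).1 hx.symm with h1 | h1
    · exact h'.ne (f x) h1.symm
    · exact hgp x (h1.symm.trans hqp)
  choose l hl using fun x => hsks _ (hkx x)
  have hld : DefF M l := .of_comp hsk hski (by simp only [hl]; fun_prop)
  refine ⟨⟨s, hsd⟩, ⟨l, hld⟩, fun x hx => ?_, fun x => hi ?_, fun x y => ?_, fun n => ?_⟩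
  · have := hs x
    dsimp only at hx
    rw [hx] at this
    exact hp.ne _ this.symm
  · dsimp only
    rw [hs, hs, hp.invol]
  · have e1 : g (f x) = g (f y) ↔ x = y := hi.eq_iff
    have e2 : g (f (s x)) = g (f y) ↔ s x = y := hi.eq_iff
    dsimp only
    rw [← hski.eq_iff, hl, hl, hp.eq_iff, e1, ← hs, e2]
  · obtain ⟨z, hz⟩ := hp.surj (sk n)
    have h1 : z ≠ q := fun h => hskj n (by rw [← hz, h])
    have h2 : z ≠ g p := fun h => hskj n (by
      rw [← hz, h]; exact (hp.eq_iff _ _).2 (.inr hpq))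
    obtain ⟨x, rfl⟩ := hc z h1 h2
    exact ⟨x, hski ((hl x).trans hz)⟩

/-- Adding one point to a Dedekind-finite set with a fixed-point-free involution destroys that
property. -/
theorem HasPairing.not_add_one {f : α → β} {p : β} (hf : DefF M f) (h : IsAddPoint f p)
    (hβ : DedekindFinite M β) (hα : HasPairing M α) : ¬ HasPairing M β := by
  rintro ⟨⟨σ, hσ⟩, _, hp⟩
  obtain ⟨⟨τ₀, hτ₀⟩, _, hp₀⟩ := hα
  have hσ : DefF M σ := hσ
  have hτ₀ : DefF M τ₀ := hτ₀
  have σne : ∀ y, σ y ≠ y := hp.ne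
  have σσ : ∀ y, σ (σ y) = y := hp.invol
  -- The involution of `α` is extended to `β` with `p` as its only fixed point.
  obtain ⟨τ, hτ, t1, t2⟩ := hf.exists_extend h.inj (hf.comp hτ₀) DefF.id
  have tp : τ p = p := t2 p h.ne
  have ττ : ∀ y, τ (τ y) = y := fun y => by
    rcases h.cover y with rfl | ⟨x, rfl⟩
    · rw [tp, tp]
    · rw [t1, t1]
      exact congrArg f (hp₀.invol x)
  have tfix : ∀ y, τ y = y → y = p := fun y hy => by
    rcases h.cover y with rfl | ⟨x, rfl⟩
    · rfl
    · rw [t1] at hy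
      exact absurd (h.inj hy) (hp₀.ne x)
  -- The orbit of `p` under the injection τσ; Dedekind-finiteness forces a repetition.
  obtain ⟨x, hx, x0, xs⟩ := Nat'.exists_seq (M := M) p (s := fun y => τ (σ y)) (by fun_prop)
  have xs' : ∀ n, x (n + 1) = τ (σ (x n)) := fun n => by rw [← Nat'.succ_eq, xs]
  have hinj : ∀ y z, τ (σ y) = τ (σ z) → y = z := fun y z hyz => by
    rw [← σσ y, ← ττ (σ y), hyz, ττ, σσ]
  have hrep : ∃ i d : Nat' M, 0 < d ∧ x (i + d) = x i := by
    by_contra! hcon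
    refine not_dedekindFinite_of_injective hx (fun i j hij => ?_) hβ
    by_contra hne
    have key : ∀ i j, i < j → x i ≠ x j := fun i j hlt hij => by
      obtain ⟨d, rfl⟩ := Nat'.exists_add_of_le hlt.le
      exact hcon i d (pos_of_lt_add_right hlt) hij.symm
    rcases lt_or_gt_of_ne hne with h1 | h1
    · exact key _ _ h1 hij
    · exact key _ _ h1 hij.symm
  obtain ⟨i, d₀, hd₀, hi⟩ := hrep
  -- Injectivity moves the repetition back to the start of the orbit.
  have hcancel : ∀ i : Nat' M, x (i + d₀) = x i → x d₀ = p :=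
    Nat'.induction (P := fun i : Nat' M => x (i + d₀) = x i → x d₀ = p) (by fun_prop)
      (fun h => by rwa [zero_add, x0] at h) fun i ih h => ih (hinj _ _ (by
        rwa [Nat'.succ_eq, add_right_comm, xs', xs'] at h))
  obtain ⟨d, ⟨hd, hxd⟩, hmin⟩ := Nat'.exists_least (P := fun d : Nat' M => 0 < d ∧ x d = p)
    (by fun_prop) ⟨hd₀, hcancel i hi⟩
  -- The dihedral relation: τ reverses the cycle and sends `x a` to `x (d - a)`.
  have hrefl : ∀ a b, a + b = d → τ (x a) = x b := by
    refine Nat'.induction (P := fun a : Nat' M => ∀ b, a + b = d → τ (x a) = x b) (by fun_prop)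
      (fun b hb => ?_) fun a ih b hb => ?_
    · rw [zero_add] at hb
      rw [x0, tp, hb, hxd]
    · rw [Nat'.succ_eq, add_right_comm, add_assoc] at hb
      have h1 := ih _ hb
      rw [xs'] at h1
      have h2 : x a = σ (x b) := by rw [← ττ (x a), h1, ττ]
      rw [Nat'.succ_eq, xs', ττ, h2, σσ]
  -- The centre of the reflection. For d = 2c, τ fixes `x c`, so the orbit is back at `p` before
  -- `d`. For d = 2c + 1, τ sends `x (c + 1)`, which is τ (σ (x c)), to `x c`, so σ fixes `x c`.
  obtain ⟨c, hc | hc⟩ := Nat'.even_or_odd d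
  · have hc0 : 0 < c := by
      rcases Nat'.zero_lt_or c with h0 | rfl
      · exact h0
      · rw [hc, zero_add] at hd
        exact absurd hd (Nat'.not_lt_zero' _)
    refine hmin c ?_ ⟨hc0, tfix _ (hrefl c c hc.symm)⟩
    rw [hc]
    exact lt_add_of_pos_left c hc0
  · have h1 := hrefl (c + 1) c (by rw [hc, add_right_comm])
    rw [xs', ττ] at h1
    exact σne _ h1

end pairing

section parity
variable {M : Type u} [setLang.Structure M] [ZF : Fact (IsModelZF M)]
  {α β γ : Type u} [Coded M α] [MSet M α] [Coded M β] [MSet M β] [Coded M γ] [MSet M γ]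

/-! ### Parity -/

theorem isEmpty_el_zero : IsEmpty (El (0 : Nat' M).1) :=
  ⟨fun x => Nat'.not_lt_zero' _ (elNat_lt _ x)⟩

theorem equipotent_sum_el_zero : Equipotent M α (α ⊕ El (0 : Nat' M).1) := by
  have hf : DefF M (Sum.inl : α → α ⊕ El (0 : Nat' M).1) := by fun_prop
  exact ⟨_, hf, Sum.inl_injective, fun z => match z with
    | .inl x => ⟨x, rfl⟩
    | .inr x => isEmpty_el_zero.elim x⟩

/-- The equipotence is turned into an equation by `nat_eq_of_equipotent_sum`, with the empty set as
the Dedekind-finite summand. -/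
theorem isEvenNat_iff {m : Nat' M} : IsEvenNat m ↔ ∃ k : Nat' M, m = k + k := by
  constructor
  · rintro ⟨k, hk⟩
    have h0 : DedekindFinite M (El (0 : Nat' M).1) := fun _ _ _ x => isEmpty_el_zero.elim x
    exact ⟨k, nat_eq_of_equipotent_sum h0 (Equipotent.refl.sum (hk.trans (.elNat_add k k)))⟩
  · rintro ⟨k, rfl⟩
    exact ⟨k, (Equipotent.elNat_add k k).symm⟩

theorem isEvenNat_add_one {m : Nat' M} : IsEvenNat (m + 1) ↔ ¬ IsEvenNat m := by
  simp only [isEvenNat_iff]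
  constructor
  · rintro ⟨k, hk⟩ ⟨j, rfl⟩
    exact Nat'.add_self_ne j k hk
  · intro h
    obtain ⟨k, hk | rfl⟩ := Nat'.even_or_odd m
    · exact absurd ⟨k, hk⟩ h
    · exact ⟨k + 1, by ring⟩

theorem exists_isAddPoint (n : Nat' M) : ∃ (f : α ⊕ El n.1 → α ⊕ El (n + 1).1)
    (p : α ⊕ El (n + 1).1), DefF M f ∧ IsAddPoint f p := by
  have hn : n < n + 1 := by rw [← Nat'.succ_eq]; exact Nat'.lt_succ_self n
  choose i hi using fun k : El n.1 => exists_elNat ((elNat_lt n k).trans hn)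
  have hid : DefF M i := .of_comp (defF_elNat _) (elNat_injective _) (by
    simp only [hi]; fun_prop)
  obtain ⟨p, hp⟩ := exists_elNat hn
  refine ⟨fun z => Sum.elim (fun x => .inl x) (fun k => .inr (i k)) z, .inr p,
    by fun_prop, ?_, ?_, ?_⟩
  · intro z w h
    rcases z with x | a <;> rcases w with y | b
    · simpa using h
    · simp at h
    · simp at h
    · simp only [Sum.elim_inr, Sum.inr.injEq] at h
      rw [elNat_injective n (a₁ := a) (a₂ := b) (by rw [← hi, h, hi])]
  · rintro (x | a) h
    · simp at h
    · simp only [Sum.elim_inr, Sum.inr.injEq] at h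
      rw [← h, hi] at hp
      exact (elNat_lt n a).ne hp
  · rintro (x | b)
    · exact .inr ⟨.inl x, rfl⟩
    · have hb := Nat'.lt_succ_iff.1 ((elNat_lt _ b).trans_eq (Nat'.succ_eq n).symm)
      rcases hb.lt_or_eq with h | h
      · obtain ⟨a, ha⟩ := exists_elNat h
        refine .inr ⟨.inr a, congrArg Sum.inr (elNat_injective _ ?_)⟩
        rw [hi, ha]
      · refine .inl (congrArg Sum.inr (elNat_injective _ ?_))
        rw [hp]
        exact h

theorem hasPairing_add_two (n : Nat' M) :
    HasPairing M (α ⊕ El (n + 1 + 1).1) ↔ HasPairing M (α ⊕ El n.1) := by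
  obtain ⟨f, p, hf, h⟩ := exists_isAddPoint (α := α) n
  obtain ⟨g, q, hg, h'⟩ := exists_isAddPoint (α := α) (n + 1)
  exact ⟨.remove_two hf hg h h', .add_two hf hg h h'⟩

/-- Induction on `j`, two points at a time. As `j` may be nonstandard, the statement must be
definable in `j`, but the type α ⊔ El k varies with `k`; the subsets `S k` of the fixed type α ⊔ ℕ
take its place. -/
theorem hasPairing_add_self (j : Nat' M) :
    HasPairing M (α ⊕ El (j + j).1) ↔ HasPairing M α := by
  let S (k : Nat' M) : Set (α ⊕ Nat' M) := {z | (∃ x, z = .inl x) ∨ ∃ i, i < k ∧ z = .inr i}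
  have hS : DefS M S := by fun_prop
  have key : ∀ k : Nat' M, HasPairing M (α ⊕ El k.1) ↔ ∃ (σ : IFun M (α ⊕ Nat' M) (α ⊕ Nat' M))
      (l : IFun M (α ⊕ Nat' M) (Nat' M)), IsPairingOn (S k) σ.1 l.1 := fun k => by
    have hf : DefF M fun z : α ⊕ El k.1 =>
        Sum.elim (fun x => (.inl x : α ⊕ Nat' M)) (fun i => .inr (elNat k i)) z := by fun_prop
    refine hasPairing_iff_on hf (fun z w h => ?_) fun y => ⟨?_, ?_⟩
    · rcases z with x | a <;> rcases w with y | b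
      · simpa using h
      · simp at h
      · simp at h
      · simp only [Sum.elim_inr, Sum.inr.injEq] at h
        rw [elNat_injective k h]
    · rintro (⟨x, rfl⟩ | ⟨i, hi, rfl⟩)
      · exact ⟨.inl x, rfl⟩
      · obtain ⟨a, rfl⟩ := exists_elNat hi
        exact ⟨.inr a, rfl⟩
    · rintro ⟨x | a, rfl⟩
      · exact .inl ⟨x, rfl⟩
      · exact .inr ⟨_, elNat_lt k a, rfl⟩
  have hQ : DefP M fun k : Nat' M => ∃ (σ : IFun M (α ⊕ Nat' M) (α ⊕ Nat' M))
      (l : IFun M (α ⊕ Nat' M) (Nat' M)), IsPairingOn (S k) σ.1 l.1 := by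
    refine DefP.congr (P := fun k : Nat' M => ∃ (σ : IFun M (α ⊕ Nat' M) (α ⊕ Nat' M))
      (l : IFun M (α ⊕ Nat' M) (Nat' M)), (∀ x, x ∈ S k → σ.1 x ∈ S k) ∧
      (∀ x, x ∈ S k → σ.1 x ≠ x) ∧ (∀ x, x ∈ S k → σ.1 (σ.1 x) = x) ∧
      (∀ x, x ∈ S k → ∀ y, y ∈ S k → (l.1 x = l.1 y ↔ x = y ∨ σ.1 x = y)) ∧
      ∀ n, ∃ x, x ∈ S k ∧ l.1 x = n) (by fun_prop) fun k => ?_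
    exact exists_congr fun σ => exists_congr fun l =>
      ⟨fun ⟨h1, h2, h3, h4, h5⟩ => ⟨h1, h2, h3, h4, h5⟩,
        fun ⟨h1, h2, h3, h4, h5⟩ => ⟨h1, h2, h3, h4, h5⟩⟩
  have hP : DefP M fun j : Nat' M => HasPairing M (α ⊕ El (j + j).1) ↔ HasPairing M α := by
    simp only [key]
    exact (hQ.comp (f := fun j : Nat' M => j + j) (by fun_prop)).iff (DefP.const _)
  refine Nat'.induction hP ?_ (fun j ih => ?_) j
  · rw [add_zero]
    exact (hasPairing_congr equipotent_sum_el_zero).symm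
  · have e : j.succ + j.succ = j + j + 1 + 1 := by rw [Nat'.succ_eq]; ring
    rw [e, hasPairing_add_two, ih]

/-- For k = 2j + 1 the set is α ⊔ 2j with one more point. The former has a pairing, so
`HasPairing.not_add_one` excludes one on the latter. -/
theorem hasPairing_sum_iff (hd : DedekindFinite M α) (hα : HasPairing M α) (k : Nat' M) :
    HasPairing M (α ⊕ El k.1) ↔ IsEvenNat k := by
  rw [isEvenNat_iff]
  constructor
  · intro h
    obtain ⟨j, hj | rfl⟩ := Nat'.even_or_odd k
    · exact ⟨j, hj⟩
    · obtain ⟨f, p, hf, hp⟩ := exists_isAddPoint (α := α) (j + j)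
      exact absurd h (HasPairing.not_add_one hf hp (hd.sum_el _) ((hasPairing_add_self j).2 hα))
  · rintro ⟨j, rfl⟩
    exact (hasPairing_add_self j).2 hα

theorem equipotent_sum_add_one {m n : Nat' M} (h : Equipotent M (α ⊕ El m.1) (β ⊕ El n.1)) :
    Equipotent M (α ⊕ El (m + 1).1) (β ⊕ El (n + 1).1) :=
  ((Equipotent.refl.sum (Equipotent.elNat_add m 1)).symm.trans Equipotent.sum_assoc.symm).trans
    ((h.sum .refl).trans (Equipotent.sum_assoc.trans (.sum .refl (Equipotent.elNat_add n 1))))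

/-- For even `n` the points of `El n` do not affect the existence of a pairing on `β`, and
`hasPairing_sum_iff` decides. For odd `n` one point is first added on both sides, which changes both
parities. -/
theorem hasPairing_iff_of_equipotent {m n : Nat' M}
    (h : Equipotent M (α ⊕ El m.1) (β ⊕ El n.1)) (hd : DedekindFinite M α)
    (hα : HasPairing M α) : HasPairing M β ↔ (IsEvenNat m ↔ IsEvenNat n) := by
  have key : ∀ {m n : Nat' M}, Equipotent M (α ⊕ El m.1) (β ⊕ El n.1) → IsEvenNat n →
      (HasPairing M β ↔ IsEvenNat m) := fun {m n} h hn => by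
    obtain ⟨j, rfl⟩ := isEvenNat_iff.1 hn
    rw [← hasPairing_add_self j, ← hasPairing_congr h, hasPairing_sum_iff hd hα]
  by_cases hn : IsEvenNat n
  · rw [key h hn, iff_true_right hn]
  · rw [key (equipotent_sum_add_one h) (isEvenNat_add_one.2 hn), isEvenNat_add_one,
      iff_false_right hn]

theorem DedekindFinite.of_equipotent_sum {m n : Nat' M}
    (h : Equipotent M (α ⊕ El m.1) (β ⊕ El n.1)) (hd : DedekindFinite M α) :
    DedekindFinite M β :=
  .of_injective (f := Sum.inl) (by fun_prop) Sum.inl_injective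
    ((hd.sum_el m).of_equipotent h.symm)

/-- ℕ absorbs the added points on either side. -/
theorem equipotent_sum_nat {m n : Nat' M} (h : Equipotent M (α ⊕ El m.1) (β ⊕ El n.1)) :
    Equipotent M (α ⊕ Nat' M) (β ⊕ Nat' M) :=
  ((Equipotent.refl.sum (Equipotent.elNat_sum_nat m)).symm.trans Equipotent.sum_assoc.symm).trans
    ((h.sum .refl).trans (Equipotent.sum_assoc.trans (.sum .refl (Equipotent.elNat_sum_nat n))))

end parity

end ZFHilbert

theorem mainTheorem4 {M : Type u} [setLang.Structure M] (hM : IsModelZF M) :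
    Nonempty (RealField M) ∧
    ∀ (R : RealField M) (X : M), DedekindFinite M (El X) → ¬ CohenFinite M (El X) →
      Ell2Iso R (El X) (El X ⊕ Nat' M) ∧
      (∃ B₁ B₂ : Set (Ell2 R (El X)),
        IsOrthonormalBasis B₁ ∧ IsOrthonormalBasis B₂ ∧
        Equipotent M {e // e ∈ B₁} (El X) ∧ DedekindFinite M {e // e ∈ B₁} ∧
        Equipotent M {e // e ∈ B₂} (El X ⊕ Nat' M) ∧ ¬ DedekindFinite M {e // e ∈ B₂} ∧
        ¬ Equipotent M {e // e ∈ B₁} {e // e ∈ B₂}) ∧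
      ∀ (Y : M) (m n : Nat' M), Equipotent M (El X ⊕ El m.1) (El Y ⊕ El n.1) →
        Ell2Iso R (El Y) (El X) ∧
        (m ≠ n → ¬ Equipotent M (El Y) (El X)) ∧
        (IsRussell M (El X) → (IsRussell M (El Y) ↔ (IsEvenNat m ↔ IsEvenNat n))) := by
  have : Fact (IsModelZF M) := ⟨hM⟩
  refine ⟨nonempty_realField, fun R X hX hcX => ?_⟩
  obtain ⟨A, hA, hAd, hAn⟩ := exists_disjoint_seq hcX
  have hiso : Ell2Iso R (El X) (El X ⊕ Nat' M) := ell2Iso_sum_nat hA hAd hAn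
  refine ⟨hiso, ?_, fun Y m n h => ⟨?_, fun hmn hYX => hmn ?_, fun hRX => ?_⟩⟩
  · obtain ⟨B₁, hB₁, e₁⟩ :=
      exists_orthonormalBasis (M := M) (R := R) (.of_equipotent (.refl (α := El X)))
    obtain ⟨B₂, hB₂, e₂⟩ := exists_orthonormalBasis hiso.symm
    have : MSet M {e // e ∈ B₁} := MSet.subtype hB₁.internal
    have : MSet M {e // e ∈ B₂} := MSet.subtype hB₂.internal
    have d₁ : DedekindFinite M {e // e ∈ B₁} := .of_equipotent e₁ hX
    have d₂ : ¬ DedekindFinite M {e // e ∈ B₂} := fun hd =>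
      not_dedekindFinite_of_injective (M := M) (g := (Sum.inr : Nat' M → El X ⊕ Nat' M))
        (by fun_prop) Sum.inr_injective (hd.of_equipotent e₂.symm)
    exact ⟨B₁, B₂, hB₁, hB₂, e₁, d₁, e₂, d₂, fun h => d₂ (d₁.of_equipotent h.symm)⟩
  -- ℓ²(Y) ≅ ℓ²(Y ⊔ ℕ) ≅ ℓ²(X ⊔ ℕ) ≅ ℓ²(X); the first step needs blocks in `Y` itself.
  · obtain ⟨B, hB, hBd, hBn⟩ := exists_disjoint_seq_of_equipotent h hA hAd hAn
    exact (ell2Iso_sum_nat hB hBd hBn).trans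
      ((Ell2Iso.of_equipotent (equipotent_sum_nat h).symm).trans hiso.symm)
  · exact nat_eq_of_equipotent_sum hX (h.trans (hYX.sum .refl))
  · rw [isRussell_iff] at hRX ⊢
    rw [and_iff_right (DedekindFinite.of_equipotent_sum h hX)]
    exact hasPairing_iff_of_equipotent h hX hRX.2
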